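/- A partition is a finite non-increasing sequence of positive integers. For a partition $\pi$ let $s(\pi)$ be its smallest part, $\ell(\pi)$ its largest part and $\#(\pi)$ its number of parts, with $s(\emptyset)=\infty$ and $\ell(\emptyset)=0$. A quadruple $(\pi_1,\pi_2,\pi_3,\pi_4)$ of partitions is a partition quadruple of $n$ if the sum of all parts of the four partitions is $n$. Let $$U=\{(\pi_1,\pi_2,\pi_3,\pi_4):\ \ell(\pi_4)\le 2s(\pi_1)<\infty,\ s(\pi_1)\le s(\pi_i)\text{ for } i=2,3,4\},$$ and let $V$ be the set of those quadruples in $U$ for which $s(\pi_1)$ appears at least twice as a part of $\pi_1$. Let $u(n)$ and $v(n)$ be the numbers of partition quadruples of $n$ in $U$ and in $V$. Let $\omega(\pi_1,\pi_2,\pi_3,\pi_4)$ be the number of parts of $\pi_1$ that are either equal to $s(\pi_1)$ or larger than $s(\pi_1)+\#(\pi_4)$, and put $$u\text{-rank}=\omega-1+2\#(\pi_2)-2\#(\pi_3)-\#(\pi_4),\qquad v\text{-rank}=\omega-2+2\#(\pi_2)-2\#(\pi_3)-\#(\pi_4).$$ Write $(a;q)_n=\prod_{j=0}^{n-1}(1-aq^j)$,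 $(a;q)_\infty=\prod_{j\ge 0}(1-aq^j)$ and $(a_1,\dots,a_k;q)_n=(a_1;q)_n\cdots(a_k;q)_n$ (also for $n=\infty$). Define, as formal power series in $q$, $$F(\rho_1,\rho_2,z;q)=\frac{(q;q)_\infty}{(z,z^{-1},\rho_1,\rho_2;q)_\infty}\sum_{n=1}^\infty\frac{(z,z^{-1},\rho_1,\rho_2;q)_n\left(\frac{q}{\rho_1\rho_2}\right)^n}{(q;q)_{2n}},$$ $$G(\rho_1,\rho_2,z;q)=\frac{(q;q)_\infty}{(z,z^{-1},\rho_1,\rho_2;q)_\infty}\sum_{n=1}^\infty\frac{(z,z^{-1},\rho_1,\rho_2;q)_n\left(\frac{q^2}{\rho_1\rho_2}\right)^n}{(q;q)_{2n}},$$ and let $ru(m,n)$ and $rv(m,n)$ be the coefficients of $z^mq^n$ in $RU(z,q)=F(z^2,z^{-2},z;q)$ and $RV(z,q)=G(z^2,z^{-2},z;q)$. **Theorem.** For all $m\in\mathbb Z$ and $n\ge 0$, $ru(m,n)$ is the number of partition quadruples of $n$ in $U$ with $u$-rank equal to $m$, and $rv(m,n)$ is the number of partition quadruples of $n$ in $V$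 with $v$-rank equal to $m$. Furthermore, for all $n\ge 0$: (i) the residue of the $u$-rank mod $3$ divides the partition quadruples of $3n$ in $U$ into $3$ equal classes; (ii) the residue of the $v$-rank mod $3$ divides the partition quadruples of $3n+1$ in $V$ into $3$ equal classes; (iii) the residue of the $u$-rank mod $5$ divides the partition quadruples of $5n$ and of $5n+3$ in $U$ into $5$ equal classes; (iv) the residue of the $v$-rank mod $5$ divides the partition quadruples of $5n+1$ and of $5n+4$ in $V$ into $5$ equal classes; (v) the residue of the $u$-rank mod $7$ divides the partition quadruples of $7n$ and of $7n+5$ in $U$ into $7$ equal classes. Consequently $u(3n)\equiv v(3n+1)\equiv 0\pmod 3$, $u(5n)\equiv u(5n+3)\equiv v(5n+1)\equiv v(5n+4)\equiv 0\pmod 5$ and $u(7n)\equiv u(7n+5)\equiv 0\pmod 7$. -/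

import Mathlib

namespace RankQuadruples

/-! ### Partitions and partition quadruples -/

/-- A partition (of some nonnegative integer `p.1`); the empty partition is the partition of `0`. -/
abbrev Ptn : Type := Σ n : ℕ, n.Partition

/-- The number of parts `#(π)`. -/
def numParts (p : Ptn) : ℕ := p.2.parts.card

/-- The smallest part `s(π)`, with `s(π) = ∞` for the empty partition. -/
noncomputable def smallest (p : Ptn) : ℕ∞ := (p.2.parts.map (fun i : ℕ => (i : ℕ∞))).inf

/-- The largest part `ℓ(π)`, with `ℓ(π) = 0` for the empty partition. -/
def largest (p : Ptn) : ℕ := p.2.parts.sup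

/-- A quadruple of partitions. -/
@[ext] structure Quad where
  p1 : Ptn
  p2 : Ptn
  p3 : Ptn
  p4 : Ptn

/-- The integer of which `(π₁, π₂, π₃, π₄)` is a partition quadruple: the sum of all the parts. -/
def Quad.size (π : Quad) : ℕ := π.p1.1 + π.p2.1 + π.p3.1 + π.p4.1

/-- `U`: the quadruples with `ℓ(π₄) ≤ 2 s(π₁) < ∞` and `s(π₁) ≤ s(πᵢ)` for `i = 2, 3, 4`. -/
def U : Set Quad :=
  {π | (largest π.p4 : ℕ∞) ≤ 2 * smallest π.p1 ∧ 2 * smallest π.p1 < ⊤ ∧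
    smallest π.p1 ≤ smallest π.p2 ∧ smallest π.p1 ≤ smallest π.p3 ∧
    smallest π.p1 ≤ smallest π.p4}

/-- `V`: the quadruples in `U` such that the smallest part of `π₁` appears at least twice
in `π₁`. -/
def V : Set Quad :=
  {π | π ∈ U ∧ 2 ≤ (π.p1.2.parts.filter (fun i : ℕ => (i : ℕ∞) = smallest π.p1)).card}

/-- `ω(π₁, π₂, π₃, π₄)`: the number of parts of `π₁` (with multiplicity) that are either `s(π₁)`
or larger than `s(π₁) + #(π₄)`. -/
noncomputable def omegaStat (π : Quad) : ℕ :=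
  (π.p1.2.parts.filter (fun i : ℕ =>
    (i : ℕ∞) = smallest π.p1 ∨ smallest π.p1 + (numParts π.p4 : ℕ∞) < (i : ℕ∞))).card

noncomputable def uRank (π : Quad) : ℤ :=
  (omegaStat π : ℤ) - 1 + 2 * (numParts π.p2 : ℤ) - 2 * (numParts π.p3 : ℤ) - (numParts π.p4 : ℤ)

noncomputable def vRank (π : Quad) : ℤ :=
  (omegaStat π : ℤ) - 2 + 2 * (numParts π.p2 : ℤ) - 2 * (numParts π.p3 : ℤ) - (numParts π.p4 : ℤ)

/-- There are finitely many partition quadruples of `n`, so that each `Set.ncard` below is a true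
count. -/
theorem finite_size_eq (n : ℕ) : {π : Quad | π.size = n}.Finite := by
  have hfin : {p : Ptn | p.1 ≤ n}.Finite := by
    have : {p : Ptn | p.1 ≤ n} = ⋃ k ∈ Set.Iic n, Set.range (fun q : k.Partition => (⟨k, q⟩ : Ptn)) := by
      ext ⟨k, q⟩
      simp only [Set.mem_ofPred_eq, Set.mem_iUnion, Set.mem_Iic, Set.mem_range]
      constructor
      · intro h
        exact ⟨k, h, q, rfl⟩
      · rintro ⟨j, hj, q', h⟩
        cases h
        exact hj
    rw [this]
    exact (Set.finite_Iic n).biUnion (fun k _ => Set.finite_range _)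
  let f : Quad → Ptn × Ptn × Ptn × Ptn := fun π => (π.p1, π.p2, π.p3, π.p4)
  have hf : Function.Injective f := by
    rintro ⟨a, b, c, d⟩ ⟨a', b', c', d'⟩ h
    simp only [f, Prod.mk.injEq] at h
    obtain ⟨rfl, rfl, rfl, rfl⟩ := h
    rfl
  refine Set.Finite.of_finite_image (f := f) ?_ hf.injOn
  refine (hfin.prod (hfin.prod (hfin.prod hfin))).subset ?_
  rintro _ ⟨π, hπ, rfl⟩
  simp only [Set.mem_ofPred_eq, Quad.size] at hπ
  simp only [f, Set.mem_prod, Set.mem_ofPred_eq]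
  omega

/-- `u(n)`: the number of partition quadruples of `n` in `U`. -/
noncomputable def u (n : ℕ) : ℕ := {π : Quad | π ∈ U ∧ π.size = n}.ncard

/-- `v(n)`: the number of partition quadruples of `n` in `V`. -/
noncomputable def v (n : ℕ) : ℕ := {π : Quad | π ∈ V ∧ π.size = n}.ncard

/-- The number of partition quadruples of `n` in `U` with `u`-rank equal to `m`. -/
noncomputable def uRankCount (m : ℤ) (n : ℕ) : ℕ :=
  {π : Quad | π ∈ U ∧ π.size = n ∧ uRank π = m}.ncard

/-- The number of partition quadruples of `n` in `V` with `v`-rank equal to `m`. -/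
noncomputable def vRankCount (m : ℤ) (n : ℕ) : ℕ :=
  {π : Quad | π ∈ V ∧ π.size = n ∧ vRank π = m}.ncard

/-- The number of partition quadruples of `n` in `U` with `u`-rank congruent to `k` modulo `l`. -/
noncomputable def uClass (k : ℤ) (l n : ℕ) : ℕ :=
  {π : Quad | π ∈ U ∧ π.size = n ∧ uRank π ≡ k [ZMOD (l : ℤ)]}.ncard

/-- The number of partition quadruples of `n` in `V` with `v`-rank congruent to `k` modulo `l`. -/
noncomputable def vClass (k : ℤ) (l n : ℕ) : ℕ :=
  {π : Quad | π ∈ V ∧ π.size = n ∧ vRank π ≡ k [ZMOD (l : ℤ)]}.ncard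

/-! ### The series `RU(z, q)` and `RV(z, q)`

They are formal power series in `q = PowerSeries.X` over a field `K`. -/

section Series

variable {K : Type*} [Field K]

/-- `(a; q)_n = ∏_{j < n} (1 - a q^j)`. -/
noncomputable def qPoch (a : PowerSeries K) (n : ℕ) : PowerSeries K :=
  ∏ j ∈ Finset.range n, (1 - a * PowerSeries.X ^ j)

/-- `(a; q)_∞ = ∏_{j ≥ 0} (1 - a q^j)`. The factors with `j > n` do not change the coefficient of
`q^n`, so this coefficient is that of `(a; q)_{n+1}`; see `coeff_qPoch`. -/
noncomputable def qPochInf (a : PowerSeries K) : PowerSeries K :=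
  PowerSeries.mk fun n => PowerSeries.coeff n (qPoch a (n + 1))

theorem coeff_qPoch (a : PowerSeries K) {n N : ℕ} (h : n < N) :
    PowerSeries.coeff n (qPoch a N) = PowerSeries.coeff n (qPochInf a) := by
  induction N, (Nat.succ_le_of_lt h) using Nat.le_induction with
  | base => simp [qPochInf]
  | succ M hM ih =>
    have hM' : n < M := hM
    rw [← ih hM', qPoch, Finset.prod_range_succ, ← qPoch, mul_sub, mul_one, map_sub, ← mul_assoc,
      PowerSeries.coeff_mul_X_pow', if_neg (by omega), sub_zero]

/-- The term of index `n` of the series that define `F` (for `e = 1`) and `G` (for `e = 2`):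
`(z, z⁻¹, ρ₁, ρ₂; q)_n (q^e / (ρ₁ ρ₂))^n / (q; q)_{2n}`. -/
noncomputable def seriesTerm (e : ℕ) (ρ₁ ρ₂ z : K) (n : ℕ) : PowerSeries K :=
  qPoch (PowerSeries.C z) n * qPoch (PowerSeries.C z⁻¹) n *
    qPoch (PowerSeries.C ρ₁) n * qPoch (PowerSeries.C ρ₂) n *
    (PowerSeries.X ^ e * PowerSeries.C (ρ₁ * ρ₂)⁻¹) ^ n *
    (qPoch PowerSeries.X (2 * n))⁻¹

theorem coeff_seriesTerm_eq_zero {e : ℕ} (he : 1 ≤ e) (ρ₁ ρ₂ z : K) {n N : ℕ} (h : N < n) :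
    PowerSeries.coeff N (seriesTerm e ρ₁ ρ₂ z n) = 0 := by
  have hd : (PowerSeries.X : PowerSeries K) ^ n ∣ seriesTerm e ρ₁ ρ₂ z n := by
    refine Dvd.dvd.mul_right (Dvd.dvd.mul_left ?_ _) _
    rw [mul_pow]
    exact Dvd.dvd.mul_right (pow_dvd_pow_of_dvd (dvd_pow_self _ (by omega)) n) _
  exact PowerSeries.X_pow_dvd_iff.1 hd N h

/-- `∑_{n ≥ 1} seriesTerm n`. For `e ≥ 1` only the terms with `n ≤ N` contribute to the coefficient of
`q^N`; see `coeff_seriesTerm_eq_zero`. -/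
noncomputable def termSum (e : ℕ) (ρ₁ ρ₂ z : K) : PowerSeries K :=
  PowerSeries.mk fun N => ∑ n ∈ Finset.Icc 1 N, PowerSeries.coeff N (seriesTerm e ρ₁ ρ₂ z n)

/-- `(q; q)_∞ / (z, z⁻¹, ρ₁, ρ₂; q)_∞`; the division is meaningful when none of `z`, `z⁻¹`, `ρ₁`,
`ρ₂` is `1`. -/
noncomputable def prefactor (ρ₁ ρ₂ z : K) : PowerSeries K :=
  qPochInf PowerSeries.X *
    (qPochInf (PowerSeries.C z) * qPochInf (PowerSeries.C z⁻¹) *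
      qPochInf (PowerSeries.C ρ₁) * qPochInf (PowerSeries.C ρ₂))⁻¹

/-- `F(ρ₁, ρ₂, z; q) = (q)_∞ / (z, z⁻¹, ρ₁, ρ₂)_∞ ·
  ∑_{n ≥ 1} (z, z⁻¹, ρ₁, ρ₂)_n (q / (ρ₁ρ₂))^n / (q)_{2n}`. -/
noncomputable def F (ρ₁ ρ₂ z : K) : PowerSeries K := prefactor ρ₁ ρ₂ z * termSum 1 ρ₁ ρ₂ z

/-- `G(ρ₁, ρ₂, z; q) = (q)_∞ / (z, z⁻¹, ρ₁, ρ₂)_∞ ·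
  ∑_{n ≥ 1} (z, z⁻¹, ρ₁, ρ₂)_n (q² / (ρ₁ρ₂))^n / (q)_{2n}`. -/
noncomputable def G (ρ₁ ρ₂ z : K) : PowerSeries K := prefactor ρ₁ ρ₂ z * termSum 2 ρ₁ ρ₂ z

end Series

/-- The indeterminate `z`, in the field of formal Laurent series `ℚ((z))`. -/
noncomputable def zVar : LaurentSeries ℚ := HahnSeries.single (1 : ℤ) (1 : ℚ)

/-- `RU(z, q) = F(z², z⁻², z; q)`, a power series in `q`. -/
noncomputable def RU : PowerSeries (LaurentSeries ℚ) := F (zVar ^ 2) (zVar ^ 2)⁻¹ zVar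

/-- `RV(z, q) = G(z², z⁻², z; q)`, a power series in `q`. -/
noncomputable def RV : PowerSeries (LaurentSeries ℚ) := G (zVar ^ 2) (zVar ^ 2)⁻¹ zVar

/-- The coefficient `ru(m, n)` of `z^m q^n` in `RU(z, q)`. -/
noncomputable def ru (m : ℤ) (n : ℕ) : ℚ := (PowerSeries.coeff n RU).coeff m

/-- The coefficient `rv(m, n)` of `z^m q^n` in `RV(z, q)`. -/
noncomputable def rv (m : ℤ) (n : ℕ) : ℚ := (PowerSeries.coeff n RV).coeff m

end RankQuadruples

open RankQuadruples

/-! The proof is combinatorial up to the vanishing of certain coefficients at a root of unity; that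
vanishing is proved analytically.

Rank interpretation. Since ρ₁ρ₂ = 1, the prefactor times the N-th term is q^{eN} (q^{2N+1})_∞ /
(zq^N, q^N/z, z²q^N, q^N/z²)_∞, with e = 1 for `F` and e = 2 for `G` (`prefactor_mul_seriesTerm`).
The factors with z² and 1/z² generate π₂ and π₃. The q-binomial theorem expands (q^{2N+1})_∞ /
(q^N/z)_∞ as the sum over k of z^{-k} q^{Nk} (zq^{N+1})_k / (q)_k. After multiplying and dividing by
(q^{N+1})_k, the quotient q^{Nk} (q^{N+1})_k / (q)_k counts the π₄ with k parts in [N, 2N], and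
(zq^{N+1})_k / ((q^{N+1})_k (zq^N)_∞) counts the parts of π₁, with z marking those equal to N or
larger than N + k. The factor q^{eN} forces e copies of N into π₁. The result is
`coeff_eq_sum_quad`, over any field.

Equal classes. For a primitive root of unity ζ of prime order l, the sum of ζ^rank is zero only if
all residue classes have the same size, because the cyclotomic polynomial is the minimal polynomial
of ζ (`mul_card_filter_eq_card`). It remains to show that the coefficients of q^{ln+a} vanish at z =
ζ.

Bilateral series. For |q| < 1/2 the formal series converge. The finite Jacobi triple product
(`jtpSum_eq`) expands (z, 1/z)_n / (q)_{2n}, and the sum over n then telescopes. So the series,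
completed by its term n = 0 and multiplied by a theta function of z, is a bilateral sum with
denominators (1 - wq^r)(1 - q^r/w), where w = ζ² (`fullSeries_one`, `fullSeries_two`). The completed
series is symmetric in z and w, which gives a second equation.

Dissection. At l-th roots of unity these denominators divide 1 - q^{lr}, and splitting r modulo l
yields Appell–Lerch sums whose exponents lie in a single class modulo l (`dissect_aux`,
`homog_lser`). Theta functions dissect in the same way. The Appell–Lerch combinations in the
relevant classes are evaluated as theta quotients by `appell_one`, `appell_transformation` and
`appell_transformation_one`, and they agree with the same classes of the added term n = 0, so the
original series has none. For l = 3 the added term is governed by Jacobi's series for (q)_∞³. For l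
= 5 one of two theta functions is eliminated between the two equations. For l = 7 three theta
functions remain, tied by the Klein quartic, and three equations for the classes 0, 3, 5 lead to a
linear system with non-zero determinant near q = 0. -/

namespace RankQuadruples

open PowerSeries Finset

section GeneratingFunctions

variable {K : Type*} [Field K]

/-! ### Generating functions of weighted partitions -/

/-- The generating function of the partitions, weighted by a function of the multiset of parts. -/
noncomputable def gf (W : Multiset ℕ → K) : PowerSeries K :=
  PowerSeries.mk fun n => ∑ p : n.Partition, W p.parts

theorem coeff_gf (W : Multiset ℕ → K) (n : ℕ) :
    coeff n (gf W) = ∑ p : n.Partition, W p.parts := by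
  simp [gf]

theorem gf_add (W W' : Multiset ℕ → K) : gf (fun s => W s + W' s) = gf W + gf W' := by
  ext n; simp [coeff_gf, Finset.sum_add_distrib]

/-- Erasing one copy of `i` is a bijection onto the partitions of `n - i`; the weight on the right
sees the erased part put back. -/
theorem gf_insert (W : Multiset ℕ → K) {i : ℕ} (hi : 0 < i) :
    gf (fun s => if i ∈ s then W s else 0) = X ^ i * gf (fun s => W (i ::ₘ s)) := by
  ext n
  rw [coeff_X_pow_mul', coeff_gf]
  split_ifs with hin
  · rw [coeff_gf, ← Finset.sum_filter]
    refine Finset.sum_bij'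
      (fun (p : n.Partition) hp => (⟨p.parts.erase i, fun {j} hj => p.parts_pos
          (Multiset.mem_of_mem_erase hj), by
            have h1 := p.parts_sum
            have h2 := Multiset.sum_erase (Finset.mem_filter.1 hp).2
            omega⟩ : (n - i).Partition))
      (fun (p : (n - i).Partition) _ => (⟨i ::ₘ p.parts, fun {j} hj => by
          rcases Multiset.mem_cons.1 hj with rfl | hj
          · exact hi
          · exact p.parts_pos hj, by
            have h1 := p.parts_sum
            rw [Multiset.sum_cons]; omega⟩ : n.Partition)) ?_ ?_ ?_ ?_ ?_
    · intro p hp; exact Finset.mem_univ _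
    · intro p hp; simp
    · intro p hp
      ext1
      simp [Multiset.cons_erase (Finset.mem_filter.1 hp).2]
    · intro p hp
      ext1
      simp
    · intro p hp
      simp [Multiset.cons_erase (Finset.mem_filter.1 hp).2]
  · refine Finset.sum_eq_zero fun p _ => if_neg fun h => hin ?_
    have h1 := p.parts_sum
    have h2 := Multiset.le_sum_of_mem h
    omega

theorem gf_split (W : Multiset ℕ → K) {i : ℕ} (hi : 0 < i) :
    gf W = gf (fun s => if i ∈ s then 0 else W s) + X ^ i * gf (fun s => W (i ::ₘ s)) := by
  rw [← gf_insert W hi, ← gf_add]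
  congr 1
  ext s
  split_ifs <;> simp

/-- The multiplicative weight of a partition attached to a weight of its parts. -/
def partWeight (x : ℕ → K) (s : Multiset ℕ) : K := (s.map x).prod

/-- The weight `x` restricted to the parts that are at least `N`. -/
def tail (x : ℕ → K) (N : ℕ) : ℕ → K := fun i => if i < N then 0 else x i

theorem partWeight_tail (x : ℕ → K) (N : ℕ) (s : Multiset ℕ) :
    partWeight (tail x N) s = if ∀ i ∈ s, N ≤ i then partWeight x s else 0 := by
  induction s using Multiset.induction_on with
  | empty => simp [partWeight]
  | cons a s ih =>
    simp only [partWeight, Multiset.map_cons, Multiset.prod_cons, Multiset.mem_cons] at ih ⊢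
    rw [ih]
    by_cases ha : a < N
    · simp [tail, ha, not_le.2 ha]
    · simp [tail, ha, not_lt.1 ha]

/-- A multiplicative weight loses exactly the factor `x N` when a part `N` is removed, so the
partitions containing `N` reproduce the whole series. Iteration yields Euler products one factor at
a time. -/
theorem gf_tail_succ (x : ℕ → K) {N : ℕ} (hN : 0 < N) :
    gf (partWeight (tail x N)) * (1 - C (x N) * X ^ N) = gf (partWeight (tail x (N + 1))) := by
  have h := gf_split (partWeight (tail x N)) hN
  have h1 : gf (fun s => partWeight (tail x N) (N ::ₘ s)) =
      C (x N) * gf (partWeight (tail x N)) := by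
    ext n
    simp [coeff_gf, coeff_C_mul, partWeight, tail, Finset.mul_sum]
  have h2 : gf (fun s => if N ∈ s then 0 else partWeight (tail x N) s) =
      gf (partWeight (tail x (N + 1))) := by
    congr 1
    ext s
    rw [partWeight_tail, partWeight_tail]
    by_cases hs : ∀ i ∈ s, N + 1 ≤ i
    · have : N ∉ s := fun h => absurd (hs N h) (by omega)
      rw [if_neg this, if_pos hs, if_pos fun i hi => (Nat.le_succ N).trans (hs i hi)]
    · rw [if_neg hs]
      split_ifs with h1 h2
      · rfl
      · exfalso
        apply hs
        intro i hi
        have := h2 i hi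
        rcases this.lt_or_eq with h | h
        · exact h
        · exact absurd (h ▸ hi) h1
      · rfl
  rw [h1, h2] at h
  linear_combination h

theorem gf_tail_mul_prod (x : ℕ → K) {N : ℕ} (hN : 0 < N) (k : ℕ) :
    gf (partWeight (tail x N)) * ∏ j ∈ range k, (1 - C (x (N + j)) * X ^ (N + j)) =
      gf (partWeight (tail x (N + k))) := by
  induction k with
  | zero => simp
  | succ k ih =>
    rw [Finset.prod_range_succ, ← mul_assoc, ih, gf_tail_succ _ (by omega)]
    rfl

/-- A non-empty partition into parts at least `N` has size at least `N`. Infinite products are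
compared through such congruences modulo powers of q. -/
theorem X_pow_dvd_gf_tail_sub_one (x : ℕ → K) (N : ℕ) :
    X ^ N ∣ gf (partWeight (tail x N)) - 1 := by
  rw [X_pow_dvd_iff]
  intro m hm
  rw [map_sub, coeff_gf, coeff_one]
  split_ifs with h0
  · subst h0
    rw [Fintype.sum_unique]
    simp [partWeight]
  · rw [sub_zero]
    refine Finset.sum_eq_zero fun p _ => ?_
    rw [partWeight_tail, if_neg]
    intro h
    obtain ⟨i, hi⟩ : ∃ i, i ∈ p.parts := by
      refine Multiset.exists_mem_of_ne_zero fun h' => h0 ?_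
      have := p.parts_sum
      simpa [h'] using this.symm
    have h1 := p.parts_sum
    have h2 := Multiset.le_sum_of_mem hi
    have h3 := h i hi
    omega

/-! ### Formal `q`-Pochhammer symbols -/

theorem eq_of_forall_X_pow_dvd {f g : PowerSeries K} (h : ∀ M : ℕ, X ^ M ∣ f - g) : f = g := by
  ext n
  have := X_pow_dvd_iff.1 (h (n + 1)) n (Nat.lt_succ_self n)
  rwa [map_sub, sub_eq_zero] at this

theorem X_pow_dvd_qPochInf_sub (a : PowerSeries K) (M : ℕ) : X ^ M ∣ qPochInf a - qPoch a M := by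
  rw [X_pow_dvd_iff]
  intro m hm
  rw [map_sub, coeff_qPoch a hm, sub_self]

theorem qPoch_add (a : PowerSeries K) (m n : ℕ) :
    qPoch a (m + n) = qPoch a m * qPoch (a * X ^ m) n := by
  simp only [qPoch, Finset.prod_range_add]
  congr 1
  exact Finset.prod_congr rfl fun j _ => by ring

theorem qPoch_succ (a : PowerSeries K) (n : ℕ) :
    qPoch a (n + 1) = qPoch a n * (1 - a * X ^ n) := by
  simp only [qPoch, Finset.prod_range_succ]

theorem qPoch_succ' (a : PowerSeries K) (n : ℕ) :
    qPoch a (n + 1) = (1 - a) * qPoch (a * X) n := by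
  rw [add_comm, qPoch_add]; simp [qPoch]

theorem qPochInf_split (a : PowerSeries K) (m : ℕ) :
    qPochInf a = qPoch a m * qPochInf (a * X ^ m) := by
  refine eq_of_forall_X_pow_dvd fun M => ?_
  have h1 := X_pow_dvd_qPochInf_sub a (m + M)
  have h2 := X_pow_dvd_qPochInf_sub (a * X ^ m) M
  have h3 : qPochInf a - qPoch a m * qPochInf (a * X ^ m) =
      (qPochInf a - qPoch a (m + M)) -
        qPoch a m * (qPochInf (a * X ^ m) - qPoch (a * X ^ m) M) := by
    rw [qPoch_add]; ring
  rw [h3]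
  exact dvd_sub ((pow_dvd_pow _ (by omega)).trans h1) (h2.mul_left _)

theorem constantCoeff_qPoch (a : PowerSeries K) (h : constantCoeff a = 0) (n : ℕ) :
    constantCoeff (qPoch a n) = 1 := by
  simp [qPoch, map_prod, h]

theorem constantCoeff_qPochInf (a : PowerSeries K) :
    constantCoeff (qPochInf a) = 1 - constantCoeff a := by
  rw [← coeff_zero_eq_constantCoeff_apply, ← coeff_qPoch a Nat.zero_lt_one]
  simp [qPoch]

theorem gf_tail_const (c : K) {N : ℕ} (hN : 0 < N) :
    gf (partWeight (tail (fun _ => c) N)) * qPochInf (C c * X ^ N) = 1 := by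
  refine eq_of_forall_X_pow_dvd fun M => ?_
  have h1 := gf_tail_mul_prod (fun _ => c) hN M
  have h2 : ∏ j ∈ range M, (1 - C c * X ^ (N + j)) = qPoch (C c * X ^ N) M := by
    simp only [qPoch]
    exact Finset.prod_congr rfl fun j _ => by ring
  rw [h2] at h1
  have h3 := X_pow_dvd_gf_tail_sub_one (fun _ => c) (N + M)
  have h4 := X_pow_dvd_qPochInf_sub (C c * X ^ N) M
  have : gf (partWeight (tail (fun _ => c) N)) * qPochInf (C c * X ^ N) - 1 =
      gf (partWeight (tail (fun _ => c) N)) *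
        (qPochInf (C c * X ^ N) - qPoch (C c * X ^ N) M) +
      (gf (partWeight (tail (fun _ => c) (N + M))) - 1) := by
    rw [← h1]; ring
  rw [this]
  exact dvd_add (h4.mul_left _) ((pow_dvd_pow _ (by omega)).trans h3)

/-- The `q`-binomial theorem, modulo a power of `q`. -/
theorem X_pow_dvd_qBinomial (a x : PowerSeries K) (hx : X ∣ x) (M : ℕ) :
    X ^ M ∣ (∑ k ∈ range M, x ^ k * (qPoch a k * (qPoch X k)⁻¹)) * qPochInf x -
      qPochInf (a * x) := by
  set c : ℕ → PowerSeries K := fun k => qPoch a k * (qPoch X k)⁻¹ with hc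
  have hcs : ∀ k, c (k + 1) * (1 - X ^ (k + 1)) = c k * (1 - a * X ^ k) := by
    intro k
    have h1 : constantCoeff (qPoch (X : PowerSeries K) k) ≠ 0 := by
      rw [constantCoeff_qPoch _ (by simp)]; exact one_ne_zero
    have h2 : constantCoeff (qPoch (X : PowerSeries K) (k + 1)) ≠ 0 := by
      rw [constantCoeff_qPoch _ (by simp)]; exact one_ne_zero
    have e1 := PowerSeries.mul_inv_cancel _ h1
    have e2 := PowerSeries.mul_inv_cancel _ h2
    rw [qPoch_succ] at e2
    simp only [hc]
    rw [qPoch_succ a k]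
    rw [qPoch_succ X k] at *
    have e3 : (qPoch X k * (1 - X * X ^ k))⁻¹ * (1 - X ^ (k + 1)) = (qPoch (X : PowerSeries K) k)⁻¹ := by
      linear_combination (qPoch (X : PowerSeries K) k)⁻¹ * e2 -
        ((qPoch X k * (1 - X * X ^ k))⁻¹ * (1 - X ^ (k + 1))) * e1
    linear_combination qPoch a k * (1 - a * X ^ k) * e3
  set B : PowerSeries K → PowerSeries K := fun y => ∑ k ∈ range M, y ^ k * c k with hB
  -- The full series satisfies B(y)(1 - y) = (1 - ay)B(qy). Truncation leaves a boundary term with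
  -- the factor y^M, which q^M divides because q divides y.
  have hstep : ∀ y : PowerSeries K, X ∣ y → X ^ M ∣ B y * (1 - y) - (1 - a * y) * B (y * X) := by
    intro y hy
    have : B y * (1 - y) - (1 - a * y) * B (y * X) = - (c M * y ^ M * (1 - X ^ M)) := by
      have key : ∀ m, (∑ k ∈ range m, y ^ k * c k) * (1 - y) -
          (1 - a * y) * (∑ k ∈ range m, (y * X) ^ k * c k) = - (c m * y ^ m * (1 - X ^ m)) := by
        intro m
        induction m with
        | zero => simp
        | succ m ih =>
          rw [Finset.sum_range_succ, Finset.sum_range_succ]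
          linear_combination ih + y ^ (m + 1) * hcs m
      exact key M
    rw [this]
    exact (((pow_dvd_pow_of_dvd hy M).mul_left _).mul_right _).neg_right
  -- Iteration moves the argument to x q^J. At J = M every term of the sum except k = 0 is divisible
  -- by q^M.
  have hiter : ∀ J, X ^ M ∣ B x * qPoch x J - qPoch (a * x) J * B (x * X ^ J) := by
    intro J
    induction J with
    | zero => simp [qPoch]
    | succ J ih =>
      have h1 := hstep (x * X ^ J) (hx.mul_right _)
      have : B x * qPoch x (J + 1) - qPoch (a * x) (J + 1) * B (x * X ^ (J + 1)) =
          (B x * qPoch x J - qPoch (a * x) J * B (x * X ^ J)) * (1 - x * X ^ J) +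
          qPoch (a * x) J * (B (x * X ^ J) * (1 - x * X ^ J) -
            (1 - a * (x * X ^ J)) * B (x * X ^ J * X)) := by
        rw [qPoch_succ, qPoch_succ, pow_succ, ← mul_assoc x]; ring
      rw [this]
      exact dvd_add (ih.mul_right _) (h1.mul_left _)
  have hB1 : X ^ M ∣ B (x * X ^ M) - 1 := by
    rcases Nat.eq_zero_or_pos M with rfl | hM
    · simp
    · simp only [hB]
      rw [← Nat.succ_pred_eq_of_pos hM, Finset.sum_range_succ']
      have : c 0 = 1 := by simp [hc, qPoch]
      rw [this, pow_zero, one_mul, add_sub_cancel_right]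
      refine Finset.dvd_sum fun k _ => ?_
      rw [pow_succ]
      exact (Dvd.dvd.mul_left (dvd_mul_left _ _) _).mul_right _
  have h1 := X_pow_dvd_qPochInf_sub x M
  have h2 := X_pow_dvd_qPochInf_sub (a * x) M
  have h3 := hiter M
  have : B x * qPochInf x - qPochInf (a * x) = B x * (qPochInf x - qPoch x M) +
      (B x * qPoch x M - qPoch (a * x) M * B (x * X ^ M)) +
      qPoch (a * x) M * (B (x * X ^ M) - 1) - (qPochInf (a * x) - qPoch (a * x) M) := by ring
  rw [show (∑ k ∈ range M, x ^ k * (qPoch a k * (qPoch X k)⁻¹)) = B x from rfl, this]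
  exact dvd_sub (dvd_add (dvd_add (h1.mul_left _) h3) (hB1.mul_left _)) h2

/-! ### Partitions in a box -/

/-- Partitions with exactly `k` parts, all of them in the interval `[N, N + L)`. -/
noncomputable def boxGf (K : Type*) [Field K] (N L k : ℕ) : PowerSeries K :=
  gf fun s => if (∀ i ∈ s, N ≤ i ∧ i < N + L) ∧ s.card = k then 1 else 0

theorem boxGf_zero_right (N L : ℕ) : boxGf K N L 0 = 1 := by
  ext n
  rw [boxGf, coeff_gf, coeff_one]
  split_ifs with h
  · subst h
    rw [Fintype.sum_unique]; simp
  · refine Finset.sum_eq_zero fun p _ => if_neg ?_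
    rintro ⟨-, h'⟩
    rw [Multiset.card_eq_zero] at h'
    have := p.parts_sum
    rw [h'] at this
    exact h (by simpa using this.symm)

theorem boxGf_zero_left (N k : ℕ) : boxGf K N 0 (k + 1) = 0 := by
  ext n
  rw [boxGf, coeff_gf, map_zero]
  refine Finset.sum_eq_zero fun p _ => if_neg ?_
  rintro ⟨h, h'⟩
  obtain ⟨i, hi⟩ := Multiset.card_pos_iff_exists_mem.1 (by omega : 0 < p.parts.card)
  have := h i hi
  omega

/-- Either the largest admissible value `N + L` does not occur, or one copy of it can be removed:
the q-Pascal rule. -/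
theorem boxGf_succ {N : ℕ} (hN : 0 < N) (L k : ℕ) :
    boxGf K N (L + 1) (k + 1) = boxGf K N L (k + 1) + X ^ (N + L) * boxGf K N (L + 1) k := by
  rw [boxGf, gf_split _ (by omega : 0 < N + L)]
  congr 1
  · rw [boxGf]
    congr 1
    ext s
    by_cases h : N + L ∈ s
    · rw [if_pos h, if_neg]
      rintro ⟨h1, -⟩
      have := h1 _ h
      omega
    · rw [if_neg h]
      refine if_congr (and_congr_left fun _ => forall₂_congr fun i hi => ?_) rfl rfl
      have : i ≠ N + L := fun h' => h (h' ▸ hi)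
      omega
  · rw [boxGf]
    congr 2
    ext s
    refine if_congr ?_ rfl rfl
    rw [Multiset.card_cons, Nat.add_right_cancel_iff]
    refine and_congr_left fun _ => ?_
    constructor
    · intro h i hi
      exact h i (Multiset.mem_cons_of_mem hi)
    · intro h i hi
      rcases Multiset.mem_cons.1 hi with rfl | hi
      · omega
      · exact h i hi

/-- After subtracting `N` from each part this is the Gaussian binomial coefficient, written without
division. The induction is on `k` and inside it on `L`. -/
theorem boxGf_mul_qPoch {N : ℕ} (hN : 0 < N) (L k : ℕ) :
    boxGf K N L k * qPoch X k = X ^ (N * k) * qPoch (X ^ L) k := by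
  induction k generalizing L with
  | zero => simp [boxGf_zero_right, qPoch]
  | succ k ih =>
    induction L with
    | zero => rw [boxGf_zero_left, pow_zero, qPoch_succ' 1]; simp
    | succ L ihL =>
      have h := ih (L + 1)
      rw [boxGf_succ hN, qPoch_succ (X ^ (L + 1))]
      rw [qPoch_succ' (X ^ L), ← pow_succ] at ihL
      rw [qPoch_succ X k] at ihL ⊢
      linear_combination ihL + X ^ (N + L) * (1 - X * X ^ k) * h

end GeneratingFunctions

end RankQuadruples

namespace RankQuadruples

open PowerSeries Finset

/-! ### From the terms of the series to weighted quadruples -/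

section Combinatorics

variable {K : Type*} [Field K]

theorem gf_count (W : Multiset ℕ → K) {N : ℕ} (hN : 0 < N) (e : ℕ) :
    gf (fun s => if e ≤ s.count N then W s else 0) =
      X ^ (e * N) * gf (fun s => W (Multiset.replicate e N + s)) := by
  induction e generalizing W with
  | zero => simp
  | succ e ih =>
    have h1 : (fun s : Multiset ℕ => if e + 1 ≤ s.count N then W s else 0) =
        fun s => if N ∈ s then (if e + 1 ≤ s.count N then W s else 0) else 0 := by
      ext s
      by_cases h : N ∈ s
      · simp [h]
      · simp [h]
    rw [h1, gf_insert _ hN]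
    have h2 : (fun s : Multiset ℕ => if e + 1 ≤ (N ::ₘ s).count N then W (N ::ₘ s) else 0) =
        fun s => if e ≤ s.count N then (fun t => W (N ::ₘ t)) s else 0 := by
      ext s; simp
    rw [h2, ih, ← mul_assoc, ← pow_add]
    congr 2
    · ring
    · ext s; simp [Multiset.replicate_succ]

theorem gf_const_mul (c : K) (W : Multiset ℕ → K) : gf (fun s => c * W s) = C c * gf W := by
  ext n; simp [coeff_gf, coeff_C_mul, Finset.mul_sum]

/-- The weight of the parts of `π₁`, when its smallest part is `N` and `π₄` has `k` parts. -/
def firstWeight (z : K) (N k : ℕ) (i : ℕ) : K := if i = N ∨ N + k < i then z else 1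

/-- The two weights differ only at the `k` sizes N + 1, …, N + k. Peeling these factors and the one
at `N` leaves the same tail on both sides, and the common factor 1 - zq^N cancels. -/
theorem gf_firstWeight (z : K) {N : ℕ} (hN : 0 < N) (k : ℕ) :
    gf (partWeight (tail (firstWeight z N k) N)) * qPoch (X ^ (N + 1)) k =
      gf (partWeight (tail (fun _ => z) N)) * qPoch (C z * X ^ (N + 1)) k := by
  have h1 := gf_tail_mul_prod (firstWeight z N k) hN (k + 1)
  have h2 := gf_tail_mul_prod (fun _ => z) hN (k + 1)
  have h3 : tail (firstWeight z N k) (N + (k + 1)) = tail (fun _ => z) (N + (k + 1)) := by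
    ext i
    simp only [tail, firstWeight]
    split_ifs with h h'
    · rfl
    · rfl
    · omega
  rw [h3, ← h2, Finset.prod_range_succ', Finset.prod_range_succ'] at h1
  have h4 : ∏ j ∈ range k, (1 - C (firstWeight z N k (N + (j + 1))) * X ^ (N + (j + 1))) =
      qPoch (X ^ (N + 1) : PowerSeries K) k := by
    refine Finset.prod_congr rfl fun j hj => ?_
    rw [Finset.mem_range] at hj
    rw [firstWeight, if_neg (by omega), map_one]
    ring
  have h5 : ∏ j ∈ range k, (1 - C z * X ^ (N + (j + 1))) =
      qPoch (C z * X ^ (N + 1) : PowerSeries K) k := by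
    refine Finset.prod_congr rfl fun j hj => by ring
  rw [h4, h5, firstWeight, if_pos (by simp)] at h1
  have h6 : (1 - C z * X ^ (N + 0) : PowerSeries K) ≠ 0 := by
    intro h
    have := congrArg constantCoeff h
    simp [hN.ne'] at this
  refine mul_right_cancel₀ h6 ?_
  simpa only [mul_assoc] using h1

theorem isUnit_qPoch_X (k : ℕ) : qPoch (X : PowerSeries K) k * (qPoch X k)⁻¹ = 1 :=
  PowerSeries.mul_inv_cancel _ (by rw [constantCoeff_qPoch _ (by simp)]; exact one_ne_zero)

/-- The factor (q^{N+1})_k cancels: it is the numerator of the count of `π₄`, whose parts take the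
`N + 1` values N, …, 2N, and the denominator due to the unmarked sizes N + 1, …, N + k in `π₁`. This
explains both the bound on the largest part of `π₄` and the definition of ω. -/
theorem C_mul_boxGf_mul_gf (z : K) {N : ℕ} (hN : 0 < N) (k : ℕ) :
    C (z⁻¹ ^ k) * boxGf K N (N + 1) k * gf (partWeight (tail (firstWeight z N k) N)) =
      gf (partWeight (tail (fun _ => z) N)) *
        ((C z⁻¹ * X ^ N) ^ k * (qPoch (C z * X ^ (N + 1)) k * (qPoch X k)⁻¹)) := by
  have h1 := gf_firstWeight z hN k
  have h2 := boxGf_mul_qPoch (K := K) hN (N + 1) k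
  have h3 := isUnit_qPoch_X (K := K) k
  have h4 : (C z⁻¹ * X ^ N : PowerSeries K) ^ k = C (z⁻¹ ^ k) * X ^ (N * k) := by
    rw [mul_pow, pow_mul, map_pow]
  rw [h4]
  linear_combination (C (z⁻¹ ^ k) * X ^ (N * k) * (qPoch X k)⁻¹) * h1
    + (C (z⁻¹ ^ k) * (qPoch X k)⁻¹ * gf (partWeight (tail (firstWeight z N k) N))) * h2
    - C (z⁻¹ ^ k) * boxGf K N (N + 1) k * gf (partWeight (tail (firstWeight z N k) N)) * h3

/-- The q-binomial theorem with a = zq^{N+1} and x = q^N/z, so that ax = q^{2N+1}. -/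
theorem X_pow_dvd_sum_boxGf (z : K) (hz : z ≠ 0) {N : ℕ} (hN : 0 < N) (M : ℕ) :
    X ^ M ∣ (∑ k ∈ range M, C (z⁻¹ ^ k) * boxGf K N (N + 1) k *
        gf (partWeight (tail (firstWeight z N k) N))) -
      gf (partWeight (tail (fun _ => z) N)) * gf (partWeight (tail (fun _ => z⁻¹) N)) *
        qPochInf (X ^ (2 * N + 1)) := by
  have h1 := X_pow_dvd_qBinomial (C z * X ^ (N + 1)) (C z⁻¹ * X ^ N : PowerSeries K)
    ((dvd_pow_self _ hN.ne').mul_left _) M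
  have h2 : (C z * X ^ (N + 1) * (C z⁻¹ * X ^ N) : PowerSeries K) = X ^ (2 * N + 1) := by
    have : (C z * C z⁻¹ : PowerSeries K) = 1 := by
      rw [← map_mul, mul_inv_cancel₀ hz, map_one]
    linear_combination X ^ (N + 1) * X ^ N * this
  rw [h2] at h1
  have h3 := gf_tail_const z⁻¹ hN
  simp_rw [C_mul_boxGf_mul_gf z hN]
  rw [← Finset.mul_sum]
  convert h1.mul_left (gf (partWeight (tail (fun _ => z) N)) *
    gf (partWeight (tail (fun _ => z⁻¹) N))) using 1
  linear_combination -gf (partWeight (tail (fun _ => z) N)) *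
    (∑ k ∈ range M, (C z⁻¹ * X ^ N) ^ k * (qPoch (C z * X ^ (N + 1)) k * (qPoch X k)⁻¹)) * h3

/-- The `N`-th summand of `F` and of `G`, up to a power of `q`. -/
noncomputable def summand (z : K) (N : ℕ) : PowerSeries K :=
  gf (partWeight (tail (fun _ => z) N)) * gf (partWeight (tail (fun _ => z⁻¹) N)) *
    gf (partWeight (tail (fun _ => z ^ 2) N)) * gf (partWeight (tail (fun _ => (z ^ 2)⁻¹) N)) *
      qPochInf (X ^ (2 * N + 1))

/-- Each infinite product splits after `N` factors, (q)_∞ after `2 * N`, and the finite parts cancel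
against the term of the series. The conditions on `z` make the constant term of the denominator of
the prefactor non-zero. -/
theorem prefactor_mul_seriesTerm (z : K) (hz : z ≠ 0) (h1 : z ≠ 1) (h2 : z ^ 2 ≠ 1) (e : ℕ)
    {N : ℕ} (hN : 0 < N) :
    prefactor (z ^ 2) (z ^ 2)⁻¹ z * seriesTerm e (z ^ 2) (z ^ 2)⁻¹ z N =
      X ^ (e * N) * summand z N := by
  have hz2 : z ^ 2 ≠ 0 := pow_ne_zero 2 hz
  have hI : (qPochInf (C z) * qPochInf (C z⁻¹) * qPochInf (C (z ^ 2)) *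
      qPochInf (C (z ^ 2)⁻¹)) * (qPochInf (C z) * qPochInf (C z⁻¹) * qPochInf (C (z ^ 2)) *
      qPochInf (C (z ^ 2)⁻¹))⁻¹ = 1 := by
    refine PowerSeries.mul_inv_cancel _ ?_
    simp only [map_mul, constantCoeff_qPochInf, constantCoeff_C]
    have a1 : (1 - z) ≠ 0 := sub_ne_zero.2 h1.symm
    have a2 : (1 - z⁻¹) ≠ 0 := sub_ne_zero.2 fun h => h1 (by simpa using h.symm)
    have a3 : (1 - z ^ 2) ≠ 0 := sub_ne_zero.2 h2.symm
    have a4 : (1 - (z ^ 2)⁻¹) ≠ 0 := sub_ne_zero.2 fun h => h2 (inv_eq_one.1 h.symm)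
    exact mul_ne_zero (mul_ne_zero (mul_ne_zero a1 a2) a3) a4
  have s1 := qPochInf_split (C z) N
  have s2 := qPochInf_split (C z⁻¹) N
  have s3 := qPochInf_split (C (z ^ 2)) N
  have s4 := qPochInf_split (C (z ^ 2)⁻¹) N
  have s5 := qPochInf_split (X : PowerSeries K) (2 * N)
  have g1 := gf_tail_const z hN
  have g2 := gf_tail_const z⁻¹ hN
  have g3 := gf_tail_const (z ^ 2) hN
  have g4 := gf_tail_const (z ^ 2)⁻¹ hN
  have h3 := isUnit_qPoch_X (K := K) (2 * N)
  rw [← pow_succ'] at s5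
  simp only [prefactor, seriesTerm, summand, mul_inv_cancel₀ hz2, inv_one, map_one, mul_one,
    ← pow_mul]
  generalize (qPochInf (C z) * qPochInf (C z⁻¹) * qPochInf (C (z ^ 2)) *
      qPochInf (C (z ^ 2)⁻¹))⁻¹ = I at *
  rw [s5]
  rw [s1, s2, s3, s4] at hI
  generalize gf (partWeight (tail (fun _ => z) N)) = G1 at *
  generalize gf (partWeight (tail (fun _ => z⁻¹) N)) = G2 at *
  generalize gf (partWeight (tail (fun _ => z ^ 2) N)) = G3 at *
  generalize gf (partWeight (tail (fun _ => (z ^ 2)⁻¹) N)) = G4 at *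
  generalize qPochInf (C z * X ^ N) = Q1 at *
  generalize qPochInf (C z⁻¹ * X ^ N) = Q2 at *
  generalize qPochInf (C (z ^ 2) * X ^ N) = Q3 at *
  generalize qPochInf (C (z ^ 2)⁻¹ * X ^ N) = Q4 at *
  generalize qPoch (C z) N = P1 at *
  generalize qPoch (C z⁻¹) N = P2 at *
  generalize qPoch (C (z ^ 2)) N = P3 at *
  generalize qPoch (C (z ^ 2)⁻¹) N = P4 at *
  have key : I * (P1 * P2 * P3 * P4) = G1 * G2 * G3 * G4 := by
    have : (G1 * Q1) * (G2 * Q2) * (G3 * Q3) * (G4 * Q4) = 1 := by rw [g1, g2, g3, g4]; ring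
    linear_combination (G1 * G2 * G3 * G4) * hI - I * (P1 * P2 * P3 * P4) * this
  linear_combination (qPoch X (2 * N) * (qPoch X (2 * N))⁻¹ * qPochInf (X ^ (2 * N + 1)) *
    X ^ (e * N)) * key + (G1 * G2 * G3 * G4 * qPochInf (X ^ (2 * N + 1)) * X ^ (e * N)) * h3

theorem coeff_prefactor_mul_termSum (z : K) (hz : z ≠ 0) (h1 : z ≠ 1) (h2 : z ^ 2 ≠ 1) {e : ℕ}
    (he : 1 ≤ e) (n : ℕ) :
    coeff n (prefactor (z ^ 2) (z ^ 2)⁻¹ z * termSum e (z ^ 2) (z ^ 2)⁻¹ z) =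
      ∑ N ∈ Icc 1 n, coeff n (X ^ (e * N) * summand z N) := by
  have hd : X ^ (n + 1) ∣ termSum e (z ^ 2) (z ^ 2)⁻¹ z -
      ∑ N ∈ Icc 1 n, seriesTerm e (z ^ 2) (z ^ 2)⁻¹ z N := by
    rw [X_pow_dvd_iff]
    intro m hm
    rw [map_sub, map_sum, termSum, coeff_mk, sub_eq_zero]
    refine Finset.sum_subset (Finset.Icc_subset_Icc_right (by omega)) fun N hN hN' => ?_
    refine coeff_seriesTerm_eq_zero he _ _ _ ?_
    rw [Finset.mem_Icc] at hN hN'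
    omega
  have hd' := X_pow_dvd_iff.1 (hd.mul_left (prefactor (z ^ 2) (z ^ 2)⁻¹ z)) n (Nat.lt_succ_self n)
  rw [mul_sub, map_sub, sub_eq_zero] at hd'
  rw [hd', Finset.mul_sum, map_sum]
  refine Finset.sum_congr rfl fun N hN => ?_
  rw [prefactor_mul_seriesTerm z hz h1 h2 e (Finset.mem_Icc.1 hN).1]

/-! ### Sums over quadruples -/

/-- `φ` is the generating function of the weight `f` with respect to the size `σ`. -/
def IsGF {A : Type*} (σ : A → ℕ) (f : A → K) (φ : PowerSeries K) : Prop :=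
  ∀ n, ∃ S : Finset A, (∀ a, a ∈ S ↔ σ a = n) ∧ coeff n φ = ∑ a ∈ S, f a

theorem IsGF.mul {A B : Type*} {σ : A → ℕ} {τ : B → ℕ} {f : A → K} {g : B → K}
    {φ γ : PowerSeries K} (hf : IsGF σ f φ) (hg : IsGF τ g γ) :
    IsGF (fun p : A × B => σ p.1 + τ p.2) (fun p => f p.1 * g p.2) (φ * γ) := by
  classical
  choose S hS hφ using hf
  choose T hT hγ using hg
  intro n
  refine ⟨(antidiagonal n).biUnion fun a => S a.1 ×ˢ T a.2, ?_, ?_⟩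
  · rintro ⟨a, b⟩
    simp only [Finset.mem_biUnion, HasAntidiagonal.mem_antidiagonal, Finset.mem_product, hS, hT, Prod.exists]
    constructor
    · rintro ⟨i, j, h, rfl, rfl⟩; exact h
    · intro h; exact ⟨_, _, h, rfl, rfl⟩
  · rw [coeff_mul, Finset.sum_biUnion]
    · refine Finset.sum_congr rfl fun a _ => ?_
      rw [hφ, hγ, Finset.sum_mul_sum, Finset.sum_product]
    · intro a _ b _ hab
      rw [Function.onFun, Finset.disjoint_left]
      rintro ⟨x, y⟩ hx hy
      simp only [Finset.mem_product, hS, hT] at hx hy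
      exact hab (Prod.ext (hx.1.symm.trans hy.1) (hx.2.symm.trans hy.2))

theorem isGF_gf (W : Multiset ℕ → K) : IsGF (fun p : Ptn => p.1) (fun p => W p.2.parts) (gf W) := by
  intro n
  refine ⟨univ.map ⟨fun q : n.Partition => (⟨n, q⟩ : Ptn), ?_⟩, ?_, ?_⟩
  · intro a b h; simpa using h
  · rintro ⟨m, q⟩
    simp only [Finset.mem_map, Finset.mem_univ, true_and]
    constructor
    · rintro ⟨a, h⟩; exact (congrArg Sigma.fst h).symm
    · rintro rfl; exact ⟨q, rfl⟩
  · rw [coeff_gf, Finset.sum_map]; rfl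

theorem coeff_gf_mul_four (W₁ W₂ W₃ W₄ : Multiset ℕ → K) (n : ℕ) :
    coeff n (gf W₁ * (gf W₂ * (gf W₃ * gf W₄))) =
      ∑ π ∈ (finite_size_eq n).toFinset, W₁ π.p1.2.parts * (W₂ π.p2.2.parts *
        (W₃ π.p3.2.parts * W₄ π.p4.2.parts)) := by
  obtain ⟨S, hS, h⟩ := ((isGF_gf W₁).mul ((isGF_gf W₂).mul ((isGF_gf W₃).mul (isGF_gf W₄)))) n
  rw [h]
  refine Finset.sum_bij' (fun p _ => ⟨p.1, p.2.1, p.2.2.1, p.2.2.2⟩)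
    (fun π _ => (π.p1, π.p2, π.p3, π.p4)) ?_ ?_ ?_ ?_ ?_
  · intro p hp
    have := (hS p).1 hp
    simp only [Set.Finite.mem_toFinset, Set.mem_ofPred_eq, Quad.size]
    rw [← this]
    ring
  · intro π hπ
    simp only [Set.Finite.mem_toFinset, Set.mem_ofPred_eq, Quad.size] at hπ
    rw [hS]
    simp only
    omega
  · intro p _; rfl
  · intro p _; rfl
  · intro p _; rfl

theorem le_smallest_iff (p : Ptn) (N : ℕ) : (N : ℕ∞) ≤ smallest p ↔ ∀ i ∈ p.2.parts, N ≤ i := by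
  simp [smallest, Multiset.le_inf]

theorem smallest_eq_iff (p : Ptn) (N : ℕ) :
    smallest p = N ↔ N ∈ p.2.parts ∧ ∀ i ∈ p.2.parts, N ≤ i := by
  constructor
  · intro h
    have h1 := (le_smallest_iff p N).1 h.ge
    refine ⟨?_, h1⟩
    by_contra h2
    have h3 : ((N + 1 : ℕ) : ℕ∞) ≤ smallest p := by
      rw [le_smallest_iff]
      intro i hi
      rcases (h1 i hi).lt_or_eq with h | h
      · exact h
      · exact absurd (h ▸ hi) h2
    rw [h, Nat.cast_le] at h3
    omega
  · rintro ⟨h1, h2⟩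
    refine le_antisymm ?_ ((le_smallest_iff p N).2 h2)
    exact Multiset.inf_le (Multiset.mem_map_of_mem _ h1)

theorem largest_le_iff (p : Ptn) (M : ℕ) : largest p ≤ M ↔ ∀ i ∈ p.2.parts, i ≤ M := by
  simp [largest, Multiset.sup_le]

theorem mem_U_iff (π : Quad) : π ∈ U ↔ ∃ N : ℕ, smallest π.p1 = N ∧
    (∀ i ∈ π.p2.2.parts, N ≤ i) ∧ (∀ i ∈ π.p3.2.parts, N ≤ i) ∧
      (∀ i ∈ π.p4.2.parts, N ≤ i ∧ i < N + (N + 1)) := by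
  constructor
  · rintro ⟨h1, h2, h3, h4, h5⟩
    have hne : smallest π.p1 ≠ ⊤ := by
      intro h; rw [h] at h2; exact absurd h2 (by simp)
    obtain ⟨N, hN⟩ := ENat.ne_top_iff_exists.1 hne
    rw [← hN] at h1 h3 h4 h5
    refine ⟨N, hN.symm, (le_smallest_iff _ _).1 h3, (le_smallest_iff _ _).1 h4, fun i hi =>
      ⟨(le_smallest_iff _ _).1 h5 i hi, ?_⟩⟩
    have h6 : largest π.p4 ≤ 2 * N := by exact_mod_cast h1
    have := (largest_le_iff _ _).1 h6 i hi
    omega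
  · rintro ⟨N, hN, h2, h3, h4⟩
    simp only [U, Set.mem_ofPred_eq, hN, le_smallest_iff]
    refine ⟨?_, ?_, h2, h3, fun i hi => (h4 i hi).1⟩
    · have h6 : largest π.p4 ≤ 2 * N := by
        rw [largest_le_iff]
        intro i hi
        have := h4 i hi
        omega
      exact_mod_cast h6
    · exact_mod_cast ENat.natCast_lt_top (2 * N)

/-- `s(π₁)` appears at least `e` times in `π₁`. -/
noncomputable def firstCount (π : Quad) : ℕ :=
  (π.p1.2.parts.filter (fun i : ℕ => (i : ℕ∞) = smallest π.p1)).card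

/-- The rank with a general shift: the shift `1` gives the `u`-rank and `2` the `v`-rank. -/
noncomputable def shiftedRank (e : ℕ) (π : Quad) : ℤ :=
  (omegaStat π : ℤ) - e + 2 * (numParts π.p2 : ℤ) - 2 * (numParts π.p3 : ℤ) - (numParts π.p4 : ℤ)

theorem firstCount_eq {π : Quad} {N : ℕ} (h : smallest π.p1 = N) :
    firstCount π = π.p1.2.parts.count N := by
  rw [firstCount, h, Multiset.count_eq_card_filter_eq]
  congr 1
  refine Multiset.filter_congr fun i _ => ?_
  rw [Nat.cast_inj, eq_comm]

theorem partWeight_firstWeight (z : K) (N k : ℕ) (s : Multiset ℕ) :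
    partWeight (firstWeight z N k) s = z ^ (s.filter fun i => i = N ∨ N + k < i).card := by
  induction s using Multiset.induction_on with
  | empty => simp [partWeight]
  | cons a s ih =>
    simp only [partWeight, Multiset.map_cons, Multiset.prod_cons] at ih ⊢
    rw [ih, firstWeight, Multiset.filter_cons]
    split_ifs with h
    · simp [pow_succ, mul_comm]
    · simp

theorem partWeight_const (c : K) (s : Multiset ℕ) : partWeight (fun _ => c) s = c ^ s.card := by
  simp [partWeight]

/-- The weight of a quadruple whose first partition has smallest part `N` and whose last partition
has `k` parts. -/
noncomputable def quadWeight (z : K) (e N k : ℕ) (π : Quad) : K :=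
  (if e ≤ π.p1.2.parts.count N then
    (z⁻¹ ^ e) * partWeight (tail (firstWeight z N k) N) π.p1.2.parts else 0) *
  (partWeight (tail (fun _ => z ^ 2) N) π.p2.2.parts *
  (partWeight (tail (fun _ => (z ^ 2)⁻¹) N) π.p3.2.parts *
  (z⁻¹ ^ k * if (∀ i ∈ π.p4.2.parts, N ≤ i ∧ i < N + (N + 1)) ∧ π.p4.2.parts.card = k
    then 1 else 0)))

/-- Removing the `e` required copies of `N` produces q^{eN} and frees the rest of `π₁`. These copies
weigh z^e, which the factor `z⁻¹ ^ e` compensates; hence the shift by `e` in the rank. -/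
theorem sum_quadWeight (z : K) (hz : z ≠ 0) (e : ℕ) {N : ℕ} (hN : 0 < N) (n k : ℕ) :
    ∑ π ∈ (finite_size_eq n).toFinset, quadWeight z e N k π =
      coeff n (X ^ (e * N) * ((C (z⁻¹ ^ k) * boxGf K N (N + 1) k *
        gf (partWeight (tail (firstWeight z N k) N))) *
        (gf (partWeight (tail (fun _ => z ^ 2) N)) *
          gf (partWeight (tail (fun _ => (z ^ 2)⁻¹) N))))) := by
  have h1 : gf (fun s => if e ≤ s.count N then
      (z⁻¹ ^ e) * partWeight (tail (firstWeight z N k) N) s else 0) =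
      X ^ (e * N) * gf (partWeight (tail (firstWeight z N k) N)) := by
    rw [gf_count (fun s => (z⁻¹ ^ e) * partWeight (tail (firstWeight z N k) N) s) hN]
    congr 2
    ext s
    have : tail (firstWeight z N k) N N = z := by simp [tail, firstWeight]
    simp only [partWeight, Multiset.map_add, Multiset.prod_add, Multiset.map_replicate,
      Multiset.prod_replicate, this]
    rw [← mul_assoc, ← mul_pow, inv_mul_cancel₀ hz, one_pow, one_mul]
  have h2 : C (z⁻¹ ^ k) * boxGf K N (N + 1) k = gf fun s =>
      z⁻¹ ^ k * if (∀ i ∈ s, N ≤ i ∧ i < N + (N + 1)) ∧ s.card = k then 1 else 0 := by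
    rw [gf_const_mul]; rfl
  have h3 := coeff_gf_mul_four (fun s => if e ≤ s.count N then
      (z⁻¹ ^ e) * partWeight (tail (firstWeight z N k) N) s else 0)
    (partWeight (tail (fun _ => z ^ 2) N)) (partWeight (tail (fun _ => (z ^ 2)⁻¹) N))
    (fun s => z⁻¹ ^ k * if (∀ i ∈ s, N ≤ i ∧ i < N + (N + 1)) ∧ s.card = k then 1 else 0) n
  rw [h1, ← h2] at h3
  rw [show (∑ π ∈ (finite_size_eq n).toFinset, quadWeight z e N k π) = _ from h3.symm]
  congr 1
  ring

theorem quadWeight_of_mem (z : K) (hz : z ≠ 0) (e : ℕ) {π : Quad} {N : ℕ}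
    (hN : smallest π.p1 = N) (he : e ≤ firstCount π)
    (h2 : ∀ i ∈ π.p2.2.parts, N ≤ i) (h3 : ∀ i ∈ π.p3.2.parts, N ≤ i)
    (h4 : ∀ i ∈ π.p4.2.parts, N ≤ i ∧ i < N + (N + 1)) :
    quadWeight z e N (numParts π.p4) π = z ^ shiftedRank e π := by
  rw [firstCount_eq hN] at he
  have h1 := ((smallest_eq_iff _ _).1 hN).2
  rw [quadWeight, if_pos he, partWeight_tail, if_pos h1, partWeight_tail, if_pos h2,
    partWeight_tail, if_pos h3, if_pos ⟨h4, rfl⟩, partWeight_const, partWeight_const,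
    partWeight_firstWeight]
  have h5 : omegaStat π = (π.p1.2.parts.filter fun i => i = N ∨ N + numParts π.p4 < i).card := by
    rw [omegaStat, hN]
    congr 1
    refine Multiset.filter_congr fun i _ => ?_
    norm_cast
  rw [← h5, shiftedRank]
  rw [zpow_sub₀ hz, zpow_sub₀ hz, zpow_add₀ hz, zpow_sub₀ hz, zpow_mul, zpow_mul]
  norm_cast
  simp only [numParts, div_eq_mul_inv, inv_pow, mul_one]
  ring

/-- The weight is non-zero for at most one pair (N, k): the smallest part of `π₁` and the number of
parts of `π₄`, both at most `n`. The condition `1 ≤ e` is what puts `N` among the parts of `π₁`. -/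
theorem sum_sum_quadWeight (z : K) (hz : z ≠ 0) {e : ℕ} (he : 1 ≤ e) {n : ℕ} {π : Quad}
    (hπ : π.size = n) [Decidable (π ∈ U ∧ e ≤ firstCount π)] :
    ∑ N ∈ Icc 1 n, ∑ k ∈ range (n + 1), quadWeight z e N k π =
      if π ∈ U ∧ e ≤ firstCount π then z ^ shiftedRank e π else 0 := by
  have hmem : ∀ N k, quadWeight z e N k π ≠ 0 → smallest π.p1 = N ∧ e ≤ π.p1.2.parts.count N ∧
      (∀ i ∈ π.p2.2.parts, N ≤ i) ∧ (∀ i ∈ π.p3.2.parts, N ≤ i) ∧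
      (∀ i ∈ π.p4.2.parts, N ≤ i ∧ i < N + (N + 1)) ∧ numParts π.p4 = k := by
    intro N k h
    rw [quadWeight, partWeight_tail, partWeight_tail, partWeight_tail] at h
    simp only [ne_eq, mul_eq_zero, not_or, ite_eq_right_iff, Classical.not_imp] at h
    obtain ⟨⟨a1, -, a2, -⟩, ⟨a3, -⟩, ⟨a4, -⟩, -, ⟨a5, a6⟩, -⟩ := h
    refine ⟨(smallest_eq_iff _ _).2 ⟨?_, a2⟩, a1, a3, a4, a5, a6⟩
    exact Multiset.count_pos.1 (by omega)
  split_ifs with h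
  · obtain ⟨hU, hc⟩ := h
    obtain ⟨N, hN, h2, h3, h4⟩ := (mem_U_iff π).1 hU
    have hN1 := (smallest_eq_iff _ _).1 hN
    have hNpos : 0 < N := π.p1.2.parts_pos hN1.1
    have hsum1 := π.p1.2.parts_sum
    have hle := Multiset.le_sum_of_mem hN1.1
    have hsize : π.p1.1 + π.p2.1 + π.p3.1 + π.p4.1 = n := hπ
    have hk : numParts π.p4 ≤ π.p4.1 := by
      have := Multiset.card_nsmul_le_sum (s := π.p4.2.parts) (a := 1)
        (fun i hi => π.p4.2.parts_pos hi)
      rw [π.p4.2.parts_sum] at this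
      simpa [numParts] using this
    rw [Finset.sum_eq_single N, Finset.sum_eq_single (numParts π.p4)]
    · exact quadWeight_of_mem z hz e hN hc h2 h3 h4
    · intro k _ hne
      by_contra h0
      exact hne (hmem _ _ h0).2.2.2.2.2.symm
    · intro h0
      exact absurd (Finset.mem_range.2 (by omega)) h0
    · intro M _ hne
      refine Finset.sum_eq_zero fun k _ => ?_
      by_contra h0
      have := (hmem _ _ h0).1
      rw [hN, Nat.cast_inj] at this
      exact hne this.symm
    · intro h0
      exact absurd (Finset.mem_Icc.2 ⟨hNpos, by omega⟩) h0
  · refine Finset.sum_eq_zero fun N _ => Finset.sum_eq_zero fun k _ => ?_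
    by_contra h0
    obtain ⟨a1, a2, a3, a4, a5, -⟩ := hmem _ _ h0
    refine h ⟨(mem_U_iff π).2 ⟨N, a1, a3, a4, a5⟩, ?_⟩
    rwa [firstCount_eq a1]

-- Valid over any field: the indeterminate of ℚ((z)) gives the meaning of `ru` and `rv`, and a
-- complex root of unity gives the exponential sums over ranks.
open Classical in
theorem coeff_eq_sum_quad (z : K) (hz : z ≠ 0) (h1 : z ≠ 1) (h2 : z ^ 2 ≠ 1) {e : ℕ}
    (he : 1 ≤ e) (n : ℕ) :
    coeff n (prefactor (z ^ 2) (z ^ 2)⁻¹ z * termSum e (z ^ 2) (z ^ 2)⁻¹ z) =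
      ∑ π ∈ (finite_size_eq n).toFinset with π ∈ U ∧ e ≤ firstCount π, z ^ shiftedRank e π := by
  rw [coeff_prefactor_mul_termSum z hz h1 h2 he, Finset.sum_filter]
  have hr : ∀ π ∈ (finite_size_eq n).toFinset,
      (if π ∈ U ∧ e ≤ firstCount π then z ^ shiftedRank e π else 0) =
        ∑ N ∈ Icc 1 n, ∑ k ∈ range (n + 1), quadWeight z e N k π := by
    intro π hπ
    rw [sum_sum_quadWeight z hz he]
    simpa using hπ
  rw [Finset.sum_congr rfl hr, Finset.sum_comm]
  refine Finset.sum_congr rfl fun N hN => ?_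
  have hN' : 0 < N := (Finset.mem_Icc.1 hN).1
  rw [Finset.sum_comm]
  simp_rw [sum_quadWeight z hz e hN']
  rw [← map_sum, ← Finset.mul_sum, ← Finset.sum_mul]
  have hd := X_pow_dvd_sum_boxGf z hz hN' (n + 1)
  have hd' := X_pow_dvd_iff.1 ((hd.mul_left (X ^ (e * N))).mul_right
    (gf (partWeight (tail (fun _ => z ^ 2) N)) *
          gf (partWeight (tail (fun _ => (z ^ 2)⁻¹) N)))) n (Nat.lt_succ_self n)
  rw [mul_sub, sub_mul, map_sub, sub_eq_zero] at hd'
  rw [← mul_assoc, hd', summand]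
  congr 1
  ring

theorem one_le_firstCount {π : Quad} (h : π ∈ U) : 1 ≤ firstCount π := by
  obtain ⟨N, hN, -⟩ := (mem_U_iff π).1 h
  rw [firstCount_eq hN]
  exact Multiset.count_pos.2 ((smallest_eq_iff _ _).1 hN).1

open Classical in
theorem coeff_F_eq_sum (z : K) (hz : z ≠ 0) (h1 : z ≠ 1) (h2 : z ^ 2 ≠ 1) (n : ℕ) :
    coeff n (F (z ^ 2) (z ^ 2)⁻¹ z) =
      ∑ π ∈ (finite_size_eq n).toFinset with π ∈ U, z ^ uRank π := by
  rw [F, coeff_eq_sum_quad z hz h1 h2 le_rfl]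
  refine Finset.sum_congr (Finset.filter_congr fun π _ => ?_) fun π _ => ?_
  · exact ⟨fun h => h.1, fun h => ⟨h, one_le_firstCount h⟩⟩
  · simp [shiftedRank, uRank]

open Classical in
theorem coeff_G_eq_sum (z : K) (hz : z ≠ 0) (h1 : z ≠ 1) (h2 : z ^ 2 ≠ 1) (n : ℕ) :
    coeff n (G (z ^ 2) (z ^ 2)⁻¹ z) =
      ∑ π ∈ (finite_size_eq n).toFinset with π ∈ V, z ^ vRank π := by
  rw [G, coeff_eq_sum_quad z hz h1 h2 (by norm_num)]
  refine Finset.sum_congr (Finset.filter_congr fun π _ => Iff.rfl) fun π _ => ?_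
  simp [shiftedRank, vRank]

theorem zVar_zpow (m : ℤ) : zVar ^ m = HahnSeries.single m (1 : ℚ) := by
  have hpow : ∀ k : ℕ, zVar ^ k = HahnSeries.single (k : ℤ) (1 : ℚ) := by
    intro k
    simp [zVar, HahnSeries.single_pow]
  obtain ⟨k, rfl | rfl⟩ := m.eq_nat_or_neg
  · rw [zpow_natCast, hpow]
  · rw [zpow_neg, zpow_natCast, hpow, inv_eq_of_mul_eq_one_right]
    simp

theorem zVar_zpow_ne (m : ℤ) (hm : m ≠ 0) : zVar ^ m ≠ 1 := by
  intro h
  have := congrArg (fun f : LaurentSeries ℚ => f.coeff 0) h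
  simp [zVar_zpow, HahnSeries.coeff_single_of_ne hm.symm] at this

theorem coeff_sum_zVar {S : Set Quad} (n : ℕ) (r : Quad → ℤ) (m : ℤ)
    [DecidablePred (· ∈ S)] :
    (∑ π ∈ (finite_size_eq n).toFinset with π ∈ S, zVar ^ r π).coeff m =
      ({π : Quad | π ∈ S ∧ π.size = n ∧ r π = m}.ncard : ℚ) := by
  have hc : ∀ π, (zVar ^ r π).coeff m = if r π = m then (1 : ℚ) else 0 := by
    intro π
    rw [zVar_zpow]
    split_ifs with h
    · rw [h, HahnSeries.coeff_single_same]
    · exact HahnSeries.coeff_single_of_ne (Ne.symm h)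
  rw [HahnSeries.coeff_sum, Finset.sum_congr rfl fun π _ => hc π, Finset.sum_boole,
    ← Set.ncard_coe_finset]
  congr 2
  ext π
  simp only [Finset.coe_filter, Finset.mem_filter, Set.Finite.mem_toFinset, Set.mem_ofPred_eq]
  constructor
  · rintro ⟨⟨h1, h2⟩, h3⟩; exact ⟨h2, h1, h3⟩
  · rintro ⟨h2, h1, h3⟩; exact ⟨⟨h1, h2⟩, h3⟩

theorem ru_eq (m : ℤ) (n : ℕ) : ru m n = (uRankCount m n : ℚ) := by
  classical
  have h0 : zVar ≠ 0 := by simp [zVar]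
  have h1 := zVar_zpow_ne 1 (by norm_num)
  have h2 := zVar_zpow_ne 2 (by norm_num)
  rw [ru, RU, coeff_F_eq_sum zVar h0 (by simpa using h1) (by exact_mod_cast h2), coeff_sum_zVar,
    uRankCount]

theorem rv_eq (m : ℤ) (n : ℕ) : rv m n = (vRankCount m n : ℚ) := by
  classical
  have h0 : zVar ≠ 0 := by simp [zVar]
  have h1 := zVar_zpow_ne 1 (by norm_num)
  have h2 := zVar_zpow_ne 2 (by norm_num)
  rw [rv, RV, coeff_G_eq_sum zVar h0 (by simpa using h1) (by exact_mod_cast h2), coeff_sum_zVar,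
    vRankCount]

end Combinatorics

end RankQuadruples

namespace RankQuadruples

/-! ### Equal classes from vanishing at a root of unity -/

section RootsOfUnity

-- Subtracting `c (l - 1)` times 1 + ζ + ⋯ + ζ^{l-1} = 0 leaves an integer polynomial of degree
-- below l - 1 that vanishes at ζ. It is divisible by the cyclotomic polynomial, of degree l - 1 as
-- `l` is prime, so it is zero.
open Polynomial Finset in
theorem card_eq_of_sum_pow_eq_zero {ζ : ℂ} {l : ℕ} (hl : l.Prime) (hζ : IsPrimitiveRoot ζ l)
    (c : ℕ → ℤ) (h : ∑ i ∈ range l, (c i : ℂ) * ζ ^ i = 0) {i : ℕ} (hi : i < l) :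
    c i = c (l - 1) := by
  have : Fact l.Prime := ⟨hl⟩
  have hl1 : l - 1 + 1 = l := Nat.succ_pred_eq_of_pos hl.pos
  set p : ℤ[X] := ∑ i ∈ range (l - 1), Polynomial.C (c i - c (l - 1)) * Polynomial.X ^ i with hp
  have hgeom := hζ.geom_sum_eq_zero hl.one_lt
  have haeval : aeval ζ p = 0 := by
    have hev : aeval ζ p = ∑ i ∈ range (l - 1), ((c i : ℂ) - c (l - 1)) * ζ ^ i := by
      simp [hp]
    rw [hev]
    simp only [sub_mul, Finset.sum_sub_distrib, ← Finset.mul_sum]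
    rw [← hl1, Finset.sum_range_succ] at h hgeom
    linear_combination h - (c (l - 1) : ℂ) * hgeom
  have hdvd := minpoly.isIntegrallyClosed_dvd (hζ.isIntegral hl.pos) haeval
  rw [← cyclotomic_eq_minpoly hζ hl.pos] at hdvd
  have hp0 : p = 0 := by
    refine eq_zero_of_dvd_of_degree_lt hdvd ?_
    rw [degree_cyclotomic, Nat.totient_prime hl]
    refine (degree_sum_le _ _).trans_lt ?_
    rw [Finset.sup_lt_iff (WithBot.bot_lt_coe _)]
    intro j hj
    refine (degree_C_mul_X_pow_le _ _).trans_lt ?_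
    exact_mod_cast Finset.mem_range.1 hj
  rcases Nat.lt_or_ge i (l - 1) with h1 | h1
  · have := congrArg (fun f : ℤ[X] => f.coeff i) hp0
    simp only [hp, finsetSum_coeff, coeff_C_mul_X_pow, Polynomial.coeff_zero] at this
    rw [Finset.sum_ite_eq, if_pos (Finset.mem_range.2 h1)] at this
    omega
  · rw [show i = l - 1 by omega]

open PowerSeries Finset

theorem mul_card_filter_eq_card {A : Type*} {ζ : ℂ} {l : ℕ} (hl : l.Prime)
    (hζ : IsPrimitiveRoot ζ l) (T : Finset A) (r : A → ℤ) (h : ∑ a ∈ T, ζ ^ r a = 0) (k : ℤ) :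
    l * (T.filter fun a => r a ≡ k [ZMOD (l : ℤ)]).card = T.card := by
  have hl0 : (l : ℤ) ≠ 0 := by exact_mod_cast hl.ne_zero
  have hlpos : (0 : ℤ) < l := by exact_mod_cast hl.pos
  set f : A → ℕ := fun a => (r a % l).toNat with hf
  have hfr : ∀ a, (f a : ℤ) = r a % l := fun a => Int.toNat_of_nonneg (Int.emod_nonneg _ hl0)
  have hfl : ∀ a ∈ T, f a ∈ range l := by
    intro a _
    rw [Finset.mem_range]
    have h1 := Int.emod_lt_of_pos (r a) hlpos
    have := hfr a
    omega
  have hpow : ∀ a, ζ ^ r a = ζ ^ f a := by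
    intro a
    rw [← zpow_natCast, hfr a, ← Int.emod_add_mul_ediv (r a) l, zpow_add₀ (hζ.ne_zero hl.ne_zero),
      zpow_mul, zpow_natCast, hζ.pow_eq_one, one_zpow, mul_one, Int.add_mul_emod_self_left,
      Int.emod_emod]
  set c : ℕ → ℤ := fun i => ((T.filter fun a => f a = i).card : ℤ) with hc
  have hsum : ∑ i ∈ range l, (c i : ℂ) * ζ ^ i = 0 := by
    rw [← h, ← Finset.sum_fiberwise_of_maps_to hfl]
    refine Finset.sum_congr rfl fun i _ => ?_
    rw [Finset.sum_congr rfl (g := fun _ => ζ ^ i), Finset.sum_const, nsmul_eq_mul]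
    · simp [hc]
    · intro a ha
      rw [hpow, (Finset.mem_filter.1 ha).2]
  have hcard : (T.card : ℤ) = ∑ i ∈ range l, c i := by
    rw [Finset.card_eq_sum_card_fiberwise hfl, Nat.cast_sum]
  have hall := fun i (hi : i ∈ range l) =>
    card_eq_of_sum_pow_eq_zero hl hζ c hsum (Finset.mem_range.1 hi)
  rw [Finset.sum_congr rfl hall, Finset.sum_const, card_range, nsmul_eq_mul] at hcard
  have hk : (k % l).toNat ∈ range l := by
    rw [Finset.mem_range]
    have h1 := Int.emod_lt_of_pos k hlpos
    have h2 := Int.emod_nonneg k hl0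
    omega
  have hk2 : (T.filter fun a => r a ≡ k [ZMOD (l : ℤ)]) =
      T.filter fun a => f a = (k % l).toNat := by
    refine Finset.filter_congr fun a _ => ?_
    have h1 := hfr a
    have h2 := Int.emod_nonneg k hl0
    rw [Int.ModEq]
    omega
  have := hall _ hk
  rw [hk2]
  rw [← this] at hcard
  simp only [hc] at hcard
  exact_mod_cast hcard.symm

theorem ncard_class (S : Set Quad) (r : Quad → ℤ) (l n : ℕ) {ζ : ℂ} (hl : l.Prime)
    (hζ : IsPrimitiveRoot ζ l) [DecidablePred (· ∈ S)]
    (h : ∑ π ∈ (finite_size_eq n).toFinset with π ∈ S, ζ ^ r π = 0) (k : ℤ) :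
    l * {π : Quad | π ∈ S ∧ π.size = n ∧ r π ≡ k [ZMOD (l : ℤ)]}.ncard =
      {π : Quad | π ∈ S ∧ π.size = n}.ncard := by
  have h1 := mul_card_filter_eq_card hl hζ _ r h k
  rw [← Set.ncard_coe_finset, ← Set.ncard_coe_finset] at h1
  convert h1 using 3
  · ext π
    simp only [Finset.coe_filter, Finset.mem_filter, Set.Finite.mem_toFinset, Set.mem_ofPred_eq]
    tauto
  · ext π
    simp only [Finset.coe_filter, Set.Finite.mem_toFinset, Set.mem_ofPred_eq]
    tauto

theorem sq_ne_one_of_isPrimitiveRoot {ζ : ℂ} {l : ℕ} (hl : 2 < l) (hζ : IsPrimitiveRoot ζ l) :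
    ζ ^ 2 ≠ 1 := hζ.pow_ne_one_of_pos_of_lt (by norm_num) hl

theorem mul_uClass {ζ : ℂ} {l n : ℕ} (hl : l.Prime) (hl2 : 2 < l) (hζ : IsPrimitiveRoot ζ l)
    (h : coeff n (F (ζ ^ 2) (ζ ^ 2)⁻¹ ζ) = 0) (k : ℤ) : l * uClass k l n = u n := by
  classical
  rw [coeff_F_eq_sum ζ (hζ.ne_zero hl.ne_zero) (hζ.ne_one hl.one_lt) (sq_ne_one_of_isPrimitiveRoot hl2 hζ)] at h
  exact ncard_class U uRank l n hl hζ h k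

theorem mul_vClass {ζ : ℂ} {l n : ℕ} (hl : l.Prime) (hl2 : 2 < l) (hζ : IsPrimitiveRoot ζ l)
    (h : coeff n (G (ζ ^ 2) (ζ ^ 2)⁻¹ ζ) = 0) (k : ℤ) : l * vClass k l n = v n := by
  classical
  rw [coeff_G_eq_sum ζ (hζ.ne_zero hl.ne_zero) (hζ.ne_one hl.one_lt) (sq_ne_one_of_isPrimitiveRoot hl2 hζ)] at h
  exact ncard_class V vRank l n hl hζ h k

end RootsOfUnity

end RankQuadruples

namespace RankQuadruples

open Filter Topology

/-! ### Formal series as holomorphic functions on a disc -/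

section Represents

/-- The formal power series `f` converges to the function `g` on the disc of radius `1 / 2`. -/
def Represents (f : PowerSeries ℂ) (g : ℂ → ℂ) : Prop :=
  ∀ q : ℂ, ‖q‖ < 1 / 2 → HasSum (fun n => PowerSeries.coeff n f * q ^ n) (g q)

theorem hasSum_of_forall_eq {ι : Type*} {f g : ι → ℂ} {a : ℂ} (h : HasSum f a)
    (e : ∀ n, g n = f n) : HasSum g a := by
  rwa [funext e]

theorem hasFPowerSeriesAt_of_hasSum {a : ℕ → ℂ} {g : ℂ → ℂ} {r : ℝ} (hr : 0 < r)
    (h : ∀ q : ℂ, ‖q‖ < r → HasSum (fun n => a n * q ^ n) (g q)) :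
    HasFPowerSeriesAt g (FormalMultilinearSeries.ofScalars ℂ a) 0 := by
  rw [hasFPowerSeriesAt_iff]
  filter_upwards [Metric.ball_mem_nhds (0 : ℂ) hr] with q hq
  rw [zero_add]
  refine hasSum_of_forall_eq (h q (by simpa using hq)) fun n => ?_
  rw [FormalMultilinearSeries.coeff_ofScalars, smul_eq_mul, mul_comm]

theorem coeff_eq_of_hasSum {a b : ℕ → ℂ} {g : ℂ → ℂ} {r : ℝ} (hr : 0 < r)
    (ha : ∀ q : ℂ, ‖q‖ < r → HasSum (fun n => a n * q ^ n) (g q))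
    (hb : ∀ q : ℂ, ‖q‖ < r → HasSum (fun n => b n * q ^ n) (g q)) : a = b := by
  have := (hasFPowerSeriesAt_of_hasSum hr ha).eq_formalMultilinearSeries
    (hasFPowerSeriesAt_of_hasSum hr hb)
  ext n
  rw [← FormalMultilinearSeries.coeff_ofScalars (𝕜 := ℂ) (p := a), this,
    FormalMultilinearSeries.coeff_ofScalars]

theorem Represents.unique {f f' : PowerSeries ℂ} {g : ℂ → ℂ} (h : Represents f g)
    (h' : Represents f' g) : f = f' := by
  ext n
  exact congrFun (coeff_eq_of_hasSum one_half_pos h h') n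

theorem Represents.congr {f : PowerSeries ℂ} {g g' : ℂ → ℂ} (h : Represents f g)
    (hg : ∀ q : ℂ, ‖q‖ < 1 / 2 → g q = g' q) : Represents f g' := fun q hq => hg q hq ▸ h q hq

theorem hasSum_taylor {g : ℂ → ℂ} (hg : DifferentiableOn ℂ g (Metric.ball 0 (1 / 2))) (q : ℂ)
    (hq : ‖q‖ < 1 / 2) :
    HasSum (fun n => ((n.factorial : ℂ)⁻¹ * iteratedDeriv n g 0) * q ^ n) (g q) := by
  have := Complex.hasSum_taylorSeries_on_ball hg (z := q) (by simpa using hq)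
  refine hasSum_of_forall_eq this fun n => ?_
  simp only [sub_zero, smul_eq_mul]
  ring

theorem exists_represents {g : ℂ → ℂ} (hg : DifferentiableOn ℂ g (Metric.ball 0 (1 / 2))) :
    ∃ f, Represents f g :=
  ⟨PowerSeries.mk fun n => (n.factorial : ℂ)⁻¹ * iteratedDeriv n g 0, fun q hq => by
    simpa using hasSum_taylor hg q hq⟩

theorem Represents.summable_norm {f : PowerSeries ℂ} {g : ℂ → ℂ} (h : Represents f g) {q : ℂ}
    (hq : ‖q‖ < 1 / 2) : Summable fun n => ‖PowerSeries.coeff n f * q ^ n‖ :=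
  (h q hq).summable.norm

theorem Represents.mul {f f' : PowerSeries ℂ} {g g' : ℂ → ℂ} (h : Represents f g)
    (h' : Represents f' g') : Represents (f * f') (fun q => g q * g' q) := by
  intro q hq
  have h1 := tsum_mul_tsum_eq_tsum_sum_antidiagonal_of_summable_norm (h.summable_norm hq)
    (h'.summable_norm hq)
  have h2 := (summable_norm_sum_mul_antidiagonal_of_summable_norm (h.summable_norm hq)
    (h'.summable_norm hq)).of_norm
  rw [(h q hq).tsum_eq, (h' q hq).tsum_eq] at h1
  have h3 := h2.hasSum
  rw [← h1] at h3
  refine hasSum_of_forall_eq h3 fun n => ?_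
  rw [PowerSeries.coeff_mul, Finset.sum_mul]
  refine Finset.sum_congr rfl fun p hp => ?_
  rw [← Finset.HasAntidiagonal.mem_antidiagonal.1 hp, pow_add]
  ring

theorem represents_C (a : ℂ) : Represents (PowerSeries.C a) fun _ => a := by
  intro q _
  convert hasSum_single (f := fun n => PowerSeries.coeff n (PowerSeries.C a) * q ^ n) 0 ?_ using 1
  · simp
  · intro n hn
    simp [PowerSeries.coeff_C, hn]

theorem represents_X : Represents (PowerSeries.X) fun q => q := by
  intro q _
  convert hasSum_single (f := fun n => PowerSeries.coeff n (PowerSeries.X) * q ^ n) 1 ?_ using 1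
  · simp
  · intro n hn
    simp [PowerSeries.coeff_X, hn]

theorem Represents.sub {f f' : PowerSeries ℂ} {g g' : ℂ → ℂ} (h : Represents f g)
    (h' : Represents f' g') : Represents (f - f') (fun q => g q - g' q) := by
  intro q hq
  refine hasSum_of_forall_eq ((h q hq).sub (h' q hq)) fun n => ?_
  rw [map_sub, sub_mul]

theorem Represents.pow {f : PowerSeries ℂ} {g : ℂ → ℂ} (h : Represents f g) (k : ℕ) :
    Represents (f ^ k) (fun q => g q ^ k) := by
  induction k with
  | zero => simpa using represents_C 1
  | succ k ih => simpa only [pow_succ] using ih.mul h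

theorem Represents.sum {ι : Type*} (s : Finset ι) {f : ι → PowerSeries ℂ} {g : ι → ℂ → ℂ}
    (h : ∀ i ∈ s, Represents (f i) (g i)) :
    Represents (∑ i ∈ s, f i) (fun q => ∑ i ∈ s, g i q) := by
  intro q hq
  refine hasSum_of_forall_eq (hasSum_sum fun i hi => h i hi q hq) fun n => ?_
  rw [map_sum, Finset.sum_mul]

theorem Represents.prod_range {f : ℕ → PowerSeries ℂ} {g : ℕ → ℂ → ℂ}
    (h : ∀ i, Represents (f i) (g i)) (n : ℕ) :
    Represents (∏ i ∈ Finset.range n, f i) (fun q => ∏ i ∈ Finset.range n, g i q) := by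
  induction n with
  | zero => simpa using represents_C 1
  | succ n ih => simpa only [Finset.prod_range_succ] using ih.mul (h n)

theorem Represents.differentiableOn {f : PowerSeries ℂ} {g : ℂ → ℂ} (h : Represents f g) :
    DifferentiableOn ℂ g (Metric.ball 0 (1 / 2)) := by
  have hp : HasFPowerSeriesOnBall g
      (FormalMultilinearSeries.ofScalars ℂ fun n => PowerSeries.coeff n f) 0
      (ENNReal.ofReal (1 / 2)) := by
    refine ⟨?_, by simp, ?_⟩
    · refine ENNReal.le_of_forall_nnreal_lt fun r hr => ?_
      have hr' : (r : ℝ) < 1 / 2 := by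
        rw [← ENNReal.ofReal_coe_nnreal, ENNReal.ofReal_lt_ofReal_iff (by norm_num)] at hr
        exact hr
      refine FormalMultilinearSeries.le_radius_of_summable_norm _ ?_
      have := h.summable_norm (q := (r : ℂ)) (by simpa using hr')
      convert this using 2 with n
      rw [FormalMultilinearSeries.ofScalars_norm, norm_mul, norm_pow]
      simp
    · intro y hy
      rw [zero_add]
      have hy' : ‖y‖ < 1 / 2 := by
        rw [Metric.mem_eball, edist_zero_right, ← ofReal_norm,
          ENNReal.ofReal_lt_ofReal_iff (by norm_num)] at hy
        exact hy
      refine hasSum_of_forall_eq (h y hy') fun n => ?_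
      rw [FormalMultilinearSeries.ofScalars_apply_eq, smul_eq_mul]
  have := hp.differentiableOn
  rwa [Metric.eball_ofReal] at this

/-- The quotient is holomorphic since `D` has no zero, so it has a Taylor series; multiplying that
back by `d` gives `f` by uniqueness. -/
theorem Represents.div {f d : PowerSeries ℂ} {g D : ℂ → ℂ} (hf : Represents f g)
    (hd : Represents d D) (hD : ∀ q : ℂ, ‖q‖ < 1 / 2 → D q ≠ 0) :
    Represents (f * d⁻¹) (fun q => g q / D q) := by
  obtain ⟨k, hk⟩ := exists_represents (hf.differentiableOn.div hd.differentiableOn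
    fun q hq => hD q (by simpa using hq))
  have h0 : PowerSeries.constantCoeff d ≠ 0 := by
    have h1 := hd 0 (by norm_num)
    have h2 := hasSum_single (f := fun n => PowerSeries.coeff n d * (0 : ℂ) ^ n) 0
      fun n hn => by simp [hn]
    have := h1.unique h2
    intro h
    refine hD 0 (by norm_num) ?_
    rw [this]
    simp [h]
  have h1 : k * d = f := by
    refine ((hk.mul hd).congr fun q hq => ?_).unique hf
    exact div_mul_cancel₀ _ (hD q hq)
  rwa [← h1, mul_assoc, PowerSeries.mul_inv_cancel _ h0, mul_one]

/-- Locally uniform convergence passes to all derivatives, so the Taylor coefficients of `gs N`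
converge to those of `g`, while by `hf` each is eventually constant. -/
theorem Represents.limit {f : PowerSeries ℂ} {g : ℂ → ℂ} {fs : ℕ → PowerSeries ℂ}
    {gs : ℕ → ℂ → ℂ} (h : ∀ N, Represents (fs N) (gs N))
    (hg : TendstoLocallyUniformlyOn gs g atTop (Metric.ball 0 (1 / 2)))
    (hf : ∀ n, ∀ᶠ N in atTop, PowerSeries.coeff n (fs N) = PowerSeries.coeff n f) :
    Represents f g := by
  have hopen : IsOpen (Metric.ball (0 : ℂ) (1 / 2)) := Metric.isOpen_ball
  have hdiff : ∀ N, DifferentiableOn ℂ (gs N) (Metric.ball 0 (1 / 2)) :=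
    fun N => (h N).differentiableOn
  have hiter : ∀ k, TendstoLocallyUniformlyOn (fun N => iteratedDeriv k (gs N))
      (iteratedDeriv k g) atTop (Metric.ball 0 (1 / 2)) ∧
      ∀ N, DifferentiableOn ℂ (iteratedDeriv k (gs N)) (Metric.ball 0 (1 / 2)) := by
    intro k
    induction k with
    | zero => simpa only [iteratedDeriv_zero] using ⟨hg, hdiff⟩
    | succ k ih =>
      simp only [iteratedDeriv_succ]
      exact ⟨ih.1.deriv (Eventually.of_forall ih.2) hopen, fun N => (ih.2 N).deriv hopen⟩
  have hgd := hg.differentiableOn (Eventually.of_forall hdiff) hopen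
  intro q hq
  convert hasSum_taylor hgd q hq using 2 with n
  congr 1
  have h0 : (0 : ℂ) ∈ Metric.ball (0 : ℂ) (1 / 2) := Metric.mem_ball_self one_half_pos
  have h1 := ((hiter n).1.tendsto_at h0).const_mul ((n.factorial : ℂ)⁻¹)
  have h2 : ∀ N, (n.factorial : ℂ)⁻¹ * iteratedDeriv n (gs N) 0 = PowerSeries.coeff n (fs N) :=
    fun N => congrFun (coeff_eq_of_hasSum one_half_pos (fun q hq => hasSum_taylor (hdiff N) q hq)
      (h N)) n
  simp only [h2] at h1
  refine tendsto_nhds_unique (tendsto_const_nhds.congr' ?_) h1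
  filter_upwards [hf n] with N hN
  exact hN.symm

/-- If the part of a represented function that comes from the exponents in a residue class vanishes
near the origin, then so do the coefficients in that class. -/
theorem Represents.coeff_eq_zero {f : PowerSeries ℂ} {g : ℂ → ℂ} (h : Represents f g) {ζ : ℂ}
    {l : ℕ} (hl : l ≠ 0) (hζ : IsPrimitiveRoot ζ l) (a : ℕ)
    (hg : ∀ᶠ q in 𝓝[≠] (0 : ℂ), ∑ j ∈ Finset.range l, ζ ^ (-(a * j : ℤ)) * g (ζ ^ j * q) = 0)
    (n : ℕ) : PowerSeries.coeff (l * n + a) f = 0 := by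
  have hnorm : ‖ζ‖ = 1 := hζ.norm'_eq_one hl
  have hζ0 : ζ ≠ 0 := hζ.ne_zero hl
  set c : ℕ → ℂ := fun m => (∑ j ∈ Finset.range l, ζ ^ (-(a * j : ℤ)) * (ζ ^ j) ^ m) *
    PowerSeries.coeff m f with hc
  set H : ℂ → ℂ := fun q => ∑ j ∈ Finset.range l, ζ ^ (-(a * j : ℤ)) * g (ζ ^ j * q) with hH
  -- The root-of-unity filter multiplies the coefficient of q^m by the sum over `j` in `c`, each of
  -- whose `l` terms is 1 when m ≡ a.
  have hHs : Represents (PowerSeries.mk c) H := by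
    intro q hq
    have := hasSum_sum (s := Finset.range l) (fun j _ =>
      (h (ζ ^ j * q) (by rw [norm_mul, norm_pow, hnorm]; simpa using hq)).mul_left
        (ζ ^ (-(a * j : ℤ))))
    refine hasSum_of_forall_eq this fun m => ?_
    rw [PowerSeries.coeff_mk, hc]
    simp only
    rw [Finset.sum_mul, Finset.sum_mul]
    refine Finset.sum_congr rfl fun j _ => ?_
    rw [mul_pow]
    ring
  -- The hypothesis excludes q = 0, where bilateral series are meaningless; continuity supplies that
  -- point.
  have hcont : ContinuousAt H 0 :=
    (hHs.differentiableOn.differentiableAt (Metric.ball_mem_nhds _ one_half_pos)).continuousAt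
  have hH0 : H 0 = 0 := by
    have h1 : Tendsto H (𝓝[≠] 0) (𝓝 (H 0)) := hcont.tendsto.mono_left nhdsWithin_le_nhds
    exact tendsto_nhds_unique (h1.congr' hg) tendsto_const_nhds
  have hev : ∀ᶠ q in 𝓝 (0 : ℂ), H q = 0 := by
    rw [eventually_nhdsWithin_iff] at hg
    filter_upwards [hg] with q hq
    rcases eq_or_ne q 0 with rfl | h0
    · exact hH0
    · exact hq h0
  obtain ⟨r, hr, hball⟩ := Metric.eventually_nhds_iff_ball.1 hev
  have hc0 : c = 0 := by
    refine coeff_eq_of_hasSum (g := H) (r := min r (1 / 2)) (by positivity) ?_ ?_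
    · intro q hq
      simpa using hHs q (hq.trans_le (min_le_right _ _))
    · intro q hq
      rw [hball q (by simpa using hq.trans_le (min_le_left _ _))]
      simp
  have h1 := congrFun hc0 (l * n + a)
  simp only [hc, Pi.zero_apply, mul_eq_zero] at h1
  refine h1.resolve_left ?_
  have : ∀ j ∈ Finset.range l, ζ ^ (-(a * j : ℤ)) * (ζ ^ j) ^ (l * n + a) = 1 := by
    intro j _
    rw [pow_add, pow_mul, ← pow_mul ζ j l, mul_comm j l, pow_mul ζ l j, hζ.pow_eq_one, one_pow,
      one_pow, one_mul, ← pow_mul, ← zpow_natCast, ← zpow_add₀ hζ0]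
    have : (-(a * j : ℤ) + ((j * a : ℕ) : ℤ)) = 0 := by push_cast; ring
    rw [this, zpow_zero]
  rw [Finset.sum_congr rfl this, Finset.sum_const, Finset.card_range, nsmul_eq_mul, mul_one]
  exact_mod_cast hl

end Represents

end RankQuadruples

namespace RankQuadruples

open Filter Topology

/-! ### Complex q-Pochhammer symbols -/

section Pochhammer

/-- The `q`-Pochhammer symbol `(a; q)_n` for complex `a` and `q`. -/
noncomputable def poch (a q : ℂ) (n : ℕ) : ℂ := ∏ j ∈ Finset.range n, (1 - a * q ^ j)

/-- The `q`-Pochhammer symbol `(a; q)_∞` for complex `a` and `q`. -/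
noncomputable def pochInf (a q : ℂ) : ℂ := ∏' j : ℕ, (1 - a * q ^ j)

theorem poch_zero (a q : ℂ) : poch a q 0 = 1 := by simp [poch]

theorem poch_succ (a q : ℂ) (n : ℕ) : poch a q (n + 1) = poch a q n * (1 - a * q ^ n) := by
  simp [poch, Finset.prod_range_succ]

theorem poch_succ' (a q : ℂ) (n : ℕ) : poch a q (n + 1) = (1 - a) * poch (a * q) q n := by
  simp only [poch, Finset.prod_range_succ', pow_zero, mul_one]
  rw [mul_comm]
  congr 1
  exact Finset.prod_congr rfl fun j _ => by ring

theorem poch_add (a q : ℂ) (m n : ℕ) : poch a q (m + n) = poch a q m * poch (a * q ^ m) q n := by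
  simp only [poch, Finset.prod_range_add]
  congr 1
  exact Finset.prod_congr rfl fun j _ => by ring

theorem summable_norm_mul_pow (a : ℂ) {q : ℂ} (hq : ‖q‖ < 1) :
    Summable fun j : ℕ => ‖-(a * q ^ j)‖ := by
  simp only [norm_neg, norm_mul, norm_pow]
  exact (summable_geometric_of_lt_one (norm_nonneg q) hq).mul_left _

theorem tendsto_poch (a : ℂ) {q : ℂ} (hq : ‖q‖ < 1) :
    Tendsto (poch a q) atTop (𝓝 (pochInf a q)) := by
  have := (multipliable_one_add_of_summable (summable_norm_mul_pow a hq)).hasProd.tendsto_prod_nat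
  simp only [← sub_eq_add_neg] at this
  exact this

theorem one_sub_mul_pow_ne_zero {a q : ℂ} (hq : ‖q‖ < 1) (ha : ‖a‖ ≤ 1) (ha1 : a ≠ 1) (j : ℕ) :
    1 - a * q ^ j ≠ 0 := by
  intro h
  rcases Nat.eq_zero_or_pos j with rfl | hj
  · rw [pow_zero, mul_one, sub_eq_zero] at h
    exact ha1 h.symm
  · have h1 : ‖a * q ^ j‖ = 1 := by rw [← sub_eq_zero.1 h, norm_one]
    rw [norm_mul, norm_pow] at h1
    have h2 : ‖q‖ ^ j < 1 := pow_lt_one₀ (norm_nonneg _) hq hj.ne'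
    nlinarith [norm_nonneg a, pow_nonneg (norm_nonneg q) j]

theorem poch_ne_zero {a q : ℂ} (hq : ‖q‖ < 1) (ha : ‖a‖ ≤ 1) (ha1 : a ≠ 1) (n : ℕ) :
    poch a q n ≠ 0 :=
  Finset.prod_ne_zero_iff.2 fun j _ => one_sub_mul_pow_ne_zero hq ha ha1 j

theorem pochInf_ne_zero {a q : ℂ} (hq : ‖q‖ < 1) (ha : ‖a‖ ≤ 1) (ha1 : a ≠ 1) :
    pochInf a q ≠ 0 := by
  have := tprod_one_add_ne_zero_of_summable (f := fun j : ℕ => -(a * q ^ j))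
    (fun j => by rw [← sub_eq_add_neg]; exact one_sub_mul_pow_ne_zero hq ha ha1 j)
    (summable_norm_mul_pow a hq)
  simp only [← sub_eq_add_neg] at this
  exact this

theorem ne_one_of_norm_lt {q : ℂ} (hq : ‖q‖ < 1) : q ≠ 1 := by
  rintro rfl
  simp at hq

theorem pochInf_succ (a : ℂ) {q : ℂ} (hq : ‖q‖ < 1) :
    pochInf a q = (1 - a) * pochInf (a * q) q := by
  have h1 := (tendsto_poch a hq).comp (tendsto_add_atTop_nat 1)
  have h2 := (tendsto_poch (a * q) hq).const_mul (1 - a)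
  refine tendsto_nhds_unique h1 (h2.congr fun n => ?_)
  simp [poch_succ']

end Pochhammer

/-! ### Convergence of the series for F and G -/

section Bridge

theorem represents_qPoch {a : PowerSeries ℂ} {α : ℂ → ℂ} (h : Represents a α) (n : ℕ) :
    Represents (qPoch a n) (fun q => poch (α q) q n) :=
  Represents.prod_range (fun j => by
    simpa using (represents_C 1).sub (h.mul (represents_X.pow j))) n

theorem represents_qPochInf {a : PowerSeries ℂ} {α : ℂ → ℂ} (h : Represents a α) {M : ℝ}
    (hM : ∀ q : ℂ, ‖q‖ < 1 / 2 → ‖α q‖ ≤ M) :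
    Represents (qPochInf a) (fun q => pochInf (α q) q) := by
  refine Represents.limit (represents_qPoch h) ?_ fun n => ?_
  · have h1 := Summable.hasProdLocallyUniformlyOn_nat_one_add
      (f := fun (j : ℕ) (q : ℂ) => -(α q * q ^ j)) (K := Metric.ball (0 : ℂ) (1 / 2))
      Metric.isOpen_ball (u := fun j => M * (1 / 2) ^ j)
      ((summable_geometric_of_lt_one (by norm_num) (by norm_num)).mul_left _)
      (Eventually.of_forall fun j q hq => ?_) (fun j => ?_)
    · have h2 := h1.tendstoLocallyUniformlyOn_finsetRange
      simp only [← sub_eq_add_neg] at h2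
      exact h2
    · have hq' : ‖q‖ < 1 / 2 := by simpa using hq
      rw [norm_neg, norm_mul, norm_pow]
      exact mul_le_mul (hM q hq') (pow_le_pow_left₀ (norm_nonneg _) hq'.le _) (by positivity)
        ((norm_nonneg _).trans (hM q hq'))
    · exact (h.differentiableOn.continuousOn.mul (continuousOn_id.pow j)).neg
  · filter_upwards [eventually_gt_atTop n] with N hN
    exact coeff_qPoch a hN

/-- The terms of the analytic versions of `F` and `G`. -/
noncomputable def anTerm (e : ℕ) (z w q : ℂ) (n : ℕ) : ℂ :=
  poch z q n * poch z⁻¹ q n * poch w q n * poch w⁻¹ q n * q ^ (e * n) / poch q q (2 * n)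

theorem norm_poch_le {a q : ℂ} (ha : ‖a‖ ≤ 1) (hq : ‖q‖ < 1 / 2) (n : ℕ) :
    ‖poch a q n‖ ≤ Real.exp 2 := by
  have h1 : ∀ j ∈ Finset.range n, ‖1 - a * q ^ j‖ ≤ Real.exp ((1 / 2) ^ j) := by
    intro j _
    calc ‖1 - a * q ^ j‖ ≤ 1 + ‖a‖ * ‖q‖ ^ j := by
          simpa using norm_sub_le (1 : ℂ) (a * q ^ j)
      _ ≤ 1 + 1 * (1 / 2) ^ j := by gcongr
      _ ≤ Real.exp ((1 / 2) ^ j) := by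
          rw [one_mul, add_comm]; exact Real.add_one_le_exp _
  rw [poch, norm_prod]
  refine (Finset.prod_le_prod (fun _ _ => norm_nonneg _) h1).trans ?_
  rw [← Real.exp_sum, Real.exp_le_exp]
  have := (summable_geometric_of_lt_one (r := (1 / 2 : ℝ)) (by norm_num)
    (by norm_num)).sum_le_tsum (Finset.range n) fun _ _ => by positivity
  rw [tsum_geometric_two] at this
  exact this

/-- A uniform lower bound for the denominators (q)_{2n}, available because the product of the 1 -
2^{-j} over j ≥ 1 exceeds 1/4. -/
theorem le_norm_poch_self {q : ℂ} (hq : ‖q‖ < 1 / 2) (n : ℕ) : 1 / 4 ≤ ‖poch q q n‖ := by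
  -- The surplus x = 2^{-(n+2)} closes the induction: (1/4 + x)(1 - x) ≥ 1/4 + x/2 as soon as x ≤
  -- 1/4.
  have key : ∀ n : ℕ, 1 / 4 + (1 / 2) ^ (n + 2) ≤ ‖poch q q (n + 1)‖ := by
    intro n
    induction n with
    | zero =>
      have := norm_sub_norm_le (1 : ℂ) q
      rw [norm_one] at this
      simp only [poch_succ, poch_zero, pow_zero, mul_one, one_mul]
      norm_num
      linarith
    | succ n ih =>
      rw [poch_succ, norm_mul]
      have h1 : 1 - (1 / 2 : ℝ) ^ (n + 2) ≤ ‖1 - q * q ^ (n + 1)‖ := by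
        have := norm_sub_norm_le (1 : ℂ) (q * q ^ (n + 1))
        rw [norm_one, ← pow_succ', norm_pow] at this
        have h2 := pow_le_pow_left₀ (norm_nonneg q) hq.le (n + 2)
        rw [← pow_succ']
        exact (sub_le_sub_left h2 1).trans this
      have hx : (1 / 2 : ℝ) ^ (n + 2) ≤ 1 / 4 := by
        have := pow_le_pow_of_le_one (by norm_num : (0 : ℝ) ≤ 1 / 2) (by norm_num)
          (by omega : 2 ≤ n + 2)
        exact this.trans (by norm_num)
      have hx0 : (0 : ℝ) < (1 / 2) ^ (n + 2) := by positivity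
      have h3 : (1 / 2 : ℝ) ^ (n + 1 + 2) = (1 / 2) ^ (n + 2) * (1 / 2) := by rw [← pow_succ]
      rw [h3]
      generalize (1 / 2 : ℝ) ^ (n + 2) = x at *
      refine le_trans ?_ (mul_le_mul ih h1 (by linarith) (norm_nonneg _))
      nlinarith
  rcases n with _ | n
  · rw [poch_zero, norm_one]; norm_num
  · exact le_trans (by simp) (key n)

theorem norm_anTerm_le (e : ℕ) (he : 1 ≤ e) {z w q : ℂ} (hz : ‖z‖ = 1) (hw : ‖w‖ = 1)
    (hq : ‖q‖ < 1 / 2) (n : ℕ) :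
    ‖anTerm e z w q n‖ ≤ Real.exp 2 ^ 4 * 4 * (1 / 2) ^ n := by
  have hz' : ‖z⁻¹‖ ≤ 1 := by simp [hz]
  have hw' : ‖w⁻¹‖ ≤ 1 := by simp [hw]
  rw [anTerm, norm_div, div_le_iff₀ (by linarith [le_norm_poch_self hq (2 * n)]), norm_mul,
    norm_mul, norm_mul, norm_mul, norm_pow]
  have h5 : ‖q‖ ^ (e * n) ≤ (1 / 2) ^ n := by
    refine (pow_le_pow_of_le_one (norm_nonneg _) (by linarith)
      (Nat.le_mul_of_pos_left n he)).trans (pow_le_pow_left₀ (norm_nonneg _) hq.le _)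
  calc ‖poch z q n‖ * ‖poch z⁻¹ q n‖ * ‖poch w q n‖ * ‖poch w⁻¹ q n‖ * ‖q‖ ^ (e * n)
      ≤ Real.exp 2 * Real.exp 2 * Real.exp 2 * Real.exp 2 * (1 / 2) ^ n := by
        gcongr
        · exact norm_poch_le hz.le hq n
        · exact norm_poch_le hz' hq n
        · exact norm_poch_le hw.le hq n
        · exact norm_poch_le hw' hq n
    _ = Real.exp 2 ^ 4 * 4 * (1 / 2) ^ n * (1 / 4) := by ring
    _ ≤ _ := by
        gcongr
        exact le_norm_poch_self hq _

/-- The sum over `n ≥ 1` of the terms of `F` (for `e = 1`) or of `G` (for `e = 2`). -/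
noncomputable def anSum (e : ℕ) (z w q : ℂ) : ℂ := ∑' n : ℕ, anTerm e z w q (n + 1)

/-- The analytic version of `F` (for `e = 1`) and of `G` (for `e = 2`). -/
noncomputable def anSeries (e : ℕ) (z w q : ℂ) : ℂ :=
  pochInf q q / (pochInf z q * pochInf z⁻¹ q * pochInf w q * pochInf w⁻¹ q) * anSum e z w q

theorem represents_seriesTerm (e : ℕ) {z w : ℂ} (hw : w ≠ 0) (n : ℕ) :
    Represents (seriesTerm e w w⁻¹ z n) (fun q => anTerm e z w q n) := by
  have h := ((((represents_qPoch (represents_C z) n).mul (represents_qPoch (represents_C z⁻¹) n)).mul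
    (represents_qPoch (represents_C w) n)).mul (represents_qPoch (represents_C w⁻¹) n)).mul
    ((represents_X.pow e).pow n)
  have h2 := h.div (represents_qPoch represents_X (2 * n)) fun q hq =>
    poch_ne_zero (by linarith) (by linarith) (ne_one_of_norm_lt (by linarith)) _
  have e1 : seriesTerm e w w⁻¹ z n = qPoch (PowerSeries.C z) n * qPoch (PowerSeries.C z⁻¹) n *
      qPoch (PowerSeries.C w) n * qPoch (PowerSeries.C w⁻¹) n * (PowerSeries.X ^ e) ^ n *
      (qPoch PowerSeries.X (2 * n))⁻¹ := by
    rw [seriesTerm, mul_inv_cancel₀ hw, inv_one, map_one, mul_one]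
  rw [e1]
  exact h2.congr fun q _ => by rw [anTerm, pow_mul]

theorem represents_termSum {e : ℕ} (he : 1 ≤ e) {z w : ℂ} (hz : ‖z‖ = 1) (hw : ‖w‖ = 1) :
    Represents (termSum e w w⁻¹ z) (fun q => anSum e z w q) := by
  have hw0 : w ≠ 0 := by rintro rfl; simp at hw
  refine Represents.limit (fs := fun N => ∑ n ∈ Finset.range N, seriesTerm e w w⁻¹ z (n + 1))
    (gs := fun N q => ∑ n ∈ Finset.range N, anTerm e z w q (n + 1))
    (fun N => Represents.sum _ fun n _ => represents_seriesTerm e hw0 _) ?_ fun n => ?_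
  · have h1 : Summable fun n : ℕ => Real.exp 2 ^ 4 * 4 * (1 / 2) ^ (n + 1) := by
      refine (Summable.mul_left _ ?_)
      exact (summable_geometric_of_lt_one (by norm_num) (by norm_num)).comp_injective
        (add_left_injective 1)
    exact (tendstoUniformlyOn_tsum_nat h1 fun n q hq =>
      norm_anTerm_le e he hz hw (by simpa using hq) (n + 1)).tendstoLocallyUniformlyOn
  · filter_upwards [eventually_ge_atTop n] with N hN
    rw [map_sum, termSum, PowerSeries.coeff_mk]
    rw [Finset.range_eq_Ico, Finset.sum_Ico_add'
      (fun k => PowerSeries.coeff n (seriesTerm e w w⁻¹ z k)) 0 N 1]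
    symm
    refine Finset.sum_subset (fun k hk => ?_) fun k hk hk' => ?_
    · rw [Finset.mem_Icc] at hk
      exact Finset.mem_Ico.2 (by omega)
    · rw [Finset.mem_Icc] at hk'
      rw [Finset.mem_Ico] at hk
      exact coeff_seriesTerm_eq_zero he _ _ _ (by omega)

theorem represents_prefactor_mul {e : ℕ} (he : 1 ≤ e) {z w : ℂ} (hz : ‖z‖ = 1) (hw : ‖w‖ = 1)
    (hz1 : z ≠ 1) (hw1 : w ≠ 1) :
    Represents (prefactor w w⁻¹ z * termSum e w w⁻¹ z) (fun q => anSeries e z w q) := by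
  have hq : Represents (qPochInf PowerSeries.X) (fun q => pochInf q q) :=
    represents_qPochInf represents_X (M := 1) fun q hq => by linarith
  have hc : ∀ a : ℂ, Represents (qPochInf (PowerSeries.C a)) (fun q => pochInf a q) := fun a =>
    represents_qPochInf (represents_C a) (M := ‖a‖) fun q hq => le_rfl
  have hz' : ‖z⁻¹‖ ≤ 1 := by simp [hz]
  have hw' : ‖w⁻¹‖ ≤ 1 := by simp [hw]
  have hz1' : z⁻¹ ≠ 1 := by simpa using hz1
  have hw1' : w⁻¹ ≠ 1 := by simpa using hw1
  refine (hq.div ((((hc z).mul (hc z⁻¹)).mul (hc w)).mul (hc w⁻¹)) fun q hq => ?_).mul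
    (represents_termSum he hz hw)
  have hq1 : ‖q‖ < 1 := by linarith
  exact mul_ne_zero (mul_ne_zero (mul_ne_zero (pochInf_ne_zero hq1 hz.le hz1)
    (pochInf_ne_zero hq1 hz' hz1')) (pochInf_ne_zero hq1 hw.le hw1)) (pochInf_ne_zero hq1 hw' hw1')

end Bridge

end RankQuadruples

namespace RankQuadruples

open Filter Topology

/-! ### Theta series -/

section Theta

/-- The generalised triangular number `n (n - 1) / 2`. -/
def tri (n : ℤ) : ℤ := n * (n - 1) / 2

theorem tri_add_one (n : ℤ) : tri (n + 1) = tri n + n := by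
  rw [tri, tri, ← Int.add_mul_ediv_right _ _ (by norm_num : (2 : ℤ) ≠ 0)]
  congr 1
  ring

theorem two_mul_tri (n : ℤ) : 2 * tri n = n * (n - 1) :=
  Int.mul_ediv_cancel' (Int.even_mul_pred_self n).two_dvd

theorem tri_one_sub (n : ℤ) : tri (1 - n) = tri n := by
  rw [tri, tri]; congr 1; ring

theorem tri_neg (n : ℤ) : tri (-n) = tri n + n := by
  rw [← tri_add_one, tri, tri]; congr 1; ring

theorem tri_zero : tri 0 = 0 := rfl

/-- The ratio test settles n ≥ 0. Negative indices reduce to it by `tri_neg`, with `y` replaced by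
`ρ / y`. -/
theorem summable_zpow_tri {ρ y : ℝ} (h0 : 0 < ρ) (h1 : ρ < 1) (hy : 0 < y) :
    Summable fun n : ℤ => ρ ^ tri n * y ^ n := by
  have key : ∀ y : ℝ, 0 < y → Summable fun n : ℕ => ρ ^ tri n * y ^ (n : ℤ) := by
    intro y hy
    refine summable_of_ratio_test_tendsto_lt_one zero_lt_one
      (Eventually.of_forall fun n => by positivity) ?_
    have h2 := (tendsto_pow_atTop_nhds_zero_of_lt_one h0.le h1).mul_const y
    rw [zero_mul] at h2
    refine h2.congr fun n => ?_
    rw [Real.norm_of_nonneg (by positivity), Real.norm_of_nonneg (by positivity), Nat.cast_succ,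
      tri_add_one, zpow_add₀ h0.ne', zpow_add₀ hy.ne', zpow_natCast, zpow_natCast, zpow_one]
    have : ρ ^ tri n ≠ 0 := (zpow_pos h0 _).ne'
    field_simp
  refine Summable.of_nat_of_neg (key y hy) ((key (ρ / y) (by positivity)).congr fun n => ?_)
  rw [tri_neg, zpow_add₀ h0.ne', div_zpow, zpow_neg]
  field_simp

variable {q : ℂ}

theorem summable_theta_norm (h0 : q ≠ 0) (h1 : ‖q‖ < 1) {x : ℂ} (hx : x ≠ 0) :
    Summable fun n : ℤ => ‖q ^ tri n * x ^ n‖ := by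
  simp only [norm_mul, norm_zpow]
  exact summable_zpow_tri (norm_pos_iff.2 h0) h1 (norm_pos_iff.2 hx)

/-- A family that is dominated by the terms of a theta series is summable. -/
theorem summable_of_le_theta (h0 : q ≠ 0) (h1 : ‖q‖ < 1) {x : ℂ} (hx : x ≠ 0) {f : ℤ → ℂ} {M : ℝ}
    (hf : ∀ n, ‖f n‖ ≤ M * ‖q ^ tri n * x ^ n‖) : Summable fun n => ‖f n‖ :=
  Summable.of_nonneg_of_le (fun _ => norm_nonneg _) hf ((summable_theta_norm h0 h1 hx).mul_left M)

theorem norm_neg_one_zpow (n : ℤ) : ‖(-1 : ℂ) ^ n‖ = 1 := by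
  rw [norm_zpow, norm_neg, norm_one, one_zpow]

/-- The theta series `∑ (-1)ⁿ q^{n(n-1)/2} xⁿ`. -/
noncomputable def theta (q x : ℂ) : ℂ := ∑' n : ℤ, (-1) ^ n * (q ^ tri n * x ^ n)

/-- The theta series `∑ n (-1)ⁿ q^{n(n-1)/2} xⁿ`. -/
noncomputable def thetaD (q x : ℂ) : ℂ := ∑' n : ℤ, n * ((-1) ^ n * (q ^ tri n * x ^ n))

theorem summable_theta (h0 : q ≠ 0) (h1 : ‖q‖ < 1) {x : ℂ} (hx : x ≠ 0) :
    Summable fun n : ℤ => ‖(-1) ^ n * (q ^ tri n * x ^ n)‖ :=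
  summable_of_le_theta h0 h1 hx (M := 1) fun n => by
    rw [norm_mul, norm_neg_one_zpow]

theorem summable_thetaD (h0 : q ≠ 0) (h1 : ‖q‖ < 1) {x : ℂ} (hx : x ≠ 0) :
    Summable fun n : ℤ => ‖n * ((-1) ^ n * (q ^ tri n * x ^ n))‖ := by
  have h2 := (summable_theta_norm h0 h1 (mul_ne_zero hx two_ne_zero)).add
    (summable_theta_norm h0 h1 (div_ne_zero hx two_ne_zero))
  refine Summable.of_nonneg_of_le (fun _ => norm_nonneg _) (fun n => ?_) h2
  -- This bound dominates the series by the theta series at `2x` and `x / 2`.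
  have h3 : ‖(n : ℂ)‖ ≤ 2 ^ n + (2 ^ n)⁻¹ := by
    rw [Complex.norm_intCast]
    have hk : ∀ k : ℕ, (k : ℝ) ≤ 2 ^ k := fun k => by exact_mod_cast Nat.lt_two_pow_self.le
    obtain ⟨k, rfl | rfl⟩ := n.eq_nat_or_neg
    · have := hk k
      have h4 : (0 : ℝ) < (2 ^ k)⁻¹ := by positivity
      simp only [Int.cast_natCast, Nat.abs_cast, zpow_natCast]
      linarith
    · have := hk k
      have h4 : (0 : ℝ) < (2 ^ k)⁻¹ := by positivity
      simp only [Int.cast_neg, Int.cast_natCast, abs_neg, Nat.abs_cast, zpow_neg, zpow_natCast,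
        inv_inv]
      linarith
  rw [norm_mul, norm_mul, norm_neg_one_zpow, one_mul, mul_zpow, div_zpow, ← mul_assoc,
    norm_mul (_ * _), mul_div_assoc', norm_div, norm_zpow 2, RCLike.norm_ofNat]
  calc ‖(n : ℂ)‖ * ‖q ^ tri n * x ^ n‖ ≤ (2 ^ n + (2 ^ n)⁻¹) * ‖q ^ tri n * x ^ n‖ := by gcongr
    _ = _ := by rw [div_eq_mul_inv]; ring

theorem theta_q_mul (h0 : q ≠ 0) {x : ℂ} (hx : x ≠ 0) : theta q (q * x) = -x⁻¹ * theta q x := by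
  rw [theta, theta, ← (Equiv.addRight (1 : ℤ)).tsum_eq (fun n => (-1) ^ n * (q ^ tri n * x ^ n)),
    ← tsum_mul_left]
  refine tsum_congr fun n => ?_
  rw [Equiv.coe_addRight, tri_add_one, zpow_add₀ h0, zpow_add₀ hx, mul_zpow,
    zpow_add₀ (neg_ne_zero.2 one_ne_zero)]
  simp only [zpow_one]
  field_simp

theorem theta_inv (h0 : q ≠ 0) {x : ℂ} (hx : x ≠ 0) : theta q x⁻¹ = -x⁻¹ * theta q x := by
  rw [← theta_q_mul h0 hx, theta, theta, ← (Equiv.neg ℤ).tsum_eq]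
  refine tsum_congr fun n => ?_
  rw [Equiv.neg_apply, tri_neg, zpow_add₀ h0, mul_zpow, inv_zpow, zpow_neg x, inv_inv, zpow_neg,
    ← inv_zpow, inv_neg, inv_one]
  ring

theorem theta_q_div (h0 : q ≠ 0) {x : ℂ} (hx : x ≠ 0) : theta q (q / x) = theta q x := by
  rw [div_eq_mul_inv, theta_q_mul h0 (inv_ne_zero hx), theta_inv h0 hx, inv_inv]
  field_simp

theorem theta_one (h0 : q ≠ 0) : theta q 1 = 0 := by
  have := theta_inv h0 one_ne_zero
  rw [inv_one] at this
  linear_combination this / 2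

theorem thetaD_q_div (h0 : q ≠ 0) {x : ℂ} (hx : x ≠ 0) : thetaD q (q / x) = -thetaD q x := by
  rw [thetaD, thetaD, ← (Equiv.neg ℤ).tsum_eq, ← tsum_neg]
  refine tsum_congr fun n => ?_
  rw [Equiv.neg_apply, tri_neg, zpow_add₀ h0, div_zpow, zpow_neg x, zpow_neg q, zpow_neg (-1),
    ← inv_zpow (-1), inv_neg, inv_one]
  have := zpow_ne_zero n h0
  have := zpow_ne_zero n hx
  push_cast
  field_simp

/-! ### The finite Jacobi triple product -/

/-- `1 / (q; q)_m`, extended by `0` to negative `m`. -/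
noncomputable def invPoch (q : ℂ) (m : ℤ) : ℂ := if m < 0 then 0 else (poch q q m.toNat)⁻¹

theorem invPoch_natCast (q : ℂ) (m : ℕ) : invPoch q m = (poch q q m)⁻¹ := by
  simp [invPoch]

theorem invPoch_rec (h1 : ‖q‖ < 1) (m : ℤ) : invPoch q m = invPoch q (m + 1) * (1 - q ^ (m + 1)) := by
  rcases lt_trichotomy m (-1) with h | rfl | h
  · rw [invPoch, invPoch, if_pos (by omega), if_pos (by omega), zero_mul]
  · simp [invPoch]
  · obtain ⟨k, rfl⟩ := Int.eq_ofNat_of_zero_le (by omega : 0 ≤ m)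
    have h2 := one_sub_mul_pow_ne_zero h1 h1.le (ne_one_of_norm_lt h1) k
    rw [← Nat.cast_succ, invPoch_natCast, invPoch_natCast, poch_succ, zpow_natCast, pow_succ',
      mul_inv, mul_assoc, inv_mul_cancel₀ h2, mul_one]

theorem norm_invPoch_le (h1 : ‖q‖ < 1) : ∃ M : ℝ, ∀ m, ‖invPoch q m‖ ≤ M := by
  have h2 := ((tendsto_poch q h1).inv₀
    (pochInf_ne_zero h1 h1.le (ne_one_of_norm_lt h1))).norm.bddAbove_range
  obtain ⟨M, hM⟩ := h2
  refine ⟨M, fun m => ?_⟩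
  have hM' : ∀ n, ‖(poch q q n)⁻¹‖ ≤ M := fun n => hM ⟨n, rfl⟩
  rw [invPoch]
  split_ifs
  · rw [norm_zero]; exact (norm_nonneg _).trans (hM' 0)
  · exact hM' _

theorem tendsto_invPoch (h1 : ‖q‖ < 1) (r : ℤ) :
    Tendsto (fun n : ℕ => invPoch q (n + r)) atTop (𝓝 (pochInf q q)⁻¹) := by
  have h2 := (tendsto_poch q h1).inv₀ (pochInf_ne_zero h1 h1.le (ne_one_of_norm_lt h1))
  have h3 : Tendsto (fun n : ℕ => ((n : ℤ) + r).toNat) atTop atTop := by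
    refine tendsto_atTop.2 fun b => ?_
    filter_upwards [eventually_ge_atTop (b + r.natAbs)] with n hn
    omega
  refine (h2.comp h3).congr' ?_
  filter_upwards [eventually_ge_atTop r.natAbs] with n hn
  rw [invPoch, if_neg (by omega)]
  rfl

/-- `1 / ((q; q)_{n - r} (q; q)_{n + r})`. -/
noncomputable def jtpCoeff (q : ℂ) (n : ℕ) (r : ℤ) : ℂ := invPoch q (n - r) * invPoch q (n + r)

theorem jtpCoeff_rec (h1 : ‖q‖ < 1) (n : ℕ) (r : ℤ) : jtpCoeff q n r =
    jtpCoeff q (n + 1) r * ((1 - q ^ (n + 1 - r : ℤ)) * (1 - q ^ (n + 1 + r : ℤ))) := by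
  rw [jtpCoeff, jtpCoeff, invPoch_rec h1 (n - r), invPoch_rec h1 (n + r)]
  push_cast
  rw [show (n : ℤ) - r + 1 = n + 1 - r by ring, show (n : ℤ) + r + 1 = n + 1 + r by ring]
  ring

theorem jtpCoeff_rec_left (h1 : ‖q‖ < 1) (n : ℕ) (r : ℤ) : jtpCoeff q n (r - 1) =
    jtpCoeff q (n + 1) r * ((1 - q ^ (n + r : ℤ)) * (1 - q ^ (n + 1 + r : ℤ))) := by
  rw [jtpCoeff, jtpCoeff, invPoch_rec h1 (n + (r - 1)), invPoch_rec h1 (n + (r - 1) + 1)]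
  push_cast
  rw [show (n : ℤ) - (r - 1) = n + 1 - r by ring, show (n : ℤ) + (r - 1) + 1 = n + r by ring,
    show (n : ℤ) + r + 1 = n + 1 + r by ring]
  ring

theorem jtpCoeff_rec_right (h1 : ‖q‖ < 1) (n : ℕ) (r : ℤ) : jtpCoeff q n (r + 1) =
    jtpCoeff q (n + 1) r * ((1 - q ^ (n - r : ℤ)) * (1 - q ^ (n + 1 - r : ℤ))) := by
  rw [jtpCoeff, jtpCoeff, invPoch_rec h1 (n - (r + 1)), invPoch_rec h1 (n - (r + 1) + 1)]
  push_cast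
  rw [show (n : ℤ) + (r + 1) = n + 1 + r by ring, show (n : ℤ) - (r + 1) + 1 = n - r by ring,
    show (n : ℤ) - r + 1 = n + 1 - r by ring]
  ring

theorem jtpCoeff_eq_zero {n : ℕ} {r : ℤ} (h : (n : ℤ) < |r|) : jtpCoeff q n r = 0 := by
  rcases lt_abs.1 h with h | h
  · rw [jtpCoeff, invPoch, if_pos (by omega), zero_mul]
  · rw [jtpCoeff, mul_comm, invPoch, if_pos (by omega), zero_mul]

theorem summable_mul_jtpCoeff (f : ℤ → ℂ) (n : ℕ) : Summable fun r => f r * jtpCoeff q n r := by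
  refine summable_of_ne_finset_zero (s := Finset.Icc (-(n : ℤ)) n) fun r hr => ?_
  rw [jtpCoeff_eq_zero, mul_zero]
  rw [Finset.mem_Icc] at hr
  rw [lt_abs]
  omega

/-- The finite form of the Jacobi triple product. -/
noncomputable def jtpSum (q x : ℂ) (n : ℕ) : ℂ :=
  ∑' r : ℤ, ((-1) ^ r * (q ^ tri r * x ^ r)) * jtpCoeff q n r

/-- The coefficient of x^r in multiplication by (1 - xq^n)(1 - q^{n+1}/x), the passage from n to n +
1. All values of `jtpCoeff` involved are multiples of `jtpCoeff q (n + 1) r`, which leaves the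
rational identity `key`. -/
theorem jtpCoeff_step (h0 : q ≠ 0) (h1 : ‖q‖ < 1) {x : ℂ} (hx : x ≠ 0) (n : ℕ) (r : ℤ) :
    (-1) ^ r * (q ^ tri r * x ^ r) * jtpCoeff q (n + 1) r *
      ((1 - q * q ^ (2 * n)) * (1 - q * q ^ (2 * n + 1))) =
    (-1) ^ r * (q ^ tri r * x ^ r) * ((1 + x * q ^ n * (q / x * q ^ n)) * jtpCoeff q n r) -
      (-1) ^ (r - 1) * (q ^ tri (r - 1) * x ^ (r - 1)) * (x * q ^ n * jtpCoeff q n (r - 1)) -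
      (-1) ^ (r + 1) * (q ^ tri (r + 1) * x ^ (r + 1)) * (q / x * q ^ n * jtpCoeff q n (r + 1)) := by
  have hm1 : (-1 : ℂ) ≠ 0 := neg_ne_zero.2 one_ne_zero
  have hr := zpow_ne_zero r h0
  have t1 : tri r = tri (r - 1) + (r - 1) := by rw [← tri_add_one]; ring_nf
  have t2 : q ^ tri (r - 1) = q ^ tri r * (q ^ r)⁻¹ * q := by
    rw [t1, zpow_add₀ h0, zpow_sub₀ h0, zpow_one]
    field_simp
  rw [jtpCoeff_rec h1 n r, jtpCoeff_rec_left h1 n r, jtpCoeff_rec_right h1 n r, t2, tri_add_one,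
    zpow_add₀ h0 (tri r), zpow_sub₀ hm1, zpow_sub₀ hx, zpow_add₀ hm1, zpow_add₀ hx,
    zpow_sub₀ h0, zpow_sub₀ h0, zpow_add₀ h0 (_ + _), zpow_add₀ h0 n r, zpow_add₀ h0 n 1]
  simp only [zpow_one, zpow_natCast]
  have e1 : ∀ S : ℂ, S / -1 = -S := fun S => by rw [div_neg, div_one]
  rw [e1, show q ^ (2 * n) = (q ^ n) ^ 2 by rw [mul_comm, pow_mul],
    show q ^ (2 * n + 1) = (q ^ n) ^ 2 * q by rw [pow_succ, mul_comm 2, pow_mul]]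
  generalize jtpCoeff q (n + 1) r = B
  generalize q ^ tri r = T
  generalize x ^ r = Y
  generalize (-1 : ℂ) ^ r = S
  generalize q ^ r = W at *
  generalize q ^ n = a at *
  have key : (1 - q * a ^ 2) * (1 - q * (a ^ 2 * q)) =
      (1 + x * a * (q / x * a)) * ((1 - a * q / W) * (1 - a * q * W)) +
        (W⁻¹ * q) * x⁻¹ * (x * a) * ((1 - a * W) * (1 - a * q * W)) +
        W * x * (q / x * a) * ((1 - a / W) * (1 - a * q / W)) := by
    field_simp
    ring
  linear_combination S * T * Y * B * key

/-- Summation of a three-term recurrence. -/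
theorem tsum_three_term (g B D : ℤ → ℂ) (α β γ δ : ℂ) (hs : Summable fun r => g r * B r)
    (h : ∀ r, g r * D r * δ =
      g r * (γ * B r) - g (r - 1) * (α * B (r - 1)) - g (r + 1) * (β * B (r + 1))) :
    (∑' r, g r * D r) * δ = (∑' r, g r * B r) * (γ - α - β) := by
  have h1 : HasSum (fun r => g r * (γ * B r)) ((∑' r, g r * B r) * γ) := by
    refine hasSum_of_forall_eq (hs.hasSum.mul_right γ) fun r => by ring
  have h2 : HasSum (fun r => g (r - 1) * (α * B (r - 1))) ((∑' r, g r * B r) * α) := by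
    have := (Equiv.subRight (1 : ℤ)).hasSum_iff.2 (hs.hasSum.mul_right α)
    refine hasSum_of_forall_eq this fun r => ?_
    simp only [Function.comp_apply, Equiv.subRight_apply]
    ring
  have h3 : HasSum (fun r => g (r + 1) * (β * B (r + 1))) ((∑' r, g r * B r) * β) := by
    have := (Equiv.addRight (1 : ℤ)).hasSum_iff.2 (hs.hasSum.mul_right β)
    refine hasSum_of_forall_eq this fun r => ?_
    simp only [Function.comp_apply, Equiv.coe_addRight]
    ring
  rw [← tsum_mul_right, tsum_congr h, ((h1.sub h2).sub h3).tsum_eq]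
  ring

theorem jtpSum_eq (h0 : q ≠ 0) (h1 : ‖q‖ < 1) {x : ℂ} (hx : x ≠ 0) (n : ℕ) :
    jtpSum q x n = poch x q n * poch (q / x) q n / poch q q (2 * n) := by
  have hm1 : (-1 : ℂ) ≠ 0 := neg_ne_zero.2 one_ne_zero
  induction n with
  | zero =>
    rw [jtpSum, tsum_eq_single 0]
    · simp [jtpCoeff, invPoch, poch_zero, tri_zero]
    · intro r hr
      rw [jtpCoeff_eq_zero (by simpa using hr), mul_zero]
  | succ n ih =>
    have e1 := one_sub_mul_pow_ne_zero h1 h1.le (ne_one_of_norm_lt h1) (2 * n)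
    have e2 := one_sub_mul_pow_ne_zero h1 h1.le (ne_one_of_norm_lt h1) (2 * n + 1)
    have e3 := poch_ne_zero h1 h1.le (ne_one_of_norm_lt h1) (2 * n)
    have key : jtpSum q x (n + 1) * ((1 - q * q ^ (2 * n)) * (1 - q * q ^ (2 * n + 1))) =
        jtpSum q x n * ((1 - x * q ^ n) * (1 - q / x * q ^ n)) := by
      have h := tsum_three_term (fun r : ℤ => (-1) ^ r * (q ^ tri r * x ^ r)) (jtpCoeff q n)
        (jtpCoeff q (n + 1)) _ _ _ _ (summable_mul_jtpCoeff _ n)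
        fun r => jtpCoeff_step h0 h1 hx n r
      rw [jtpSum, jtpSum, h]
      ring
    rw [poch_succ, poch_succ, show 2 * (n + 1) = 2 * n + 1 + 1 by ring, poch_succ q, poch_succ q,
      eq_div_iff (mul_ne_zero (mul_ne_zero e3 e1) e2)]
    rw [eq_div_iff e3] at ih
    linear_combination poch q q (2 * n) * key + (1 - x * q ^ n) * (1 - q / x * q ^ n) * ih

end Theta

end RankQuadruples

namespace RankQuadruples

open Filter Topology

/-! ### The bilateral series attached to F and G -/

section BilateralSeries

variable {q : ℂ}

theorem pochInf_self_ne_zero (h1 : ‖q‖ < 1) : pochInf q q ≠ 0 :=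
  pochInf_ne_zero h1 h1.le (ne_one_of_norm_lt h1)

theorem tendsto_jtpCoeff (h1 : ‖q‖ < 1) (r : ℤ) :
    Tendsto (fun n => jtpCoeff q n r) atTop (𝓝 ((pochInf q q)⁻¹ * (pochInf q q)⁻¹)) := by
  have := (tendsto_invPoch h1 (-r)).mul (tendsto_invPoch h1 r)
  simpa only [jtpCoeff, sub_eq_add_neg] using this

theorem norm_jtpCoeff_le (h1 : ‖q‖ < 1) : ∃ M : ℝ, 0 ≤ M ∧ ∀ n r, ‖jtpCoeff q n r‖ ≤ M := by
  obtain ⟨M, hM⟩ := norm_invPoch_le h1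
  refine ⟨M * M, mul_self_nonneg M, fun n r => ?_⟩
  rw [jtpCoeff, norm_mul]
  exact mul_le_mul (hM _) (hM _) (norm_nonneg _) ((norm_nonneg _).trans (hM 0))

theorem tendsto_poch_two_mul (h1 : ‖q‖ < 1) :
    Tendsto (fun n => poch q q (2 * n)) atTop (𝓝 (pochInf q q)) :=
  (tendsto_poch q h1).comp (tendsto_id.const_mul_atTop' two_pos)

/-- The Jacobi triple product. -/
theorem theta_eq (h0 : q ≠ 0) (h1 : ‖q‖ < 1) {x : ℂ} (hx : x ≠ 0) :
    theta q x = pochInf q q * (pochInf x q * pochInf (q / x) q) := by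
  obtain ⟨M, hM0, hM⟩ := norm_jtpCoeff_le h1
  have hE := pochInf_self_ne_zero h1
  have t1 : Tendsto (jtpSum q x) atTop
      (𝓝 (∑' r : ℤ, ((-1) ^ r * (q ^ tri r * x ^ r)) * ((pochInf q q)⁻¹ * (pochInf q q)⁻¹))) := by
    refine tendsto_tsum_of_dominated_convergence ((summable_theta h0 h1 hx).mul_right M)
      (fun r => (tendsto_jtpCoeff h1 r).const_mul _) (Eventually.of_forall fun n r => ?_)
    rw [norm_mul]
    exact mul_le_mul_of_nonneg_left (hM n r) (norm_nonneg _)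
  have t2 := ((tendsto_poch x h1).mul (tendsto_poch (q / x) h1)).div (tendsto_poch_two_mul h1) hE
  have := tendsto_nhds_unique t1 (t2.congr fun n => (jtpSum_eq h0 h1 hx n).symm)
  rw [tsum_mul_right, ← theta] at this
  field_simp at this
  linear_combination this

theorem pochInf_ne_zero_of_forall (h1 : ‖q‖ < 1) {a : ℂ} (ha : ∀ j : ℕ, 1 - a * q ^ j ≠ 0) :
    pochInf a q ≠ 0 := by
  have := tprod_one_add_ne_zero_of_summable (f := fun j : ℕ => -(a * q ^ j))
    (fun j => by rw [← sub_eq_add_neg]; exact ha j) (summable_norm_mul_pow a h1)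
  simp only [← sub_eq_add_neg] at this
  exact this

/-- The number `w` is not a power of `q`. -/
def NotPower (q w : ℂ) : Prop := ∀ r : ℤ, 1 - w * q ^ r ≠ 0

theorem NotPower.inv (h0 : q ≠ 0) {w : ℂ} (hw0 : w ≠ 0) (hw : NotPower q w) : NotPower q w⁻¹ := by
  intro r h
  refine hw (-r) ?_
  have hr := zpow_ne_zero r h0
  rw [zpow_neg]
  field_simp at h ⊢
  linear_combination -h

theorem theta_ne_zero (h0 : q ≠ 0) (h1 : ‖q‖ < 1) {w : ℂ} (hw0 : w ≠ 0) (hw : NotPower q w) :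
    theta q w ≠ 0 := by
  rw [theta_eq h0 h1 hw0]
  refine mul_ne_zero (pochInf_self_ne_zero h1) (mul_ne_zero
    (pochInf_ne_zero_of_forall h1 fun j => by simpa using hw j)
    (pochInf_ne_zero_of_forall h1 fun j => ?_))
  have := hw.inv h0 hw0 (j + 1)
  rw [zpow_add₀ h0, zpow_natCast, zpow_one] at this
  convert this using 2
  ring

theorem pochInf_mul_pochInf_inv (h0 : q ≠ 0) (h1 : ‖q‖ < 1) {x : ℂ} (hx : x ≠ 0) :
    pochInf q q * (pochInf x q * pochInf x⁻¹ q) = (1 - x⁻¹) * theta q x := by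
  rw [theta_eq h0 h1 hx, pochInf_succ x⁻¹ h1, mul_comm x⁻¹ q, ← div_eq_mul_inv]
  ring

/-! ### Two expansions of `(z)_n (1/z)_n / (q)_{2n}` -/

/-- The finite triple products at qz and, times z, at q/z are added. Relative to (z)_n(1/z)_n they
carry the factors (1 - zq^n)/(1 - z) and z(1 - q^n/z)/(1 - 1/z), whose sum is 1 + z. -/
theorem jtpSum_add_first (h0 : q ≠ 0) (h1 : ‖q‖ < 1) {z : ℂ} (hz : z ≠ 0) (n : ℕ) :
    ∑' r : ℤ, (-1) ^ r * q ^ tri (r + 1) * (z ^ r + z ^ (1 - r)) * jtpCoeff q n r =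
      (1 + z) * (poch z q n * poch z⁻¹ q n / poch q q (2 * n)) := by
  have e1 := jtpSum_eq h0 h1 (mul_ne_zero h0 hz) n
  have e2 := jtpSum_eq h0 h1 (div_ne_zero h0 hz) n
  have e3 : ∑' r : ℤ, (-1) ^ r * q ^ tri (r + 1) * (z ^ r + z ^ (1 - r)) * jtpCoeff q n r =
      jtpSum q (q * z) n + z * jtpSum q (q / z) n := by
    rw [jtpSum, jtpSum, ← tsum_mul_left, ← (summable_mul_jtpCoeff _ n).tsum_add
      ((summable_mul_jtpCoeff _ n).mul_left z)]
    refine tsum_congr fun r => ?_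
    rw [tri_add_one, zpow_add₀ h0, zpow_sub₀ hz, zpow_one, mul_zpow, div_zpow]
    ring
  rw [e3, e1, e2, div_div_cancel₀ h0, show q / (q * z) = z⁻¹ by field_simp]
  rcases n with _ | m
  · simp [poch_zero]
  · rw [poch_succ (q * z), poch_succ' z⁻¹, poch_succ (q / z), poch_succ' z, mul_comm z q,
      mul_comm z⁻¹ q, ← div_eq_mul_inv]
    field_simp
    ring

/-- The arguments z and 1/z give q^n(1 + z) instead. The extra q^n lets the q^{2n} of `G` be treated
by the same summation over n as `F`. -/
theorem jtpSum_add_second (h0 : q ≠ 0) (h1 : ‖q‖ < 1) {z : ℂ} (hz : z ≠ 0) (n : ℕ) :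
    ∑' r : ℤ, (-1) ^ r * q ^ tri r * (z ^ r + z ^ (1 - r)) * jtpCoeff q n r =
      (1 + z) * (q ^ n * (poch z q n * poch z⁻¹ q n / poch q q (2 * n))) := by
  have e1 := jtpSum_eq h0 h1 hz n
  have e2 := jtpSum_eq h0 h1 (inv_ne_zero hz) n
  have e3 : ∑' r : ℤ, (-1) ^ r * q ^ tri r * (z ^ r + z ^ (1 - r)) * jtpCoeff q n r =
      jtpSum q z n + z * jtpSum q z⁻¹ n := by
    rw [jtpSum, jtpSum, ← tsum_mul_left, ← (summable_mul_jtpCoeff _ n).tsum_add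
      ((summable_mul_jtpCoeff _ n).mul_left z)]
    refine tsum_congr fun r => ?_
    rw [zpow_sub₀ hz, zpow_one, inv_zpow]
    ring
  rw [e3, e1, e2, div_inv_eq_mul]
  rcases n with _ | m
  · simp [poch_zero]
  · rw [poch_succ (q * z), poch_succ' z⁻¹, poch_succ (q / z), poch_succ' z, mul_comm z q,
      mul_comm z⁻¹ q, ← div_eq_mul_inv]
    field_simp
    ring

/-! ### Summation over `n` -/

/-- For w ≠ 0 the family tends to 1 as r → ∞ and to 0 as r → -∞. A vanishing denominator contributes
0, so the bound also covers series with a pole left out. -/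
theorem norm_inv_one_sub_le (h0 : q ≠ 0) (h1 : ‖q‖ < 1) (w : ℂ) :
    ∃ M : ℝ, 0 ≤ M ∧ ∀ r : ℤ, ‖(1 - w * q ^ r)⁻¹‖ ≤ M := by
  rcases eq_or_ne w 0 with rfl | hw
  · exact ⟨1, zero_le_one, fun r => by simp⟩
  have hp := tendsto_pow_atTop_nhds_zero_of_norm_lt_one h1
  have t1 : Tendsto (fun n : ℕ => (1 - w * q ^ n)⁻¹) atTop (𝓝 (1 - w * 0)⁻¹) :=
    ((hp.const_mul w).const_sub 1).inv₀ (by simp)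
  have t2 : Tendsto (fun n : ℕ => q ^ n * (q ^ n - w)⁻¹) atTop (𝓝 (0 * (0 - w)⁻¹)) :=
    hp.mul ((hp.sub_const w).inv₀ (by simpa using hw))
  obtain ⟨M₁, hM₁⟩ := t1.norm.bddAbove_range
  obtain ⟨M₂, hM₂⟩ := t2.norm.bddAbove_range
  refine ⟨max M₁ M₂, ((norm_nonneg _).trans (hM₁ ⟨0, rfl⟩)).trans (le_max_left _ _), fun r => ?_⟩
  obtain ⟨k, rfl | rfl⟩ := r.eq_nat_or_neg
  · rw [zpow_natCast]
    exact (hM₁ ⟨k, rfl⟩).trans (le_max_left _ _)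
  · refine le_trans (le_of_eq ?_) ((hM₂ ⟨k, rfl⟩).trans (le_max_right _ _))
    simp only
    rw [zpow_neg, zpow_natCast]
    have hk := pow_ne_zero k h0
    congr 1
    rw [show 1 - w * (q ^ k)⁻¹ = (q ^ k - w) * (q ^ k)⁻¹ by field_simp, mul_inv, inv_inv, mul_comm]

/-- The denominator `(1 - w q^r) (1 - q^r / w)`. -/
noncomputable def den (q w : ℂ) (r : ℤ) : ℂ := (1 - w * q ^ r) * (1 - w⁻¹ * q ^ r)

theorem den_ne_zero (h0 : q ≠ 0) {w : ℂ} (hw0 : w ≠ 0) (hw : NotPower q w) (r : ℤ) :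
    den q w r ≠ 0 := mul_ne_zero (hw r) (hw.inv h0 hw0 r)

/-- The sum telescopes: the partial sums have the closed form `hpart`, and the value is its limit.
-/
theorem hasSum_poch_mul_jtpCoeff (h0 : q ≠ 0) (h1 : ‖q‖ < 1) {w : ℂ} (hw0 : w ≠ 0)
    (hw : NotPower q w) (r : ℤ) :
    HasSum (fun n : ℕ => poch w q n * poch w⁻¹ q n * q ^ n * jtpCoeff q n r)
      (pochInf w q * pochInf w⁻¹ q * ((pochInf q q)⁻¹ * (pochInf q q)⁻¹) * (q ^ r / den q w r)) := by
  obtain ⟨M, hM0, hM⟩ := norm_jtpCoeff_le h1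
  have hd := den_ne_zero h0 hw0 hw r
  have tw := (tendsto_poch w h1).mul (tendsto_poch w⁻¹ h1)
  have hsum : Summable fun n : ℕ => poch w q n * poch w⁻¹ q n * q ^ n * jtpCoeff q n r := by
    obtain ⟨C, hC⟩ := tw.norm.bddAbove_range
    refine Summable.of_norm_bounded
      ((summable_geometric_of_lt_one (norm_nonneg q) h1).mul_left (C * M)) fun n => ?_
    have hC' : ‖poch w q n * poch w⁻¹ q n‖ ≤ C := hC ⟨n, rfl⟩
    rw [norm_mul, norm_mul _ (q ^ n), norm_pow]
    calc ‖poch w q n * poch w⁻¹ q n‖ * ‖q‖ ^ n * ‖jtpCoeff q n r‖ ≤ C * ‖q‖ ^ n * M := by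
          gcongr
          · exact mul_nonneg ((norm_nonneg _).trans hC') (by positivity)
          · exact hM n r
      _ = _ := by ring
  have hpart : ∀ N : ℕ, ∑ n ∈ Finset.range N, poch w q n * poch w⁻¹ q n * q ^ n * jtpCoeff q n r =
      poch w q N * poch w⁻¹ q N * ((1 - q ^ (N - r : ℤ)) * (1 - q ^ (N + r : ℤ)) * jtpCoeff q N r) *
        (q ^ r / den q w r) := by
    intro N
    induction N with
    | zero =>
      rcases eq_or_ne r 0 with rfl | hr
      · simp
      · rw [jtpCoeff_eq_zero (by simpa using hr)]; simp
    | succ n ih =>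
      have e1 : (1 - q ^ ((n + 1 : ℕ) - r : ℤ)) * (1 - q ^ ((n + 1 : ℕ) + r : ℤ)) *
          jtpCoeff q (n + 1) r = jtpCoeff q n r := by
        rw [jtpCoeff_rec h1 n r]; push_cast; ring
      rw [Finset.sum_range_succ, ih, e1, poch_succ, poch_succ]
      have hr := zpow_ne_zero r h0
      -- The telescoping identity: the two quadratic products on the right differ by q^{n-r} times
      -- `den`.
      have e2 : q ^ n * den q w r = q ^ r * ((1 - w * q ^ n) * (1 - w⁻¹ * q ^ n) -
          (1 - q ^ (n - r : ℤ)) * (1 - q ^ (n + r : ℤ))) := by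
        rw [zpow_sub₀ h0, zpow_add₀ h0, den, zpow_natCast]
        field_simp
        ring
      rw [mul_div_assoc', mul_div_assoc', div_add' _ _ _ hd]
      congr 1
      linear_combination poch w q n * poch w⁻¹ q n * jtpCoeff q n r * e2
  have hlim : Tendsto (fun N : ℕ => ∑ n ∈ Finset.range N,
      poch w q n * poch w⁻¹ q n * q ^ n * jtpCoeff q n r) atTop
      (𝓝 (pochInf w q * pochInf w⁻¹ q * ((pochInf q q)⁻¹ * (pochInf q q)⁻¹) *
        (q ^ r / den q w r))) := by
    rw [← tendsto_add_atTop_iff_nat 1]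
    refine ((((tendsto_add_atTop_iff_nat 1).2 tw).mul (tendsto_jtpCoeff h1 r)).mul_const
      (q ^ r / den q w r)).congr fun n => ?_
    rw [hpart, jtpCoeff_rec h1 n r]
    push_cast
    ring
  rw [tendsto_nhds_unique hlim hsum.hasSum.tendsto_sum_nat]
  exact hsum.hasSum

theorem summable_poch_mul (h1 : ‖q‖ < 1) (w : ℂ) {c : ℤ → ℂ} (hc : Summable fun r => ‖c r‖) :
    Summable fun p : ℕ × ℤ =>
      poch w q p.1 * poch w⁻¹ q p.1 * q ^ p.1 * (c p.2 * jtpCoeff q p.1 p.2) := by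
  obtain ⟨M, hM0, hM⟩ := norm_jtpCoeff_le h1
  obtain ⟨C, hC⟩ := ((tendsto_poch w h1).mul (tendsto_poch w⁻¹ h1)).norm.bddAbove_range
  have hC' : ∀ n, ‖poch w q n * poch w⁻¹ q n‖ ≤ C := fun n => hC ⟨n, rfl⟩
  have hC0 : 0 ≤ C := (norm_nonneg _).trans (hC' 0)
  have h2 := ((summable_geometric_of_lt_one (norm_nonneg q) h1).mul_of_nonneg hc
    (fun n => by positivity) fun r => norm_nonneg _).mul_left (C * M)
  refine Summable.of_norm_bounded h2 fun p => ?_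
  rw [norm_mul, norm_mul _ (q ^ _), norm_pow, norm_mul (c _)]
  have e1 := hC' p.1
  have e2 := hM p.1 p.2
  generalize ‖poch w q p.1 * poch w⁻¹ q p.1‖ = x at *
  calc x * ‖q‖ ^ p.1 * (‖c p.2‖ * ‖jtpCoeff q p.1 p.2‖)
      ≤ C * ‖q‖ ^ p.1 * (‖c p.2‖ * M) := by gcongr
    _ = _ := by ring

theorem hasSum_poch_mul_tsum (h0 : q ≠ 0) (h1 : ‖q‖ < 1) {w : ℂ} (hw0 : w ≠ 0)
    (hw : NotPower q w) {c : ℤ → ℂ} (hc : Summable fun r => ‖c r‖) :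
    HasSum (fun n : ℕ => poch w q n * poch w⁻¹ q n * q ^ n * ∑' r : ℤ, c r * jtpCoeff q n r)
      (pochInf w q * pochInf w⁻¹ q * ((pochInf q q)⁻¹ * (pochInf q q)⁻¹) *
        ∑' r : ℤ, c r * (q ^ r / den q w r)) := by
  obtain ⟨S, hS⟩ := summable_poch_mul h1 w hc
  have h2 : HasSum (fun n : ℕ => poch w q n * poch w⁻¹ q n * q ^ n *
      ∑' r : ℤ, c r * jtpCoeff q n r) S := by
    refine HasSum.prod_fiberwise hS fun n => ?_
    exact (summable_mul_jtpCoeff c n).hasSum.mul_left (poch w q n * poch w⁻¹ q n * q ^ n)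
  have h3 : HasSum (fun r => c r * (pochInf w q * pochInf w⁻¹ q *
      ((pochInf q q)⁻¹ * (pochInf q q)⁻¹) * (q ^ r / den q w r))) S := by
    refine HasSum.prod_fiberwise ((Equiv.prodComm ℤ ℕ).hasSum_iff.2 hS) fun r => ?_
    refine hasSum_of_forall_eq ((hasSum_poch_mul_jtpCoeff h0 h1 hw0 hw r).mul_left (c r)) fun n => ?_
    simp only [Function.comp_apply, Equiv.prodComm_apply, Prod.swap_prod_mk]
    ring
  have h4 : pochInf w q * pochInf w⁻¹ q * ((pochInf q q)⁻¹ * (pochInf q q)⁻¹) *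
      ∑' r : ℤ, c r * (q ^ r / den q w r) = S := by
    rw [← h3.tsum_eq, ← tsum_mul_left]
    exact tsum_congr fun r => by ring
  rw [h4]
  exact h2

/-- The bilateral series attached to `F`. -/
noncomputable def phiF (q z w : ℂ) : ℂ :=
  ∑' r : ℤ, (-1) ^ r * q ^ tri (r + 1) * (z ^ r + z ^ (1 - r)) * (q ^ r / den q w r)

/-- The bilateral series attached to `G`. -/
noncomputable def phiG (q z w : ℂ) : ℂ :=
  ∑' r : ℤ, (-1) ^ r * q ^ tri r * (z ^ r + z ^ (1 - r)) * (q ^ r / den q w r)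

theorem norm_zpow_add_zpow_le {z : ℂ} (hz : ‖z‖ = 1) (r : ℤ) : ‖z ^ r + z ^ (1 - r)‖ ≤ 2 := by
  refine (norm_add_le _ _).trans ?_
  rw [norm_zpow, norm_zpow, hz, one_zpow, one_zpow]
  norm_num

theorem hasSum_anTerm_one (h0 : q ≠ 0) (h1 : ‖q‖ < 1) {z w : ℂ} (hz : ‖z‖ = 1) (hw0 : w ≠ 0)
    (hw : NotPower q w) :
    HasSum (fun n => (1 + z) * anTerm 1 z w q n)
      (pochInf w q * pochInf w⁻¹ q * ((pochInf q q)⁻¹ * (pochInf q q)⁻¹) * phiF q z w) := by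
  have hz0 : z ≠ 0 := by rintro rfl; simp at hz
  have hc : Summable fun r : ℤ => ‖(-1) ^ r * q ^ tri (r + 1) * (z ^ r + z ^ (1 - r))‖ := by
    refine summable_of_le_theta h0 h1 h0 (M := 2) fun r => ?_
    rw [norm_mul, norm_mul, norm_neg_one_zpow, one_mul, tri_add_one, zpow_add₀ h0, mul_comm]
    exact mul_le_mul_of_nonneg_right (norm_zpow_add_zpow_le hz r) (norm_nonneg _)
  refine hasSum_of_forall_eq (hasSum_poch_mul_tsum h0 h1 hw0 hw hc) fun n => ?_
  rw [jtpSum_add_first h0 h1 hz0, anTerm, one_mul]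
  ring

theorem hasSum_anTerm_two (h0 : q ≠ 0) (h1 : ‖q‖ < 1) {z w : ℂ} (hz : ‖z‖ = 1) (hw0 : w ≠ 0)
    (hw : NotPower q w) :
    HasSum (fun n => (1 + z) * anTerm 2 z w q n)
      (pochInf w q * pochInf w⁻¹ q * ((pochInf q q)⁻¹ * (pochInf q q)⁻¹) * phiG q z w) := by
  have hz0 : z ≠ 0 := by rintro rfl; simp at hz
  have hc : Summable fun r : ℤ => ‖(-1) ^ r * q ^ tri r * (z ^ r + z ^ (1 - r))‖ := by
    refine summable_of_le_theta h0 h1 one_ne_zero (M := 2) fun r => ?_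
    rw [norm_mul, norm_mul, norm_neg_one_zpow, one_mul, one_zpow, mul_one, mul_comm]
    exact mul_le_mul_of_nonneg_right (norm_zpow_add_zpow_le hz r) (norm_nonneg _)
  refine hasSum_of_forall_eq (hasSum_poch_mul_tsum h0 h1 hw0 hw hc) fun n => ?_
  rw [jtpSum_add_second h0 h1 hz0, anTerm, two_mul, pow_add]
  ring

/-- The factor `E / (z, 1/z, w, 1/w)_∞`. -/
noncomputable def anPrefactor (z w q : ℂ) : ℂ :=
  pochInf q q / (pochInf z q * pochInf z⁻¹ q * pochInf w q * pochInf w⁻¹ q)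

/-- `F` or `G`, with the missing term of index `0` added. -/
noncomputable def fullSeries (e : ℕ) (z w q : ℂ) : ℂ := anSeries e z w q + anPrefactor z w q

theorem notPower_of_norm_eq_one (h1 : ‖q‖ < 1) {w : ℂ} (hw : ‖w‖ = 1) (hw1 : w ≠ 1) :
    NotPower q w := by
  intro r h
  rcases eq_or_ne r 0 with rfl | hr
  · rw [zpow_zero, mul_one, sub_eq_zero] at h
    exact hw1 h.symm
  · have h2 : ‖w * q ^ r‖ = 1 := by rw [← sub_eq_zero.1 h, norm_one]
    rw [norm_mul, hw, one_mul, norm_zpow] at h2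
    exact hr ((zpow_eq_one_iff_right₀ (norm_nonneg _) h1.ne).1 h2)

/-- The bilateral form sums over all n ≥ 0. The term n = 0 is 1, and after multiplication by the
prefactor it becomes `anPrefactor`. -/
theorem fullSeries_aux (h0 : q ≠ 0) (h1 : ‖q‖ < 1) {z w : ℂ} (hz : ‖z‖ = 1) (hw : ‖w‖ = 1)
    (hz1 : z ≠ 1) (hw1 : w ≠ 1) {e : ℕ} {Φ : ℂ}
    (h : HasSum (fun n => (1 + z) * anTerm e z w q n)
      (pochInf w q * pochInf w⁻¹ q * ((pochInf q q)⁻¹ * (pochInf q q)⁻¹) * Φ)) (hne : 1 + z ≠ 0) :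
    (1 + z) * ((1 - z⁻¹) * theta q z) * fullSeries e z w q = Φ := by
  have hz0 : z ≠ 0 := by rintro rfl; simp at hz
  have hE := pochInf_self_ne_zero h1
  have hz' : ‖z⁻¹‖ ≤ 1 := by simp [hz]
  have hw' : ‖w⁻¹‖ ≤ 1 := by simp [hw]
  have n1 := pochInf_ne_zero h1 hz.le hz1
  have n2 := pochInf_ne_zero h1 hz' (by simpa using hz1)
  have n3 := pochInf_ne_zero h1 hw.le hw1
  have n4 := pochInf_ne_zero h1 hw' (by simpa using hw1)
  have hs : Summable fun n => anTerm e z w q n := (summable_mul_left_iff hne).1 h.summable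
  have h2 : (1 + z) * (1 + anSum e z w q) =
      pochInf w q * pochInf w⁻¹ q * ((pochInf q q)⁻¹ * (pochInf q q)⁻¹) * Φ := by
    rw [← h.tsum_eq, tsum_mul_left, hs.tsum_eq_zero_add, anSum]
    simp [anTerm, poch_zero]
  rw [← pochInf_mul_pochInf_inv h0 h1 hz0, fullSeries, anSeries, anPrefactor]
  have h3 : (1 + z) * (1 + anSum e z w q) * (pochInf q q * pochInf q q) =
      pochInf w q * pochInf w⁻¹ q * Φ := by
    rw [h2]; field_simp
  generalize pochInf z⁻¹ q = Z' at *
  generalize pochInf w⁻¹ q = W' at *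
  field_simp
  linear_combination h3

theorem fullSeries_one (h0 : q ≠ 0) (h1 : ‖q‖ < 1) {z w : ℂ} (hz : ‖z‖ = 1) (hw : ‖w‖ = 1)
    (hz1 : z ≠ 1) (hw1 : w ≠ 1) (hne : 1 + z ≠ 0) :
    (1 + z) * ((1 - z⁻¹) * theta q z) * fullSeries 1 z w q = phiF q z w :=
  fullSeries_aux h0 h1 hz hw hz1 hw1 (hasSum_anTerm_one h0 h1 hz (by rintro rfl; simp at hw)
    (notPower_of_norm_eq_one h1 hw hw1)) hne

theorem fullSeries_two (h0 : q ≠ 0) (h1 : ‖q‖ < 1) {z w : ℂ} (hz : ‖z‖ = 1) (hw : ‖w‖ = 1)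
    (hz1 : z ≠ 1) (hw1 : w ≠ 1) (hne : 1 + z ≠ 0) :
    (1 + z) * ((1 - z⁻¹) * theta q z) * fullSeries 2 z w q = phiG q z w :=
  fullSeries_aux h0 h1 hz hw hz1 hw1 (hasSum_anTerm_two h0 h1 hz (by rintro rfl; simp at hw)
    (notPower_of_norm_eq_one h1 hw hw1)) hne

/-- This symmetry is invisible in the bilateral series, so exchanging z and w gives a second
equation for the same unknown. -/
theorem fullSeries_symm (e : ℕ) (z w q : ℂ) : fullSeries e z w q = fullSeries e w z q := by
  have h : ∀ n, anTerm e z w q n = anTerm e w z q n := fun n => by rw [anTerm, anTerm]; ring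
  simp only [fullSeries, anSeries, anPrefactor, anSum, h]
  ring

/-! ### Appell–Lerch series -/

/-- The Appell–Lerch series `∑ (-1)ⁿ q^{n(n+1)/2} xⁿ / (1 - w qⁿ)`, without its poles. -/
noncomputable def appell (q x w : ℂ) : ℂ :=
  ∑' n : ℤ, (-1) ^ n * (q ^ tri (n + 1) * x ^ n) * (1 - w * q ^ n)⁻¹

theorem summable_appell (h0 : q ≠ 0) (h1 : ‖q‖ < 1) {x : ℂ} (hx : x ≠ 0) (w : ℂ) :
    Summable fun n : ℤ => ‖(-1) ^ n * (q ^ tri (n + 1) * x ^ n) * (1 - w * q ^ n)⁻¹‖ := by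
  obtain ⟨M, hM0, hM⟩ := norm_inv_one_sub_le h0 h1 w
  refine summable_of_le_theta h0 h1 (mul_ne_zero h0 hx) (M := M) fun n => ?_
  rw [norm_mul, norm_mul, norm_neg_one_zpow, one_mul, mul_comm, tri_add_one, zpow_add₀ h0, mul_assoc,
    ← mul_zpow]
  exact mul_le_mul_of_nonneg_right (hM n) (norm_nonneg _)

theorem appell_one_inv (h0 : q ≠ 0) {w : ℂ} (hw0 : w ≠ 0) :
    appell q 1 w⁻¹ = -w * appell q 1 w := by
  rw [appell, appell, ← (Equiv.neg ℤ).tsum_eq, ← tsum_mul_left]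
  refine tsum_congr fun n => ?_
  have hn := zpow_ne_zero n h0
  have e1 : (1 - w⁻¹ * q ^ (-n))⁻¹ = -w * q ^ n * (1 - w * q ^ n)⁻¹ := by
    rw [zpow_neg, show 1 - w⁻¹ * (q ^ n)⁻¹ = -w⁻¹ * (q ^ n)⁻¹ * (1 - w * q ^ n) by
      field_simp; ring, mul_inv, mul_inv, inv_neg, inv_inv, inv_inv]
  rw [Equiv.neg_apply, e1, show -n + 1 = 1 - n by ring, tri_one_sub, tri_add_one, zpow_add₀ h0,
    one_zpow, one_zpow, zpow_neg (-1), ← inv_zpow (-1 : ℂ), inv_neg, inv_one]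
  ring

/-- At z = 1 the symbol (1)_n kills every term with n ≥ 1, so `phiF q 1 w` is an explicit product.
Partial fractions express it by the Appell series at w and 1/w, which `appell_one_inv` relates. -/
theorem appell_one (h0 : q ≠ 0) (h1 : ‖q‖ < 1) {w : ℂ} (hw0 : w ≠ 0) (hw : NotPower q w)
    (hw2 : w ^ 2 ≠ 1) : appell q 1 w * theta q w = pochInf q q ^ 3 := by
  have hw' := hw.inv h0 hw0
  have ha := (summable_appell h0 h1 one_ne_zero w).of_norm
  have hb := (summable_appell h0 h1 one_ne_zero w⁻¹).of_norm
  have hE := pochInf_self_ne_zero h1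
  have n1 : 1 + w ≠ 0 := fun h => hw2 (by linear_combination (w - 1) * h)
  have e1 : phiF q 1 w * (w - w⁻¹) = 2 * (appell q 1 w - appell q 1 w⁻¹) := by
    rw [appell, appell, ← ha.tsum_sub hb, phiF, ← tsum_mul_right, ← tsum_mul_left]
    refine tsum_congr fun n => ?_
    have a1 := hw n
    have a2 := hw' n
    rw [den, one_zpow, one_zpow]
    have e2 : q ^ n / ((1 - w * q ^ n) * (1 - w⁻¹ * q ^ n)) * (w - w⁻¹) =
        (1 - w * q ^ n)⁻¹ - (1 - w⁻¹ * q ^ n)⁻¹ := by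
      rw [inv_sub_inv a1 a2, div_mul_eq_mul_div]
      congr 1
      ring
    linear_combination 2 * ((-1) ^ n * q ^ tri (n + 1)) * e2
  have e3 : pochInf w q * pochInf w⁻¹ q * ((pochInf q q)⁻¹ * (pochInf q q)⁻¹) * phiF q 1 w = 2 := by
    refine (hasSum_anTerm_one h0 h1 norm_one hw0 hw).unique ?_
    convert hasSum_single 0 fun n hn => ?_ using 1
    · simp [anTerm, poch_zero]; norm_num
    · obtain ⟨m, rfl⟩ := Nat.exists_eq_succ_of_ne_zero hn
      simp [anTerm, poch_succ']
  have e4 := pochInf_mul_pochInf_inv h0 h1 hw0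
  rw [appell_one_inv h0 hw0] at e1
  have e5 : (1 - w⁻¹) * theta q w * phiF q 1 w = 2 * pochInf q q ^ 3 := by
    rw [← e4]
    generalize pochInf w⁻¹ q = W' at *
    field_simp at e3
    linear_combination pochInf q q * e3
  field_simp at e1 e5
  have e6 : w * (1 + w) * (appell q 1 w * theta q w - pochInf q q ^ 3) = 0 := by
    linear_combination (-theta q w / 2) * e1 + ((1 + w) / 2) * e5
  rcases mul_eq_zero.1 e6 with h | h
  · exact absurd h (mul_ne_zero hw0 n1)
  · exact sub_eq_zero.1 h

end BilateralSeries

end RankQuadruples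

namespace RankQuadruples

open Filter Topology

/-! ### Transformation of Appell–Lerch series -/

section AppellTransformation

variable {q : ℂ}

theorem tri_nonneg (n : ℤ) : 0 ≤ tri n := by
  have := two_mul_tri n
  rcases le_or_gt n 0 with h | h
  · nlinarith
  · nlinarith

/-- Multiplication of bilateral series. -/
theorem hasSum_convolution {f g : ℤ → ℂ} (hf : Summable fun n => ‖f n‖)
    (hg : Summable fun n => ‖g n‖) :
    HasSum (fun n => ∑' b, f (n - b) * g b) ((∑' n, f n) * ∑' n, g n) := by
  have h := hf.of_norm.hasSum.mul hg.of_norm.hasSum (summable_mul_of_summable_norm hf hg)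
  let e : ℤ × ℤ ≃ ℤ × ℤ := ⟨fun p => (p.1 - p.2, p.2), fun p => (p.1 + p.2, p.2),
    fun p => by simp, fun p => by simp⟩
  have h2 := e.hasSum_iff.2 h
  exact HasSum.prod_fiberwise h2 fun n =>
    (h2.summable.prod_factor n).hasSum

/-- A quadratic exponent of a product of two bilateral series. -/
noncomputable def kern (q : ℂ) (n b : ℤ) : ℂ := q ^ (tri (n - b) + tri (b + 1))

theorem summable_kern (h0 : q ≠ 0) (h1 : ‖q‖ < 1) (n : ℤ) {y : ℂ} (hy : y ≠ 0) {f : ℤ → ℂ} {M : ℝ}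
    (hf : ∀ b, ‖f b‖ ≤ M) : Summable fun b => kern q n b * y ^ b * f b := by
  refine (summable_of_le_theta h0 h1 (mul_ne_zero h0 hy) (M := M) fun b => ?_).of_norm
  have h2 : ‖q ^ tri (n - b)‖ ≤ 1 := by
    obtain ⟨k, hk⟩ := Int.eq_ofNat_of_zero_le (tri_nonneg (n - b))
    rw [hk, zpow_natCast, norm_pow]
    exact pow_le_one₀ (norm_nonneg _) h1.le
  have e1 : kern q n b * y ^ b * f b = f b * (q ^ tri (n - b)) * (q ^ tri b * (q * y) ^ b) := by
    rw [kern, zpow_add₀ h0, tri_add_one, zpow_add₀ h0, mul_zpow]; ring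
  rw [e1, norm_mul, norm_mul]
  have h3 : ‖f b‖ * ‖q ^ tri (n - b)‖ ≤ M * 1 :=
    mul_le_mul (hf b) h2 (norm_nonneg _) ((norm_nonneg _).trans (hf b))
  rw [mul_one] at h3
  exact mul_le_mul_of_nonneg_right h3 (norm_nonneg _)

/-- The coefficients of the difference of the two products in `appell_transformation`. -/
noncomputable def transCoeff (q v w : ℂ) (n : ℤ) : ℂ :=
  (∑' b, kern q n b * (v / w) ^ (n - b) * (1 - w * q ^ b)⁻¹) -
    ∑' b, kern q n b * (v / w) ^ (b + 1) * (1 - v * q ^ b)⁻¹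

theorem hasSum_transCoeff (h0 : q ≠ 0) (h1 : ‖q‖ < 1) {v w x : ℂ} (hv : v ≠ 0) (hw : w ≠ 0)
    (hx : x ≠ 0) : HasSum (fun n => (-1) ^ n * x ^ n * transCoeff q v w n)
      (theta q (v * x / w) * appell q x w - v / w * (theta q x * appell q (v * x / w) v)) := by
  have hy : v * x / w ≠ 0 := div_ne_zero (mul_ne_zero hv hx) hw
  have hvw : v / w ≠ 0 := div_ne_zero hv hw
  have hm1 : (-1 : ℂ) ≠ 0 := neg_ne_zero.2 one_ne_zero
  have e1 := hasSum_convolution (summable_theta h0 h1 hy) (summable_appell h0 h1 hx w)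
  have e2 := (hasSum_convolution (summable_theta h0 h1 hx) (summable_appell h0 h1 hy v)).mul_left
    (v / w)
  refine hasSum_of_forall_eq (e1.sub e2) fun n => ?_
  rw [transCoeff, mul_sub, ← tsum_mul_left, ← tsum_mul_left, ← tsum_mul_left]
  have hz : v * x / w = v / w * x := by ring
  congr 1
  · refine tsum_congr fun b => ?_
    rw [hz, mul_zpow, kern, zpow_add₀ h0, zpow_sub₀ hm1, zpow_sub₀ hx]
    have a1 := zpow_ne_zero b hm1
    have a2 := zpow_ne_zero b hx
    field_simp
  · refine tsum_congr fun b => ?_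
    rw [hz, mul_zpow, kern, zpow_add₀ h0, zpow_sub₀ hm1, zpow_sub₀ hx, zpow_add₀ hvw, zpow_one]
    have a1 := zpow_ne_zero b hm1
    have a2 := zpow_ne_zero b hx
    field_simp

theorem kern_succ (h0 : q ≠ 0) (n b : ℤ) : kern q (n + 1) b = kern q n b * q ^ (n - b) := by
  rw [kern, kern, ← zpow_add₀ h0, show n + 1 - b = n - b + 1 by ring, tri_add_one]
  congr 1
  ring

/-- In this combination of consecutive coefficients each summand acquires exactly its own
denominator as a factor; where the denominators do not vanish, pure theta sums remain. -/
theorem transCoeff_succ (h0 : q ≠ 0) (h1 : ‖q‖ < 1) {v w : ℂ} (hv : v ≠ 0) (hw : w ≠ 0) (n : ℤ) :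
    transCoeff q v w (n + 1) - v * q ^ n * transCoeff q v w n =
      (∑' b, kern q n b * q ^ (n - b) * (v / w) ^ (n - b + 1) *
        ((1 - w * q ^ b) * (1 - w * q ^ b)⁻¹)) -
      ∑' b, kern q n b * q ^ (n - b) * (v / w) ^ (b + 1) *
        ((1 - v * q ^ b) * (1 - v * q ^ b)⁻¹) := by
  obtain ⟨M, hM0, hM⟩ := norm_inv_one_sub_le h0 h1 w
  obtain ⟨M', hM0', hM'⟩ := norm_inv_one_sub_le h0 h1 v
  have hvw : v / w ≠ 0 := div_ne_zero hv hw
  have sA : ∀ m, Summable fun b => kern q m b * (v / w) ^ (m - b) * (1 - w * q ^ b)⁻¹ := fun m => by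
    have := (summable_kern h0 h1 m (inv_ne_zero hvw) hM).mul_left ((v / w) ^ m)
    refine this.congr fun b => ?_
    rw [zpow_sub₀ hvw, inv_zpow]
    ring
  have sB : ∀ m, Summable fun b => kern q m b * (v / w) ^ (b + 1) * (1 - v * q ^ b)⁻¹ := fun m => by
    have := (summable_kern h0 h1 m hvw hM').mul_left (v / w)
    refine this.congr fun b => ?_
    rw [zpow_add₀ hvw, zpow_one]
    ring
  have e1 : (∑' b, kern q n b * q ^ (n - b) * (v / w) ^ (n - b + 1) *
      ((1 - w * q ^ b) * (1 - w * q ^ b)⁻¹)) =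
      (∑' b, kern q (n + 1) b * (v / w) ^ (n + 1 - b) * (1 - w * q ^ b)⁻¹) -
      v * q ^ n * ∑' b, kern q n b * (v / w) ^ (n - b) * (1 - w * q ^ b)⁻¹ := by
    rw [← tsum_mul_left, ← (sA (n + 1)).tsum_sub ((sA n).mul_left _)]
    refine tsum_congr fun b => ?_
    have hb := zpow_ne_zero b h0
    rw [kern_succ h0, show n + 1 - b = n - b + 1 by ring, zpow_add₀ hvw (n - b), zpow_one,
      zpow_sub₀ h0]
    field_simp
  have e2 : (∑' b, kern q n b * q ^ (n - b) * (v / w) ^ (b + 1) *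
      ((1 - v * q ^ b) * (1 - v * q ^ b)⁻¹)) =
      (∑' b, kern q (n + 1) b * (v / w) ^ (b + 1) * (1 - v * q ^ b)⁻¹) -
      v * q ^ n * ∑' b, kern q n b * (v / w) ^ (b + 1) * (1 - v * q ^ b)⁻¹ := by
    rw [← tsum_mul_left, ← (sB (n + 1)).tsum_sub ((sB n).mul_left _)]
    refine tsum_congr fun b => ?_
    have hb := zpow_ne_zero b h0
    rw [kern_succ h0, zpow_sub₀ h0]
    field_simp
  rw [e1, e2, transCoeff, transCoeff]
  ring

/-- The exponent of q is tri (n - b + 1) + tri (b + 1), invariant under b ↦ n - b. -/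
theorem tsum_kern_symm (h0 : q ≠ 0) (n : ℤ) (y : ℂ) :
    ∑' b, kern q n b * q ^ (n - b) * y ^ (n - b + 1) =
      ∑' b, kern q n b * q ^ (n - b) * y ^ (b + 1) := by
  rw [← (Equiv.subLeft n).tsum_eq]
  refine tsum_congr fun b => ?_
  rw [Equiv.subLeft_apply, kern, kern, ← zpow_add₀ h0, ← zpow_add₀ h0, sub_sub_cancel,
    tri_add_one, tri_add_one]
  congr 2
  ring

/-- A first-order recurrence solved in both directions from n = 0. Its homogeneous solution is the
coefficient of a theta series, and the inhomogeneity δ adds a term linear in n, hence `thetaD`. -/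
theorem transCoeff_eq (h0 : q ≠ 0) {v w δ : ℂ} (hv : v ≠ 0)
    (h : ∀ n, transCoeff q v w (n + 1) - v * q ^ n * transCoeff q v w n =
      δ * (q ^ tri (n + 1) * v ^ (n + 1))) (n : ℤ) :
    transCoeff q v w n = q ^ tri n * v ^ n * (transCoeff q v w 0 + n * δ) := by
  have step : ∀ n : ℤ, q ^ tri (n + 1) * v ^ (n + 1) = v * q ^ n * (q ^ tri n * v ^ n) := by
    intro n
    rw [tri_add_one, zpow_add₀ h0, zpow_add₀ hv, zpow_one]; ring
  induction n using Int.induction_on with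
  | zero => simp [tri_zero]
  | succ n ih =>
    have h2 := h n
    have h3 := step n
    push_cast
    linear_combination h2 + v * q ^ (n : ℤ) * ih - (δ + transCoeff q v w 0 + n * δ - δ) * h3
  | pred n ih =>
    have h2 := h (-n - 1)
    have h3 := step (-n - 1)
    rw [show (-n - 1 + 1 : ℤ) = -n by ring] at h2 h3
    have hne : v * q ^ (-n - 1 : ℤ) ≠ 0 := mul_ne_zero hv (zpow_ne_zero _ h0)
    refine mul_left_cancel₀ hne ?_
    push_cast at ih ⊢
    linear_combination ih - h2 + (transCoeff q v w 0 - n * δ - δ) * h3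

theorem transformation_aux (h0 : q ≠ 0) (h1 : ‖q‖ < 1) {v w δ : ℂ} (hv : v ≠ 0) (hw : w ≠ 0)
    (h : ∀ n, transCoeff q v w (n + 1) - v * q ^ n * transCoeff q v w n =
      δ * (q ^ tri (n + 1) * v ^ (n + 1))) {x : ℂ} (hx : x ≠ 0) :
    theta q (v * x / w) * appell q x w - v / w * (theta q x * appell q (v * x / w) v) =
      transCoeff q v w 0 * theta q (v * x) + δ * thetaD q (v * x) := by
  have hvx := mul_ne_zero hv hx
  rw [← (hasSum_transCoeff h0 h1 hv hw hx).tsum_eq, theta, thetaD, ← tsum_mul_left, ← tsum_mul_left,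
    ← ((summable_theta h0 h1 hvx).of_norm.mul_left _).tsum_add
      ((summable_thetaD h0 h1 hvx).of_norm.mul_left _)]
  refine tsum_congr fun n => ?_
  rw [transCoeff_eq h0 hv h n, mul_zpow]
  ring

/-- Here δ = 0, so the difference of products is a constant multiple of `theta q (v * x)`. The
constant is read off at x = 1, where `theta_one` removes one product and `appell_one` evaluates the
other. -/
theorem appell_transformation (h0 : q ≠ 0) (h1 : ‖q‖ < 1) {v w : ℂ} (hv : v ≠ 0) (hw : w ≠ 0)
    (hv' : NotPower q v) (hw' : NotPower q w) (hw2 : w ^ 2 ≠ 1) {x : ℂ} (hx : x ≠ 0) :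
    theta q v * theta q w * (theta q (v * x / w) * appell q x w -
      v / w * (theta q x * appell q (v * x / w) v)) =
        theta q (v / w) * pochInf q q ^ 3 * theta q (v * x) := by
  have h : ∀ n, transCoeff q v w (n + 1) - v * q ^ n * transCoeff q v w n =
      0 * (q ^ tri (n + 1) * v ^ (n + 1)) := by
    intro n
    rw [transCoeff_succ h0 h1 hv hw, zero_mul, sub_eq_zero]
    simp only [mul_inv_cancel₀ (hw' _), mul_inv_cancel₀ (hv' _), mul_one]
    exact tsum_kern_symm h0 n _
  have e1 := transformation_aux h0 h1 hv hw h hx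
  have e2 := transformation_aux h0 h1 hv hw h one_ne_zero
  rw [theta_one h0] at e2
  simp only [mul_one] at e2
  rw [← appell_one h0 h1 hw hw' hw2]
  linear_combination theta q v * theta q w * e1 - theta q w * theta q (v * x) * e2

/-- For w = 1 the summand b = 0 of the Appell series is missing. Its absence makes δ = -1 and brings
in `thetaD`. -/
theorem transformation_one_aux (h0 : q ≠ 0) (h1 : ‖q‖ < 1) {v : ℂ} (hv : v ≠ 0)
    (hv' : NotPower q v) {x : ℂ} (hx : x ≠ 0) :
    theta q (v * x) * appell q x 1 - v * (theta q x * appell q (v * x) v) =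
      transCoeff q v 1 0 * theta q (v * x) - thetaD q (v * x) := by
  have h : ∀ n, transCoeff q v 1 (n + 1) - v * q ^ n * transCoeff q v 1 n =
      -1 * (q ^ tri (n + 1) * v ^ (n + 1)) := by
    intro n
    have hs : Summable fun b => kern q n b * q ^ (n - b) * v ^ (n - b + 1) := by
      have := (summable_kern h0 h1 n (y := (q * v)⁻¹) (inv_ne_zero (mul_ne_zero h0 hv))
        (f := fun _ => q ^ n * v ^ (n + 1)) fun _ => le_rfl)
      refine this.congr fun b => ?_
      rw [show n - b + 1 = n + 1 - b by ring, zpow_sub₀ h0, zpow_sub₀ hv, inv_zpow, mul_zpow,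
        mul_inv]
      ring
    -- At b = 0 the inverse of zero is 0, so the product is 0 there and 1 elsewhere.
    have hind : ∀ b : ℤ, (1 - 1 * q ^ b) * (1 - 1 * q ^ b)⁻¹ = 1 - if b = 0 then 1 else 0 := by
      intro b
      split_ifs with hb
      · simp [hb]
      · rw [sub_zero, mul_inv_cancel₀]
        rw [one_mul, sub_ne_zero]
        intro hb2
        have := congrArg norm hb2
        rw [norm_one, norm_zpow] at this
        exact hb ((zpow_eq_one_iff_right₀ (norm_nonneg _) h1.ne).1 this.symm)
    rw [transCoeff_succ h0 h1 hv one_ne_zero]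
    simp only [mul_inv_cancel₀ (hv' _), mul_one, div_one, hind]
    have h2 : Summable fun b : ℤ => kern q n b * q ^ (n - b) * v ^ (n - b + 1) *
        (1 - if b = 0 then 1 else 0) := by
      have h3 : Summable fun b : ℤ => kern q n b * q ^ (n - b) * v ^ (n - b + 1) *
          (if b = 0 then 1 else 0) := by
        refine summable_of_ne_finset_zero (s := {0}) fun b hb => ?_
        rw [if_neg (by simpa using hb), mul_zero]
      simpa only [mul_sub, mul_one] using hs.sub h3
    rw [← tsum_kern_symm h0 n v, ← h2.tsum_sub hs, tsum_eq_single 0]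
    · simp only [if_true, sub_self, mul_zero, zero_sub, sub_zero, zero_add, kern]
      rw [show tri 1 = 0 from rfl, add_zero, ← zpow_add₀ h0, tri_add_one]
      ring
    · intro b hb
      rw [if_neg hb, sub_zero, mul_one, sub_self]
  have := transformation_aux h0 h1 hv one_ne_zero h hx
  simp only [div_one] at this
  linear_combination this

theorem appell_one_one (h0 : q ≠ 0) : appell q 1 1 = 0 := by
  have := appell_one_inv (q := q) h0 (one_ne_zero (α := ℂ))
  rw [inv_one] at this
  linear_combination this / 2

/-- The unknown `transCoeff q v 1 0` is eliminated between a general x and x = 1, where both `theta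
q 1` and `appell q 1 1` vanish. -/
theorem appell_transformation_one (h0 : q ≠ 0) (h1 : ‖q‖ < 1) {v : ℂ} (hv : v ≠ 0)
    (hv' : NotPower q v) {x : ℂ} (hx : x ≠ 0) :
    theta q v * (theta q (v * x) * appell q x 1 - v * (theta q x * appell q (v * x) v)) =
      thetaD q v * theta q (v * x) - theta q v * thetaD q (v * x) := by
  have e1 := transformation_one_aux h0 h1 hv hv' hx
  have e2 := transformation_one_aux h0 h1 hv hv' one_ne_zero
  rw [theta_one h0, mul_one, appell_one_one h0] at e2
  linear_combination theta q v * e1 - theta q (v * x) * e2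

/-- Jacobi's expansion of `(q; q)_∞³`. -/
theorem thetaD_one (h0 : q ≠ 0) (h1 : ‖q‖ < 1) : thetaD q 1 = -pochInf q q ^ 3 := by
  -- Any v that is not a power of q and has v² ≠ 1 would do. With x = 1/v the argument vx is 1,
  -- where theta vanishes and only `thetaD q 1` survives.
  have hI : NotPower q Complex.I := notPower_of_norm_eq_one h1 (by simp) (by
    intro h; simpa using congrArg Complex.re h)
  have e1 := transformation_one_aux h0 h1 Complex.I_ne_zero hI (inv_ne_zero Complex.I_ne_zero)
  rw [mul_inv_cancel₀ Complex.I_ne_zero, theta_one h0, theta_inv h0 Complex.I_ne_zero] at e1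
  have e2 := appell_one h0 h1 Complex.I_ne_zero hI (by rw [Complex.I_sq]; norm_num)
  rw [← e2]
  have h3 : Complex.I * Complex.I⁻¹ = 1 := mul_inv_cancel₀ Complex.I_ne_zero
  linear_combination e1 - theta q Complex.I * appell q 1 Complex.I * h3

end AppellTransformation

end RankQuadruples

namespace RankQuadruples

open Filter Topology

/-! ### Dissection at roots of unity of odd order -/

section Dissection

variable {q : ℂ}

/-- Splitting a bilateral series into residue classes modulo `2 h + 1`. -/
theorem tsum_int_split {f : ℤ → ℂ} (hf : Summable f) (h : ℕ) :
    ∑' n, f n = ∑ j ∈ Finset.range (2 * h + 1), ∑' m : ℤ, f ((2 * h + 1) * m + (j - h)) := by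
  have : NeZero (2 * h + 1) := ⟨by omega⟩
  obtain ⟨S, hS⟩ := hf
  have h1 : HasSum (fun n : ℤ => f (n - h)) S := (Equiv.subRight (h : ℤ)).hasSum_iff.2 hS
  have h2 := (Int.divModEquiv (2 * h + 1)).symm.hasSum_iff.2 h1
  have h3 : HasSum (fun p : Fin (2 * h + 1) × ℤ => f ((2 * h + 1) * p.2 + (p.1 - h))) S := by
    refine hasSum_of_forall_eq ((Equiv.prodComm (Fin (2 * h + 1)) ℤ).hasSum_iff.2 h2) fun p => ?_
    simp only [Function.comp_apply, Equiv.prodComm_apply, Int.divModEquiv_symm_apply, Prod.fst_swap,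
      Prod.snd_swap]
    congr 1
    push_cast
    ring
  have h4 : HasSum (fun j : Fin (2 * h + 1) => ∑' m : ℤ, f ((2 * h + 1) * m + (j - h))) S :=
    HasSum.prod_fiberwise h3 fun j => (h3.summable.prod_factor j).hasSum
  rw [hS.tsum_eq, h4.unique (hasSum_fintype _),
    Fin.sum_univ_eq_sum_range (fun j => ∑' m : ℤ, f ((2 * h + 1) * m + (j - h)))]

theorem norm_pow_lt_one (h1 : ‖q‖ < 1) {n : ℕ} (hn : n ≠ 0) : ‖q ^ n‖ < 1 := by
  rw [norm_pow]
  exact pow_lt_one₀ (norm_nonneg _) h1 hn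

theorem one_sub_zpow_ne_zero (h1 : ‖q‖ < 1) {n : ℤ} (hn : n ≠ 0) : 1 - q ^ n ≠ 0 := by
  intro h
  have := congrArg norm (sub_eq_zero.1 h)
  rw [norm_one, norm_zpow] at this
  exact hn ((zpow_eq_one_iff_right₀ (norm_nonneg _) h1.ne).1 this.symm)

/-- The series `∑ (-1)ⁿ q^{n(n+1)/2 + kn} / (1 - q^{(2h+1)n})` over the `n ≡ s` modulo `2 h + 1`. -/
noncomputable def lser (h : ℕ) (k s : ℤ) (q : ℂ) : ℂ :=
  (-1) ^ s * q ^ (tri (s + 1) + k * s) *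
    appell (q ^ ((2 * h + 1) ^ 2)) ((q ^ (2 * h + 1)) ^ (s - h + k)) ((q ^ (2 * h + 1)) ^ s)

/-- The terms of `lser`, without restriction to a residue class. -/
noncomputable def lterm (h : ℕ) (k : ℤ) (q : ℂ) (n : ℤ) : ℂ :=
  (-1) ^ n * q ^ (tri (n + 1) + k * n) * (1 - (q ^ (2 * h + 1)) ^ n)⁻¹

theorem summable_lterm (h0 : q ≠ 0) (h1 : ‖q‖ < 1) (h : ℕ) (k : ℤ) :
    Summable fun n => ‖lterm h k q n‖ := by
  obtain ⟨M, hM0, hM⟩ := norm_inv_one_sub_le (pow_ne_zero (2 * h + 1) h0)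
    (norm_pow_lt_one h1 (by omega : 2 * h + 1 ≠ 0)) 1
  refine summable_of_le_theta h0 h1 (zpow_ne_zero (k + 1) h0) (M := M) fun n => ?_
  have := hM n
  rw [one_mul] at this
  rw [lterm, norm_mul, norm_mul, norm_neg_one_zpow, one_mul, mul_comm, ← zpow_mul, ← zpow_add₀ h0,
    tri_add_one, show tri n + n + k * n = tri n + (k + 1) * n by ring]
  exact mul_le_mul_of_nonneg_right this (norm_nonneg _)

theorem tri_mul_add (h : ℕ) (m s : ℤ) : tri ((2 * h + 1) * m + s + 1) =
    (2 * h + 1) ^ 2 * tri (m + 1) + (2 * h + 1) * m * (s - h) + tri (s + 1) := by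
  have e1 := two_mul_tri ((2 * h + 1) * m + s + 1)
  have e2 := two_mul_tri (m + 1)
  have e3 := two_mul_tri (s + 1)
  have : 2 * tri ((2 * h + 1) * m + s + 1) = 2 * ((2 * h + 1) ^ 2 * tri (m + 1) +
      (2 * h + 1) * m * (s - h) + tri (s + 1)) := by
    linear_combination e1 - (2 * h + 1) ^ 2 * e2 - e3
  linarith

theorem neg_one_zpow_odd_mul (h : ℕ) (m : ℤ) : (-1 : ℂ) ^ ((2 * h + 1) * m : ℤ) = (-1) ^ m := by
  have : (-1 : ℂ) ^ (2 * h + 1 : ℤ) = -1 := Odd.neg_one_zpow ⟨h, rfl⟩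
  rw [zpow_mul, this]

theorem tsum_lterm_class (h0 : q ≠ 0) (h : ℕ) (k s : ℤ) :
    ∑' m : ℤ, lterm h k q ((2 * h + 1) * m + s) = lser h k s q := by
  rw [lser, appell, ← tsum_mul_left]
  refine tsum_congr fun m => ?_
  have hm1 : (-1 : ℂ) ≠ 0 := neg_ne_zero.2 one_ne_zero
  have hQ : q ^ (2 * h + 1) ≠ 0 := pow_ne_zero _ h0
  have e0 : q ^ ((2 * h + 1) ^ 2) = (q ^ (2 * h + 1)) ^ (2 * h + 1) := by rw [sq, pow_mul]
  have e1 : (q ^ (2 * h + 1)) ^ ((2 * h + 1) * m + s) =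
      (q ^ (2 * h + 1)) ^ s * (q ^ ((2 * h + 1) ^ 2)) ^ m := by
    rw [zpow_add₀ hQ, mul_comm, zpow_mul, e0]
    norm_cast
  have e2 : q ^ (tri ((2 * h + 1) * m + s + 1) + k * ((2 * h + 1) * m + s)) =
      q ^ (tri (s + 1) + k * s) * ((q ^ ((2 * h + 1) ^ 2)) ^ tri (m + 1) *
        ((q ^ (2 * h + 1)) ^ (s - h + k)) ^ m) := by
    rw [← zpow_natCast, ← zpow_natCast, ← zpow_mul, ← zpow_mul, ← zpow_mul, ← zpow_add₀ h0,
      ← zpow_add₀ h0, tri_mul_add]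
    congr 1
    push_cast
    ring
  rw [lterm, e1, e2, zpow_add₀ hm1, neg_one_zpow_odd_mul]
  ring

theorem zpow_odd_mul_add {z : ℂ} {h : ℕ} (hz0 : z ≠ 0) (hz : z ^ (2 * h + 1) = 1) (m s : ℤ) :
    z ^ ((2 * h + 1) * m + s) = z ^ s := by
  have : z ^ (2 * h + 1 : ℤ) = 1 := by exact_mod_cast hz
  rw [zpow_add₀ hz0, zpow_mul, this, one_zpow, one_mul]

/-- A bilateral series with denominators `(1 - w q^r)(1 - q^r / w)`, as a combination of `lser`. -/
theorem dissect_aux (h0 : q ≠ 0) (h1 : ‖q‖ < 1) {h : ℕ} {z w : ℂ} (hz0 : z ≠ 0)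
    (hz : z ^ (2 * h + 1) = 1) (N : ℕ → ℂ)
    (hN : ∀ x : ℂ, (1 - w * x) * (1 - w⁻¹ * x) * ∑ m ∈ Finset.range (2 * h), N m * x ^ m =
      1 - x ^ (2 * h + 1)) (hw : NotPower q w) (hw' : NotPower q w⁻¹) (k : ℤ) :
    ∑' r : ℤ, (-1) ^ r * q ^ (tri (r + 1) + (k - 1) * r) * (z ^ r + z ^ (1 - r)) *
        (q ^ r / den q w r) =
      (1 + z) / ((1 - w) * (1 - w⁻¹)) + ∑ j ∈ Finset.range (2 * h + 1),
        ∑ m ∈ Finset.range (2 * h), N m * (z ^ (j - h : ℤ) + z ^ (1 - (j - h) : ℤ)) *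
          lser h (m + k) (j - h) q := by
  have hQ : ‖q ^ (2 * h + 1)‖ < 1 := norm_pow_lt_one h1 (by omega)
  have hs : ∀ m : ℕ, Summable fun r : ℤ => N m * (z ^ r + z ^ (1 - r)) * lterm h (m + k) q r := by
    intro m
    have hzn : ‖z‖ = 1 := Complex.norm_eq_one_of_pow_eq_one hz (by omega)
    refine Summable.of_norm_bounded
      ((summable_lterm h0 h1 h (m + k)).mul_left (‖N m‖ * 2)) fun r => ?_
    rw [norm_mul, norm_mul]
    gcongr
    exact norm_zpow_add_zpow_le hzn r
  -- At r = 0 the denominator of `lterm` is zero and `lterm` vanishes, so that summand is split off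
  -- as a constant. Elsewhere `N` replaces the two linear denominators by 1 - q^{(2h+1)r}.
  have e1 : ∀ r : ℤ, (-1) ^ r * q ^ (tri (r + 1) + (k - 1) * r) * (z ^ r + z ^ (1 - r)) *
        (q ^ r / den q w r) = (if r = 0 then (1 + z) / ((1 - w) * (1 - w⁻¹)) else 0) +
      ∑ m ∈ Finset.range (2 * h), N m * (z ^ r + z ^ (1 - r)) * lterm h (m + k) q r := by
    intro r
    split_ifs with hr
    · subst hr
      simp [lterm, den, tri, div_eq_mul_inv, mul_comm]
    · have hx := hN (q ^ r)
      have hd : den q w r ≠ 0 := mul_ne_zero (hw r) (hw' r)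
      have hne := one_sub_zpow_ne_zero hQ hr
      have e3 : (q ^ r) ^ (2 * h + 1) = (q ^ (2 * h + 1)) ^ r := by
        rw [← zpow_natCast, ← zpow_natCast, ← zpow_mul, ← zpow_mul, mul_comm]
      have e2 : (1 : ℂ) / den q w r = (∑ m ∈ Finset.range (2 * h), N m * (q ^ r) ^ m) *
          (1 - (q ^ (2 * h + 1)) ^ r)⁻¹ := by
        rw [div_eq_iff hd, ← div_eq_mul_inv, div_mul_eq_mul_div, eq_div_iff hne, one_mul, ← e3, ← hx,
          den]
        ring
      rw [zero_add, div_eq_mul_one_div, e2, Finset.sum_mul, Finset.mul_sum, Finset.mul_sum]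
      refine Finset.sum_congr rfl fun m _ => ?_
      have e4 : q ^ (tri (r + 1) + (m + k) * r) =
          q ^ (tri (r + 1) + (k - 1) * r) * q ^ r * (q ^ r) ^ m := by
        rw [← zpow_natCast, ← zpow_mul, ← zpow_add₀ h0, ← zpow_add₀ h0]
        congr 1
        ring
      rw [lterm, e4]
      ring
  rw [tsum_congr e1, Summable.tsum_add (summable_of_ne_finset_zero (s := {0}) fun b hb =>
      if_neg (by simpa using hb)) (summable_sum fun m _ => hs m), tsum_ite_eq,
    Summable.tsum_finsetSum fun m _ => hs m, Finset.sum_comm]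
  congr 1
  refine Finset.sum_congr rfl fun m _ => ?_
  rw [tsum_int_split (hs m) h]
  refine Finset.sum_congr rfl fun j _ => ?_
  rw [← tsum_lterm_class h0, ← tsum_mul_left]
  refine tsum_congr fun n => ?_
  rw [zpow_odd_mul_add hz0 hz,
    show 1 - ((2 * h + 1) * n + (j - h)) = (2 * h + 1) * (-n) + (1 - (j - h) : ℤ) by ring,
    zpow_odd_mul_add hz0 hz]

theorem phiF_dissect (h0 : q ≠ 0) (h1 : ‖q‖ < 1) {h : ℕ} {z w : ℂ} (hz0 : z ≠ 0)
    (hz : z ^ (2 * h + 1) = 1) (N : ℕ → ℂ)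
    (hN : ∀ x : ℂ, (1 - w * x) * (1 - w⁻¹ * x) * ∑ m ∈ Finset.range (2 * h), N m * x ^ m =
      1 - x ^ (2 * h + 1)) (hw : NotPower q w) (hw' : NotPower q w⁻¹) :
    phiF q z w = (1 + z) / ((1 - w) * (1 - w⁻¹)) + ∑ j ∈ Finset.range (2 * h + 1),
        ∑ m ∈ Finset.range (2 * h), N m * (z ^ (j - h : ℤ) + z ^ (1 - (j - h) : ℤ)) *
          lser h (m + 1) (j - h) q := by
  rw [← dissect_aux h0 h1 hz0 hz N hN hw hw', phiF]
  simp

theorem phiG_dissect (h0 : q ≠ 0) (h1 : ‖q‖ < 1) {h : ℕ} {z w : ℂ} (hz0 : z ≠ 0)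
    (hz : z ^ (2 * h + 1) = 1) (N : ℕ → ℂ)
    (hN : ∀ x : ℂ, (1 - w * x) * (1 - w⁻¹ * x) * ∑ m ∈ Finset.range (2 * h), N m * x ^ m =
      1 - x ^ (2 * h + 1)) (hw : NotPower q w) (hw' : NotPower q w⁻¹) :
    phiG q z w = (1 + z) / ((1 - w) * (1 - w⁻¹)) + ∑ j ∈ Finset.range (2 * h + 1),
        ∑ m ∈ Finset.range (2 * h), N m * (z ^ (j - h : ℤ) + z ^ (1 - (j - h) : ℤ)) *
          lser h m (j - h) q := by
  have := dissect_aux h0 h1 hz0 hz N hN hw hw' 0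
  simp only [add_zero] at this
  rw [← this, phiG]
  refine tsum_congr fun r => ?_
  rw [show tri (r + 1) + (0 - 1) * r = tri r by rw [tri_add_one]; ring]

theorem zpow_tri_mul_add (h0 : q ≠ 0) (h j : ℕ) (m : ℤ) :
    q ^ tri ((2 * h + 1) * m + (j - h)) =
      q ^ tri (j - h) * ((q ^ ((2 * h + 1) ^ 2)) ^ tri m * ((q ^ (2 * h + 1)) ^ j) ^ m) := by
  rw [← zpow_natCast, ← zpow_natCast, ← zpow_natCast, ← zpow_mul, ← zpow_mul, ← zpow_mul,
    ← zpow_add₀ h0, ← zpow_add₀ h0]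
  congr 1
  have e1 := two_mul_tri ((2 * h + 1) * m + (j - h))
  have e2 := two_mul_tri m
  have e3 := two_mul_tri (j - h)
  push_cast
  have : 2 * tri ((2 * h + 1) * m + (j - h)) = 2 * (tri (j - h) + ((2 * h + 1) ^ 2 * tri m +
      (2 * h + 1) * j * m)) := by
    linear_combination e1 - (2 * h + 1) ^ 2 * e2 - e3
  linarith

theorem theta_dissect (h0 : q ≠ 0) (h1 : ‖q‖ < 1) {h : ℕ} {z : ℂ} (hz0 : z ≠ 0)
    (hz : z ^ (2 * h + 1) = 1) :
    theta q z = ∑ j ∈ Finset.range (2 * h + 1), (-1) ^ (j - h : ℤ) * q ^ tri (j - h) *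
      z ^ (j - h : ℤ) * theta (q ^ ((2 * h + 1) ^ 2)) ((q ^ (2 * h + 1)) ^ j) := by
  rw [theta, tsum_int_split (summable_theta h0 h1 hz0).of_norm h]
  refine Finset.sum_congr rfl fun j _ => ?_
  rw [theta, ← tsum_mul_left]
  refine tsum_congr fun m => ?_
  have hm1 : (-1 : ℂ) ≠ 0 := neg_ne_zero.2 one_ne_zero
  rw [zpow_odd_mul_add hz0 hz, zpow_tri_mul_add h0, zpow_add₀ hm1, neg_one_zpow_odd_mul]
  ring

theorem appell_inv (h0 : q ≠ 0) {w : ℂ} (hw0 : w ≠ 0) (x : ℂ) :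
    appell q x⁻¹ w⁻¹ = -w * appell q x w := by
  rw [appell, appell, ← (Equiv.neg ℤ).tsum_eq, ← tsum_mul_left]
  refine tsum_congr fun n => ?_
  have hn := zpow_ne_zero n h0
  have e1 : (1 - w⁻¹ * q ^ (-n))⁻¹ = -w * q ^ n * (1 - w * q ^ n)⁻¹ := by
    rw [zpow_neg, show 1 - w⁻¹ * (q ^ n)⁻¹ = -w⁻¹ * (q ^ n)⁻¹ * (1 - w * q ^ n) by
      field_simp; ring, mul_inv, mul_inv, inv_neg, inv_inv, inv_inv]
  rw [Equiv.neg_apply, e1, show -n + 1 = 1 - n by ring, tri_one_sub, tri_add_one, zpow_add₀ h0,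
    inv_zpow, zpow_neg x, inv_inv, zpow_neg (-1), ← inv_zpow (-1 : ℂ), inv_neg, inv_one]
  ring

/-- The reflection n ↦ -n of the summation index; it identifies many of the Appell series that occur
in one class. -/
theorem lser_neg (h0 : q ≠ 0) (h : ℕ) (k s : ℤ) : lser h k (-s) q = -lser h (2 * h - k) s q := by
  have hQ : q ^ (2 * h + 1) ≠ 0 := pow_ne_zero _ h0
  rw [lser, lser, zpow_neg (_ ^ _) s, show -s - h + k = -(s - h + (2 * h - k)) by ring,
    zpow_neg (_ ^ _) (s - h + _), appell_inv (pow_ne_zero _ h0) (zpow_ne_zero _ hQ), zpow_neg (-1), ← inv_zpow (-1 : ℂ), inv_neg,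
    inv_one]
  have : q ^ (tri (-s + 1) + k * -s) * (q ^ (2 * h + 1)) ^ s =
      q ^ (tri (s + 1) + (2 * h - k) * s) := by
    rw [← zpow_natCast, ← zpow_mul, ← zpow_add₀ h0, show -s + 1 = 1 - s by ring, tri_one_sub,
      tri_add_one]
    congr 1
    push_cast
    ring
  rw [← this]
  ring

/-! ### Projection onto residue classes of exponents -/

/-- `l` times the part of `f` that comes from the exponents congruent to `a` modulo `l`. -/
noncomputable def proj (ζ : ℂ) (l : ℕ) (a : ℤ) (f : ℂ → ℂ) (q : ℂ) : ℂ :=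
  ∑ j ∈ Finset.range l, ζ ^ (-(a * j)) * f (ζ ^ j * q)

/-- The function `f` only has exponents congruent to `e`. -/
def Homog (ζ : ℂ) (e : ℤ) (f : ℂ → ℂ) : Prop := ∀ q : ℂ, q ≠ 0 → ∀ j : ℕ, f (ζ ^ j * q) = ζ ^ (e * j) * f q

theorem proj_add (ζ : ℂ) (l : ℕ) (a : ℤ) (f g : ℂ → ℂ) (q : ℂ) :
    proj ζ l a (fun q => f q + g q) q = proj ζ l a f q + proj ζ l a g q := by
  simp only [proj, mul_add, Finset.sum_add_distrib]

theorem proj_sub (ζ : ℂ) (l : ℕ) (a : ℤ) (f g : ℂ → ℂ) (q : ℂ) :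
    proj ζ l a (fun q => f q - g q) q = proj ζ l a f q - proj ζ l a g q := by
  simp only [proj, mul_sub, Finset.sum_sub_distrib]

theorem proj_const_mul (ζ : ℂ) (l : ℕ) (a : ℤ) (c : ℂ) (f : ℂ → ℂ) (q : ℂ) :
    proj ζ l a (fun q => c * f q) q = c * proj ζ l a f q := by
  simp only [proj, Finset.mul_sum, mul_left_comm]

theorem proj_sum (ζ : ℂ) (l : ℕ) (a : ℤ) {ι : Type*} (s : Finset ι) (f : ι → ℂ → ℂ) (q : ℂ) :
    proj ζ l a (fun q => ∑ i ∈ s, f i q) q = ∑ i ∈ s, proj ζ l a (f i) q := by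
  simp only [proj, Finset.mul_sum]
  rw [Finset.sum_comm]

theorem proj_congr {ζ : ℂ} (hζ : ‖ζ‖ = 1) (l : ℕ) (a : ℤ) {f g : ℂ → ℂ} {r : ℝ}
    (hfg : ∀ q : ℂ, q ≠ 0 → ‖q‖ < r → f q = g q) (h0 : q ≠ 0) (h1 : ‖q‖ < r) :
    proj ζ l a f q = proj ζ l a g q := by
  have hζ0 : ζ ≠ 0 := by rintro rfl; simp at hζ
  refine Finset.sum_congr rfl fun j _ => ?_
  rw [hfg _ (mul_ne_zero (pow_ne_zero j hζ0) h0) (by rw [norm_mul, norm_pow, hζ]; simpa using h1)]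

theorem proj_homog_mul {ζ : ℂ} (hζ0 : ζ ≠ 0) (l : ℕ) (a : ℤ) {e : ℤ} {g : ℂ → ℂ}
    (hg : Homog ζ e g) (f : ℂ → ℂ) (h0 : q ≠ 0) :
    proj ζ l a (fun q => g q * f q) q = g q * proj ζ l (a - e) f q := by
  rw [proj, proj, Finset.mul_sum]
  refine Finset.sum_congr rfl fun j _ => ?_
  rw [hg q h0, show -((a - e) * j) = -(a * j) + e * j by ring, zpow_add₀ hζ0]
  ring

theorem proj_homog {ζ : ℂ} {l : ℕ} (hl : l ≠ 0) (hζ : IsPrimitiveRoot ζ l) (a : ℤ) {e : ℤ}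
    {g : ℂ → ℂ} (hg : Homog ζ e g) (h0 : q ≠ 0) :
    proj ζ l a g q = if (l : ℤ) ∣ e - a then l * g q else 0 := by
  have hζ0 := hζ.ne_zero hl
  have h2 : proj ζ l a g q = (∑ j ∈ Finset.range l, (ζ ^ (e - a)) ^ j) * g q := by
    rw [proj, Finset.sum_mul]
    refine Finset.sum_congr rfl fun j _ => ?_
    rw [hg q h0, ← zpow_natCast, ← zpow_mul, ← mul_assoc, ← zpow_add₀ hζ0]
    congr 2
    ring
  rw [h2]
  split_ifs with h
  · rw [(hζ.zpow_eq_one_iff_dvd _).2 h]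
    simp
  · have h3 : ζ ^ (e - a) ≠ 1 := fun h3 => h ((hζ.zpow_eq_one_iff_dvd _).1 h3)
    have h4 : (ζ ^ (e - a)) ^ l = 1 := by
      rw [← zpow_natCast, ← zpow_mul, mul_comm, zpow_mul, zpow_natCast, hζ.pow_eq_one, one_zpow]
    rw [geom_sum_eq h3, h4, sub_self, zero_div, zero_mul]

/-- Apart from the initial power of q, `lser` depends on q^{2h+1} alone, which does not change when
q is multiplied by a power of ζ. -/
theorem homog_lser {ζ : ℂ} {h : ℕ} (hζ : ζ ^ (2 * h + 1) = 1) (k s : ℤ) :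
    Homog ζ (tri (s + 1) + k * s) (lser h k s) := by
  intro q _ j
  have e1 : (ζ ^ j * q) ^ (2 * h + 1) = q ^ (2 * h + 1) := by
    rw [mul_pow, ← pow_mul, mul_comm j, pow_mul, hζ, one_pow, one_mul]
  have e2 : (ζ ^ j * q) ^ ((2 * h + 1) ^ 2) = q ^ ((2 * h + 1) ^ 2) := by
    rw [sq, pow_mul, e1, ← pow_mul]
  rw [lser, lser, e1, e2, mul_zpow, ← zpow_natCast, ← zpow_mul, mul_comm (j : ℤ)]
  ring

end Dissection

end RankQuadruples

namespace RankQuadruples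

open Filter Topology

/-! ### Products over roots of unity and projected bilateral series -/

section Products

variable {q : ℂ}

theorem prod_one_sub_pow_mul {ζ : ℂ} {l : ℕ} (hl : 0 < l) (hζ : IsPrimitiveRoot ζ l) (y : ℂ) :
    ∏ i ∈ Finset.range l, (1 - ζ ^ i * y) = 1 - y ^ l := by
  classical
  have h := hζ.pow_sub_pow_eq_prod_sub_mul 1 y hl
  rw [one_pow] at h
  rw [h, Polynomial.nthRootsFinset_def]
  have h2 : Polynomial.nthRoots l (1 : ℂ) = (Multiset.range l).map (fun i => ζ ^ i) := by
    rw [hζ.nthRoots_eq (one_pow l)]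
    simp
  symm
  rw [Finset.prod_eq_multiset_prod, Multiset.toFinset_val,
    Multiset.dedup_eq_self.2 hζ.nthRoots_one_nodup, h2, Multiset.map_map]
  rfl

theorem prod_pochInf_pow_mul {ζ : ℂ} {l : ℕ} (hl : 0 < l) (hζ : IsPrimitiveRoot ζ l) (h1 : ‖q‖ < 1) :
    ∏ i ∈ Finset.range l, pochInf (ζ ^ i * q) q = pochInf (q ^ l) (q ^ l) := by
  refine tendsto_nhds_unique (tendsto_finsetProd (Finset.range l) fun i _ => tendsto_poch (ζ ^ i * q) h1) ?_
  refine (tendsto_poch (q ^ l) (norm_pow_lt_one h1 hl.ne')).congr fun n => ?_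
  simp only [poch]
  rw [Finset.prod_comm]
  refine Finset.prod_congr rfl fun j _ => ?_
  simp only [mul_assoc]
  rw [prod_one_sub_pow_mul hl hζ, mul_pow, ← pow_mul, ← pow_mul, mul_comm l]

theorem pochInf_self_split {l : ℕ} (hl : 0 < l) (h1 : ‖q‖ < 1) :
    pochInf q q = ∏ s ∈ Finset.range l, pochInf (q ^ (s + 1)) (q ^ l) := by
  have ht : Tendsto (fun n => poch q q (l * n)) atTop (𝓝 (pochInf q q)) :=
    (tendsto_poch q h1).comp (tendsto_id.const_mul_atTop' hl)
  refine tendsto_nhds_unique ht ?_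
  refine (tendsto_finsetProd (Finset.range l) fun s _ =>
    tendsto_poch (q ^ (s + 1)) (norm_pow_lt_one h1 hl.ne')).congr fun n => ?_
  induction n with
  | zero => simp [poch]
  | succ n ih =>
    simp only [poch_succ, Finset.prod_mul_distrib] at ih ⊢
    rw [ih, mul_add, mul_one, poch_add]
    congr 1
    refine Finset.prod_congr rfl fun s _ => ?_
    rw [← pow_mul]
    ring

/-- The theta function `(1 - 1/z) θ(z)`, symmetric under `z ↦ 1/z`. -/
noncomputable def thetaR (q z : ℂ) : ℂ := (1 - z⁻¹) * theta q z

theorem thetaR_eq (h0 : q ≠ 0) (h1 : ‖q‖ < 1) {z : ℂ} (hz : z ≠ 0) :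
    thetaR q z = pochInf q q * (pochInf z q * pochInf z⁻¹ q) :=
  (pochInf_mul_pochInf_inv h0 h1 hz).symm

theorem thetaR_inv (h0 : q ≠ 0) {z : ℂ} (hz : z ≠ 0) : thetaR q z⁻¹ = thetaR q z := by
  rw [thetaR, thetaR, theta_inv h0 hz, inv_inv]
  field_simp
  ring

theorem thetaR_mul_anPrefactor (h0 : q ≠ 0) (h1 : ‖q‖ < 1) {z w : ℂ} (hz : ‖z‖ = 1) (hw : ‖w‖ = 1)
    (hz1 : z ≠ 1) (hw1 : w ≠ 1) :
    thetaR q z * thetaR q w * anPrefactor z w q = pochInf q q ^ 3 := by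
  have hz0 : z ≠ 0 := by rintro rfl; simp at hz
  have hw0 : w ≠ 0 := by rintro rfl; simp at hw
  have n1 := pochInf_ne_zero h1 hz.le hz1
  have n2 := pochInf_ne_zero (a := z⁻¹) h1 (by simp [hz]) (by simpa using hz1)
  have n3 := pochInf_ne_zero h1 hw.le hw1
  have n4 := pochInf_ne_zero (a := w⁻¹) h1 (by simp [hw]) (by simpa using hw1)
  rw [thetaR_eq h0 h1 hz0, thetaR_eq h0 h1 hw0, anPrefactor]
  generalize pochInf z⁻¹ q = Z' at *
  generalize pochInf w⁻¹ q = W' at *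
  field_simp

/-- Each `thetaR` contains the Pochhammer symbols at ζ^i and ζ^{-i}. Their leading factors 1 - ζ^i
multiply to 2h + 1, and the rest is evaluated by `prod_pochInf_pow_mul`. -/
theorem pochInf_self_mul_prod_thetaR {ζ : ℂ} {h : ℕ} (hζ : IsPrimitiveRoot ζ (2 * h + 1)) (h0 : q ≠ 0)
    (h1 : ‖q‖ < 1) : pochInf q q * ∏ i ∈ Finset.range h, thetaR q (ζ ^ (i + 1)) =
      (2 * h + 1) * pochInf q q ^ h * pochInf (q ^ (2 * h + 1)) (q ^ (2 * h + 1)) := by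
  have hζ0 := hζ.ne_zero (by omega)
  have e1 : ∏ i ∈ Finset.range h, thetaR q (ζ ^ (i + 1)) =
      pochInf q q ^ h * ∏ i ∈ Finset.range (2 * h), pochInf (ζ ^ (i + 1)) q := by
    rw [two_mul, Finset.prod_range_add, ← Finset.prod_range_reflect (fun x => pochInf (ζ ^ (h + x + 1)) q),
      ← Finset.prod_mul_distrib, Finset.prod_congr rfl fun i _ => thetaR_eq h0 h1 (pow_ne_zero _ hζ0),
      Finset.prod_mul_distrib, Finset.prod_const, Finset.card_range]
    congr 1
    refine Finset.prod_congr rfl fun i hi => ?_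
    rw [Finset.mem_range] at hi
    congr 2
    refine inv_eq_of_mul_eq_one_right ?_
    rw [← pow_add,
      show i + 1 + (h + (h - 1 - i) + 1) = 2 * h + 1 by omega, hζ.pow_eq_one]
  have e2 : ∏ i ∈ Finset.range (2 * h), pochInf (ζ ^ (i + 1)) q =
      (2 * h + 1) * ∏ i ∈ Finset.range (2 * h), pochInf (ζ ^ (i + 1) * q) q := by
    have := hζ.prod_one_sub_pow_eq_order
    push_cast at this
    rw [← this, ← Finset.prod_mul_distrib]
    exact Finset.prod_congr rfl fun i _ => pochInf_succ _ h1
  have e3 := prod_pochInf_pow_mul (by omega) hζ h1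
  rw [Finset.prod_range_succ', pow_zero, one_mul] at e3
  rw [e1, e2, ← e3]
  ring

theorem notPower_zpow (h0 : q ≠ 0) (h1 : ‖q‖ < 1) {l : ℕ} {s : ℤ} (hs : ¬(l : ℤ) ∣ s) :
    NotPower (q ^ l) (q ^ s) := by
  intro r
  rw [← zpow_natCast, ← zpow_mul, ← zpow_add₀ h0]
  exact one_sub_zpow_ne_zero h1 fun h => hs ⟨-r, by linear_combination h⟩

theorem thetaD_one_dissect (h0 : q ≠ 0) (h1 : ‖q‖ < 1) (h : ℕ) :
    thetaD q 1 = ∑ j ∈ Finset.range (2 * h + 1), (-1) ^ (j - h : ℤ) * q ^ tri (j - h) *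
      ((2 * h + 1) * thetaD (q ^ ((2 * h + 1) ^ 2)) ((q ^ (2 * h + 1)) ^ j) +
        (j - h) * theta (q ^ ((2 * h + 1) ^ 2)) ((q ^ (2 * h + 1)) ^ j)) := by
  have hP : q ^ ((2 * h + 1) ^ 2) ≠ 0 := pow_ne_zero _ h0
  have hP1 : ‖q ^ ((2 * h + 1) ^ 2)‖ < 1 := norm_pow_lt_one h1 (by positivity)
  rw [thetaD, tsum_int_split (summable_thetaD h0 h1 one_ne_zero).of_norm h]
  refine Finset.sum_congr rfl fun j _ => ?_
  have hQ : (q ^ (2 * h + 1)) ^ j ≠ 0 := pow_ne_zero _ (pow_ne_zero _ h0)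
  rw [theta, thetaD, ← tsum_mul_left, ← tsum_mul_left (a := ((j : ℂ) - h)),
    ← ((summable_thetaD hP hP1 hQ).of_norm.mul_left _).tsum_add
      ((summable_theta hP hP1 hQ).of_norm.mul_left _), ← tsum_mul_left]
  refine tsum_congr fun m => ?_
  rw [zpow_tri_mul_add h0, zpow_add₀ (neg_ne_zero.2 one_ne_zero), neg_one_zpow_odd_mul, one_zpow]
  push_cast
  ring

theorem proj_phiF {ζ : ℂ} {h : ℕ} (hζ : IsPrimitiveRoot ζ (2 * h + 1)) {z w : ℂ} (hz : z ^ (2 * h + 1) = 1)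
    (hw : w ^ (2 * h + 1) = 1) (hw1 : w ≠ 1) (N : ℕ → ℂ)
    (hN : ∀ x : ℂ, (1 - w * x) * (1 - w⁻¹ * x) * ∑ m ∈ Finset.range (2 * h), N m * x ^ m =
      1 - x ^ (2 * h + 1)) (a : ℤ) (h0 : q ≠ 0) (h1 : ‖q‖ < 1) :
    proj ζ (2 * h + 1) a (fun q => phiF q z w) q =
      (if (2 * h + 1 : ℤ) ∣ a then (2 * h + 1) * ((1 + z) / ((1 - w) * (1 - w⁻¹))) else 0) +
      ∑ j ∈ Finset.range (2 * h + 1), ∑ m ∈ Finset.range (2 * h),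
        N m * (z ^ (j - h : ℤ) + z ^ (1 - (j - h) : ℤ)) *
          (if (2 * h + 1 : ℤ) ∣ tri (j - h + 1) + (m + 1) * (j - h) - a then
            (2 * h + 1) * lser h (m + 1) (j - h) q else 0) := by
  have hl : 2 * h + 1 ≠ 0 := by omega
  have hwn : ‖w‖ = 1 := Complex.norm_eq_one_of_pow_eq_one hw hl
  have hz0 : z ≠ 0 := by rintro rfl; simp at hz
  rw [proj_congr (hζ.norm'_eq_one hl) _ _ (fun q h0 h1 => phiF_dissect h0 h1 hz0 hz N hN
    (notPower_of_norm_eq_one h1 hwn hw1)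
    (notPower_of_norm_eq_one h1 (by simp [hwn]) (by simpa using hw1))) h0 h1, proj_add, proj_sum]
  congr 1
  · rw [proj_homog (e := 0) hl hζ _ (by intro q _ j; simp) h0]
    simp only [zero_sub, dvd_neg]
    push_cast
    rfl
  · refine Finset.sum_congr rfl fun j _ => ?_
    rw [proj_sum]
    refine Finset.sum_congr rfl fun m _ => ?_
    rw [proj_const_mul, proj_homog hl hζ _ (homog_lser hζ.pow_eq_one _ _) h0]
    push_cast
    rfl

theorem proj_phiG {ζ : ℂ} {h : ℕ} (hζ : IsPrimitiveRoot ζ (2 * h + 1)) {z w : ℂ} (hz : z ^ (2 * h + 1) = 1)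
    (hw : w ^ (2 * h + 1) = 1) (hw1 : w ≠ 1) (N : ℕ → ℂ)
    (hN : ∀ x : ℂ, (1 - w * x) * (1 - w⁻¹ * x) * ∑ m ∈ Finset.range (2 * h), N m * x ^ m =
      1 - x ^ (2 * h + 1)) (a : ℤ) (h0 : q ≠ 0) (h1 : ‖q‖ < 1) :
    proj ζ (2 * h + 1) a (fun q => phiG q z w) q =
      (if (2 * h + 1 : ℤ) ∣ a then (2 * h + 1) * ((1 + z) / ((1 - w) * (1 - w⁻¹))) else 0) +
      ∑ j ∈ Finset.range (2 * h + 1), ∑ m ∈ Finset.range (2 * h),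
        N m * (z ^ (j - h : ℤ) + z ^ (1 - (j - h) : ℤ)) *
          (if (2 * h + 1 : ℤ) ∣ tri (j - h + 1) + m * (j - h) - a then
            (2 * h + 1) * lser h m (j - h) q else 0) := by
  have hl : 2 * h + 1 ≠ 0 := by omega
  have hwn : ‖w‖ = 1 := Complex.norm_eq_one_of_pow_eq_one hw hl
  have hz0 : z ≠ 0 := by rintro rfl; simp at hz
  rw [proj_congr (hζ.norm'_eq_one hl) _ _ (fun q h0 h1 => phiG_dissect h0 h1 hz0 hz N hN
    (notPower_of_norm_eq_one h1 hwn hw1)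
    (notPower_of_norm_eq_one h1 (by simp [hwn]) (by simpa using hw1))) h0 h1, proj_add, proj_sum]
  congr 1
  · rw [proj_homog (e := 0) hl hζ _ (by intro q _ j; simp) h0]
    simp only [zero_sub, dvd_neg]
    push_cast
    rfl
  · refine Finset.sum_congr rfl fun j _ => ?_
    rw [proj_sum]
    refine Finset.sum_congr rfl fun m _ => ?_
    rw [proj_const_mul, proj_homog hl hζ _ (homog_lser hζ.pow_eq_one _ _) h0]
    push_cast
    rfl

theorem thetaR_mul_anSeries_one (h0 : q ≠ 0) (h1 : ‖q‖ < 1) {z w : ℂ} (hz : ‖z‖ = 1) (hw : ‖w‖ = 1)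
    (hz1 : z ≠ 1) (hw1 : w ≠ 1) (hne : 1 + z ≠ 0) :
    (1 + z) * (thetaR q z * (anSeries 1 z w q + anPrefactor z w q)) = phiF q z w := by
  rw [← fullSeries_one h0 h1 hz hw hz1 hw1 hne, fullSeries, thetaR]
  ring

theorem thetaR_mul_anSeries_two (h0 : q ≠ 0) (h1 : ‖q‖ < 1) {z w : ℂ} (hz : ‖z‖ = 1) (hw : ‖w‖ = 1)
    (hz1 : z ≠ 1) (hw1 : w ≠ 1) (hne : 1 + z ≠ 0) :
    (1 + z) * (thetaR q z * (anSeries 2 z w q + anPrefactor z w q)) = phiG q z w := by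
  rw [← fullSeries_two h0 h1 hz hw hz1 hw1 hne, fullSeries, thetaR]
  ring

theorem one_add_ne_zero_of_isPrimitiveRoot {ζ : ℂ} {l : ℕ} (hl2 : 2 < l) (hζ : IsPrimitiveRoot ζ l) :
    1 + ζ ≠ 0 := fun h =>
  sq_ne_one_of_isPrimitiveRoot hl2 hζ (by rw [show ζ = -1 by linear_combination h]; norm_num)

theorem eventually_small_ne_zero : ∀ᶠ q in 𝓝[≠] (0 : ℂ), q ≠ 0 ∧ ‖q‖ < 1 := by
  filter_upwards [self_mem_nhdsWithin, mem_nhdsWithin_of_mem_nhds (Metric.ball_mem_nhds 0 one_pos)]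
    with q h1 h2
  exact ⟨h1, by simpa using h2⟩

theorem coeff_termSum_eq_zero {e : ℕ} (he : 1 ≤ e) {ζ : ℂ} {l : ℕ} (hl2 : 2 < l)
    (hζ : IsPrimitiveRoot ζ l) (a : ℕ)
    (h : ∀ᶠ q in 𝓝[≠] (0 : ℂ), proj ζ l a (fun q => anSeries e ζ (ζ ^ 2) q) q = 0) (n : ℕ) :
    PowerSeries.coeff (l * n + a)
      (prefactor (ζ ^ 2) (ζ ^ 2)⁻¹ ζ * termSum e (ζ ^ 2) (ζ ^ 2)⁻¹ ζ) = 0 := by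
  have hn : ‖ζ‖ = 1 := hζ.norm'_eq_one (by omega)
  refine (represents_prefactor_mul he hn (by rw [norm_pow, hn, one_pow]) (hζ.ne_one (by omega))
    (sq_ne_one_of_isPrimitiveRoot hl2 hζ)).coeff_eq_zero (by omega) hζ a ?_ n
  exact h

end Products

end RankQuadruples

namespace RankQuadruples

open Filter Topology

/-! ### Modulus 3 -/

section Three

variable {q : ℂ}

theorem homog_pow_mul {ζ : ℂ} {l : ℕ} (hζ : ζ ^ l = 1) (e : ℕ) (f : ℂ → ℂ) :
    Homog ζ e (fun q => q ^ e * f (q ^ l)) := by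
  intro q _ j
  have e1 : (ζ ^ j * q) ^ l = q ^ l := by
    rw [mul_pow, ← pow_mul, mul_comm j, pow_mul, hζ, one_pow, one_mul]
  beta_reduce
  rw [e1, mul_pow, mul_comm (e : ℤ), zpow_mul, zpow_natCast, zpow_natCast]
  ring

theorem proj_pow_mul_mul {ζ : ℂ} {l : ℕ} (hl : l ≠ 0) (hζ : IsPrimitiveRoot ζ l) (a : ℤ) (e : ℕ)
    (g f : ℂ → ℂ) (h0 : q ≠ 0) :
    proj ζ l a (fun q => q ^ e * g (q ^ l) * f q) q = q ^ e * g (q ^ l) * proj ζ l (a - e) f q :=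
  proj_homog_mul (hζ.ne_zero hl) l a (homog_pow_mul hζ.pow_eq_one e g) f h0

theorem proj_mul {ζ : ℂ} {l : ℕ} (hl : l ≠ 0) (hζ : IsPrimitiveRoot ζ l) (a : ℤ)
    (g f : ℂ → ℂ) (h0 : q ≠ 0) :
    proj ζ l a (fun q => g (q ^ l) * f q) q = g (q ^ l) * proj ζ l a f q := by
  simpa using proj_pow_mul_mul hl hζ a 0 g f h0

theorem proj_pow_mul {ζ : ℂ} {l : ℕ} (hl : l ≠ 0) (hζ : IsPrimitiveRoot ζ l) (a : ℤ) (e : ℕ)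
    (g : ℂ → ℂ) (h0 : q ≠ 0) : proj ζ l a (fun q => q ^ e * g (q ^ l)) q =
      if (l : ℤ) ∣ e - a then l * (q ^ e * g (q ^ l)) else 0 :=
  proj_homog hl hζ a (homog_pow_mul hζ.pow_eq_one e g) h0

theorem geom_three {ζ : ℂ} (hζ : IsPrimitiveRoot ζ 3) : 1 + ζ + ζ ^ 2 = 0 := by
  simpa [Finset.sum_range_succ] using hζ.geom_sum_eq_zero (by norm_num)

theorem factor_three {w : ℂ} (hw : IsPrimitiveRoot w 3) (x : ℂ) :
    (1 - w * x) * (1 - w⁻¹ * x) * ∑ m ∈ Finset.range (2 * 1), (-1) ^ m * x ^ m =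
      1 - x ^ (2 * 1 + 1) := by
  have h3 := hw.pow_eq_one
  have e : w⁻¹ = w ^ 2 := inv_eq_of_mul_eq_one_right (by linear_combination h3)
  simp [Finset.sum_range_succ, e]
  linear_combination (-x + x ^ 2) * geom_three hw + (1 - x) * x ^ 2 * h3

/-- Triangular numbers are 0 or 1 modulo 3, so only two classes occur. The class of 1 is Jacobi's
series again, at base q⁹, hence a cube. -/
theorem thetaD_one_three (h0 : q ≠ 0) (h1 : ‖q‖ < 1) :
    thetaD q 1 = q ^ 0 * (6 * thetaD ((q ^ 3) ^ 3) (q ^ 3) - theta ((q ^ 3) ^ 3) (q ^ 3)) +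
      q ^ 1 * (3 * pochInf ((q ^ 3) ^ 3) ((q ^ 3) ^ 3) ^ 3) := by
  have h := thetaD_one_dissect h0 h1 1
  norm_num [Finset.sum_range_succ, tri] at h
  have hQ : q ^ 3 ≠ 0 := pow_ne_zero _ h0
  have hP : q ^ 9 ≠ 0 := pow_ne_zero _ h0
  have e : (q ^ 3) ^ 2 = q ^ 9 / q ^ 3 := by
    rw [eq_div_iff hQ]; ring
  rw [e, theta_q_div hP hQ, thetaD_q_div hP hQ, theta_one hP,
    thetaD_one hP (norm_pow_lt_one h1 (by norm_num))] at h
  rw [← pow_mul, h]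
  ring

/-- As ζ² = 1/ζ, both theta factors equal `thetaR q ζ`, which is 3(q³;q³)_∞. The added term n = 0 is
therefore (q)_∞³ over its square, and `thetaD_one` makes the cube a series. -/
theorem anSeries_three (h0 : q ≠ 0) (h1 : ‖q‖ < 1) {ζ Φ : ℂ} (hζ : IsPrimitiveRoot ζ 3) {e : ℕ}
    (h : (1 + ζ) * (thetaR q ζ * (anSeries e ζ (ζ ^ 2) q + anPrefactor ζ (ζ ^ 2) q)) = Φ) :
    9 * (1 + ζ) * pochInf (q ^ 3) (q ^ 3) ^ 2 * anSeries e ζ (ζ ^ 2) q =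
      3 * pochInf (q ^ 3) (q ^ 3) * Φ + (1 + ζ) * thetaD q 1 := by
  have hn : ‖ζ‖ = 1 := hζ.norm'_eq_one (by norm_num)
  have h2 := pochInf_self_mul_prod_thetaR (h := 1) hζ h0 h1
  have hE := pochInf_self_ne_zero h1
  have e1 : ζ ^ 2 = ζ⁻¹ := (inv_eq_of_mul_eq_one_right (by linear_combination hζ.pow_eq_one)).symm
  have h4 := thetaR_mul_anPrefactor h0 h1 hn (w := ζ ^ 2) (by simp [hn]) (hζ.ne_one (by norm_num))
    (sq_ne_one_of_isPrimitiveRoot (by norm_num) hζ)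
  simp only [Finset.prod_range_one, zero_add, pow_one, mul_one, Nat.cast_one, Nat.reduceAdd] at h2
  rw [e1, thetaR_inv h0 (hζ.ne_zero (by norm_num)), ← e1] at h4
  have h5 : thetaR q ζ = 3 * pochInf (q ^ 3) (q ^ 3) := mul_left_cancel₀ hE (by linear_combination h2)
  rw [thetaD_one h0 h1, ← h, ← h4, h5]
  ring

theorem pochInf_cube (h0 : q ≠ 0) (h1 : ‖q‖ < 1) : pochInf q q = theta (q ^ 3) q := by
  rw [pochInf_self_split (l := 3) (by norm_num) h1, theta_eq (pow_ne_zero 3 h0) (norm_pow_lt_one h1 (by norm_num)) h0,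
    show q ^ 3 / q = q ^ 2 by field_simp]
  simp only [Finset.prod_range_succ, Finset.prod_range_zero, zero_add, pow_one, one_mul, Nat.reduceAdd]
  ring

/-- The degenerate transformation at base q³ with v = x = q; the symmetry x ↦ q³/x brings the values
at vx = q² back to q. -/
theorem appell_three (h0 : q ≠ 0) (h1 : ‖q‖ < 1) :
    theta (q ^ 3) q * (appell (q ^ 3) q 1 - q * appell (q ^ 3) (q ^ 2) q) = 2 * thetaD (q ^ 3) q := by
  have hP : q ^ 3 ≠ 0 := pow_ne_zero _ h0
  have hv : NotPower (q ^ 3) q := by simpa using notPower_zpow h0 h1 (l := 3) (s := 1) (by norm_num)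
  have h := appell_transformation_one hP (norm_pow_lt_one h1 (by norm_num)) h0 hv h0
  have e : q * q = q ^ 3 / q := by field_simp
  rw [e, theta_q_div hP h0, thetaD_q_div hP h0, ← e, ← sq] at h
  refine mul_left_cancel₀ (theta_ne_zero hP (norm_pow_lt_one h1 (by norm_num)) h0 hv) ?_
  linear_combination h

/-- In class 0 the constant of `phiF` cancels the `theta` part of Jacobi's series, and the Appell
sums cancel its `thetaD` part by `appell_three`. -/
theorem coeff_F_three {ζ : ℂ} (hζ : IsPrimitiveRoot ζ 3) (n : ℕ) :
    PowerSeries.coeff (3 * n + 0) (F (ζ ^ 2) (ζ ^ 2)⁻¹ ζ) = 0 := by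
  refine coeff_termSum_eq_zero le_rfl (by norm_num) hζ 0 ?_ n
  have hn : ‖ζ‖ = 1 := hζ.norm'_eq_one (by norm_num)
  have hne := one_add_ne_zero_of_isPrimitiveRoot (by norm_num) hζ
  have hw : IsPrimitiveRoot (ζ ^ 2) 3 := hζ.pow_of_coprime 2 (by norm_num)
  have hw1 := hw.ne_one (by norm_num)
  filter_upwards [eventually_small_ne_zero] with q ⟨h0, h1⟩
  have hQ : q ^ 3 ≠ 0 := pow_ne_zero _ h0
  have hP : q ^ 9 ≠ 0 := pow_ne_zero _ h0
  have hE := pochInf_self_ne_zero (norm_pow_lt_one h1 (n := 3) (by norm_num))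
  have h2 := proj_congr hn 3 0 (fun q h0 h1 => anSeries_three h0 h1 hζ
    (thetaR_mul_anSeries_one h0 h1 hn (w := ζ ^ 2) (by simp [hn]) (hζ.ne_one (by norm_num)) hw1 hne)) h0 h1
  rw [proj_mul (by norm_num) hζ 0 (fun x => 9 * (1 + ζ) * pochInf x x ^ 2) _ h0, proj_add,
    proj_mul (by norm_num) hζ 0 (fun x => 3 * pochInf x x) _ h0, proj_const_mul,
    proj_congr hn 3 0 (fun q h0 h1 => thetaD_one_three h0 h1) h0 h1, proj_add,
    proj_pow_mul (by norm_num) hζ 0 0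
      (fun x => 6 * thetaD (x ^ 3) x - theta (x ^ 3) x) h0,
    proj_pow_mul (by norm_num) hζ 0 1 (fun x => 3 * pochInf (x ^ 3) (x ^ 3) ^ 3) h0] at h2
  have h3 := proj_phiF (h := 1) hζ hζ.pow_eq_one hw.pow_eq_one hw1 (fun m => (-1) ^ m) (factor_three hw) 0 h0 h1
  norm_num [Finset.sum_range_succ, tri, lser] at h2 h3
  have e1 := pochInf_cube hQ (norm_pow_lt_one h1 (by norm_num))
  have e2 := appell_three hQ (norm_pow_lt_one h1 (by norm_num))
  rw [appell_one_one hP] at h3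
  rw [← pow_mul] at e1 e2 h2
  norm_num at e1 e2 h2
  have e3 : (1 - ζ ^ 2) * (1 - (ζ ^ 2)⁻¹) = 3 := by
    rw [show (ζ ^ 2)⁻¹ = ζ from inv_eq_of_mul_eq_one_right (by linear_combination hζ.pow_eq_one)]
    linear_combination hζ.pow_eq_one - geom_three hζ
  rw [e3] at h3
  have h4 : 9 * (1 + ζ) * pochInf (q ^ 3) (q ^ 3) ^ 2 ≠ 0 :=
    mul_ne_zero (mul_ne_zero (by norm_num) hne) (pow_ne_zero _ hE)
  refine mul_left_cancel₀ h4 ?_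
  rw [Nat.cast_zero]
  refine h2.trans ?_
  rw [h3, e1]
  linear_combination -9 * (1 + ζ) * e2

/-- In class 1 a single Appell sum is left in `phiG`; `appell_one` at base q⁹ matches it with the
cube contributed by Jacobi's series. -/
theorem coeff_G_three {ζ : ℂ} (hζ : IsPrimitiveRoot ζ 3) (n : ℕ) :
    PowerSeries.coeff (3 * n + 1) (G (ζ ^ 2) (ζ ^ 2)⁻¹ ζ) = 0 := by
  refine coeff_termSum_eq_zero one_le_two (by norm_num) hζ 1 ?_ n
  have hn : ‖ζ‖ = 1 := hζ.norm'_eq_one (by norm_num)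
  have hne := one_add_ne_zero_of_isPrimitiveRoot (by norm_num) hζ
  have hw : IsPrimitiveRoot (ζ ^ 2) 3 := hζ.pow_of_coprime 2 (by norm_num)
  have hw1 := hw.ne_one (by norm_num)
  filter_upwards [eventually_small_ne_zero] with q ⟨h0, h1⟩
  have hQ : q ^ 3 ≠ 0 := pow_ne_zero _ h0
  have hP : q ^ 9 ≠ 0 := pow_ne_zero _ h0
  have hE := pochInf_self_ne_zero (norm_pow_lt_one h1 (n := 3) (by norm_num))
  have h2 := proj_congr hn 3 1 (fun q h0 h1 => anSeries_three h0 h1 hζ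
    (thetaR_mul_anSeries_two h0 h1 hn (w := ζ ^ 2) (by simp [hn]) (hζ.ne_one (by norm_num)) hw1 hne)) h0 h1
  rw [proj_mul (by norm_num) hζ 1 (fun x => 9 * (1 + ζ) * pochInf x x ^ 2) _ h0, proj_add,
    proj_mul (by norm_num) hζ 1 (fun x => 3 * pochInf x x) _ h0, proj_const_mul,
    proj_congr hn 3 1 (fun q h0 h1 => thetaD_one_three h0 h1) h0 h1, proj_add,
    proj_pow_mul (by norm_num) hζ 1 0
      (fun x => 6 * thetaD (x ^ 3) x - theta (x ^ 3) x) h0,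
    proj_pow_mul (by norm_num) hζ 1 1 (fun x => 3 * pochInf (x ^ 3) (x ^ 3) ^ 3) h0] at h2
  have h3 := proj_phiG (h := 1) hζ hζ.pow_eq_one hw.pow_eq_one hw1 (fun m => (-1) ^ m) (factor_three hw) 1 h0 h1
  norm_num [Finset.sum_range_succ, tri, lser] at h2 h3
  have hP1 : ‖q ^ 9‖ < 1 := norm_pow_lt_one h1 (by norm_num)
  have h5 : NotPower (q ^ 9) (q ^ 3) := by
    have := notPower_zpow hQ (norm_pow_lt_one h1 (n := 3) (by norm_num)) (l := 3) (s := 1) (by norm_num)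
    rwa [← pow_mul, zpow_one] at this
  have h6 := appell_one hP hP1 hQ h5 ?_
  · have h4 : 9 * (1 + ζ) * pochInf (q ^ 3) (q ^ 3) ^ 2 ≠ 0 :=
      mul_ne_zero (mul_ne_zero (by norm_num) hne) (pow_ne_zero _ hE)
    refine mul_left_cancel₀ h4 ?_
    have e1 := pochInf_cube hQ (norm_pow_lt_one h1 (by norm_num))
    rw [← pow_mul] at h2 e1
    norm_num at h2 e1
    rw [Nat.cast_one]
    refine h2.trans ?_
    rw [h3, e1, ← h6]
    ring
  · rw [← pow_mul]
    intro h
    have := one_sub_zpow_ne_zero h1 (n := 6) (by norm_num)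
    exact this (by rw [sub_eq_zero]; exact_mod_cast h.symm)

end Three

end RankQuadruples

namespace RankQuadruples

open Filter Topology

/-! ### Theta functions and Appell sums at powers of q -/

section PowerArguments

variable {q : ℂ}

/-- The theta function with base `q ^ l` at `q ^ k`. -/
noncomputable def thetaPow (l : ℕ) (q : ℂ) (k : ℤ) : ℂ := theta (q ^ l) (q ^ k)

/-- The Appell sum with base `q ^ l` and arguments `q ^ i`, `q ^ s`. -/
noncomputable def appellPow (l : ℕ) (q : ℂ) (i s : ℤ) : ℂ := appell (q ^ l) (q ^ i) (q ^ s)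

theorem thetaPow_sub {l : ℕ} (h0 : q ≠ 0) (k : ℤ) : thetaPow l q (l - k) = thetaPow l q k := by
  rw [thetaPow, thetaPow, zpow_sub₀ h0, zpow_natCast,
    theta_q_div (pow_ne_zero l h0) (zpow_ne_zero k h0)]

theorem thetaPow_neg {l : ℕ} (h0 : q ≠ 0) (k : ℤ) :
    thetaPow l q (-k) = -q ^ (-k) * thetaPow l q k := by
  rw [thetaPow, thetaPow, zpow_neg, theta_inv (pow_ne_zero l h0) (zpow_ne_zero k h0)]

theorem appellPow_neg {l : ℕ} (h0 : q ≠ 0) (i s : ℤ) :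
    appellPow l q (-i) (-s) = -q ^ s * appellPow l q i s := by
  rw [appellPow, appellPow, zpow_neg, zpow_neg, appell_inv (pow_ne_zero l h0) (zpow_ne_zero s h0)]

theorem thetaPow_ne_zero {l : ℕ} (hl : l ≠ 0) (h0 : q ≠ 0) (h1 : ‖q‖ < 1) {k : ℤ} (hk : ¬(l : ℤ) ∣ k) :
    thetaPow l q k ≠ 0 :=
  theta_ne_zero (pow_ne_zero l h0) (norm_pow_lt_one h1 hl) (zpow_ne_zero k h0) (notPower_zpow h0 h1 hk)

theorem appellPow_transformation {l : ℕ} (hl : l ≠ 0) (h0 : q ≠ 0) (h1 : ‖q‖ < 1) {a b : ℤ} (c : ℤ)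
    (ha : ¬(l : ℤ) ∣ a) (hb : ¬(l : ℤ) ∣ b) :
    thetaPow l q a * thetaPow l q b * (thetaPow l q (a + c - b) * appellPow l q c b -
      q ^ (a - b) * (thetaPow l q c * appellPow l q (a + c - b) a)) =
        thetaPow l q (a - b) * pochInf (q ^ l) (q ^ l) ^ 3 * thetaPow l q (a + c) := by
  have h := appell_transformation (pow_ne_zero l h0) (norm_pow_lt_one h1 hl) (zpow_ne_zero a h0)
    (zpow_ne_zero b h0) (notPower_zpow h0 h1 ha) (notPower_zpow h0 h1 hb) ?_ (zpow_ne_zero c h0)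
  · simp only [thetaPow, appellPow, zpow_add₀ h0, zpow_sub₀ h0]
    exact h
  · rw [← zpow_natCast, ← zpow_mul]
    intro h
    exact one_sub_zpow_ne_zero h1 (n := b * (2 : ℕ)) (by rintro h; exact hb (by simp at h; simp [h]))
      (by rw [h, sub_self])

theorem lser_eq (h : ℕ) (k s : ℤ) : lser h k s q =
    (-1) ^ s * q ^ (tri (s + 1) + k * s) * appellPow (2 * h + 1) (q ^ (2 * h + 1)) (s - h + k) s := by
  rw [lser, appellPow, ← pow_mul, ← sq]

/-- The factors of (q)_∞ are grouped by residues modulo 2h + 1, and opposite non-zero residues are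
paired by the triple product. -/
theorem pochInf_split_two_mul_add_one (h0 : q ≠ 0) (h1 : ‖q‖ < 1) (h : ℕ) :
    pochInf (q ^ (2 * h + 1)) (q ^ (2 * h + 1)) ^ h * pochInf q q =
      pochInf (q ^ (2 * h + 1)) (q ^ (2 * h + 1)) *
        ∏ i ∈ Finset.range h, thetaPow (2 * h + 1) q (i + 1) := by
  have hl : 2 * h + 1 ≠ 0 := by omega
  have e1 : ∀ i ∈ Finset.range h, thetaPow (2 * h + 1) q (i + 1) =
      pochInf (q ^ (2 * h + 1)) (q ^ (2 * h + 1)) * (pochInf (q ^ (i + 1)) (q ^ (2 * h + 1)) *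
        pochInf (q ^ (h + (h - 1 - i) + 1)) (q ^ (2 * h + 1))) := by
    intro i hi
    rw [Finset.mem_range] at hi
    rw [thetaPow, show ((i : ℤ) + 1) = ((i + 1 : ℕ) : ℤ) by push_cast; rfl, zpow_natCast,
      theta_eq (pow_ne_zero _ h0) (norm_pow_lt_one h1 hl) (pow_ne_zero _ h0)]
    congr 3
    rw [div_eq_iff (pow_ne_zero _ h0), ← pow_add]
    congr 1
    omega
  rw [Finset.prod_congr rfl e1, Finset.prod_mul_distrib, Finset.prod_const, Finset.card_range,
    Finset.prod_mul_distrib, Finset.prod_range_reflect (fun x => pochInf (q ^ (h + x + 1)) (q ^ (2 * h + 1))),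
    ← Finset.prod_range_add (fun x => pochInf (q ^ (x + 1)) (q ^ (2 * h + 1))),
    pochInf_self_split (l := 2 * h + 1) (by omega) h1, Finset.prod_range_succ, ← two_mul]
  ring

theorem theta_dissect_pow (h0 : q ≠ 0) (h1 : ‖q‖ < 1) {h : ℕ} {z : ℂ} (hz0 : z ≠ 0)
    (hz : z ^ (2 * h + 1) = 1) :
    theta q z = ∑ j ∈ Finset.range (2 * h + 1), (-1) ^ (j - h : ℤ) * q ^ tri (j - h) *
      z ^ (j - h : ℤ) * thetaPow (2 * h + 1) (q ^ (2 * h + 1)) j := by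
  simp only [theta_dissect h0 h1 hz0 hz, thetaPow, zpow_natCast, ← pow_mul, sq]

end PowerArguments

/-! ### Modulus 5 -/

section Five

variable {q : ℂ}

theorem geom_five {ζ : ℂ} (hζ : IsPrimitiveRoot ζ 5) : 1 + ζ + ζ ^ 2 + ζ ^ 3 + ζ ^ 4 = 0 := by
  simpa [Finset.sum_range_succ] using hζ.geom_sum_eq_zero (by norm_num)

/-- Coefficients of `(1 - x^5) / ((1 - w x) (1 - x / w))`, where `w` is a primitive fifth root of unity
and `c = w + 1 / w`. -/
noncomputable def numFive (c : ℂ) (m : ℕ) : ℂ := [1, c, -c, -1].getD m 0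

theorem factor_five {w : ℂ} (hw : IsPrimitiveRoot w 5) (x : ℂ) :
    (1 - w * x) * (1 - w⁻¹ * x) * ∑ m ∈ Finset.range (2 * 2), numFive (w + w⁻¹) m * x ^ m =
      1 - x ^ (2 * 2 + 1) := by
  have h5 := hw.pow_eq_one
  have e : w * w⁻¹ = 1 := mul_inv_cancel₀ (hw.ne_zero (by norm_num))
  have hc : (w + w⁻¹) ^ 2 = 1 - (w + w⁻¹) := by
    rw [show w⁻¹ = w ^ 4 from inv_eq_of_mul_eq_one_right (by linear_combination h5)]
    linear_combination geom_five hw + (2 + w ^ 3) * h5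
  simp [Finset.sum_range_succ, numFive]
  generalize w⁻¹ = w' at *
  have hs : (1 - w * x) * (1 - w' * x) = 1 - (w + w') * x + x ^ 2 := by linear_combination x ^ 2 * e
  rw [hs]
  linear_combination (-x ^ 2 + x ^ 3) * hc

/-- Of the five pieces of the theta series one vanishes by `theta_one` and the others agree in pairs
by `thetaPow_sub`. Two theta functions of q⁵ remain, in the classes 0 and 1; they are called X and Y
below. -/
theorem thetaR_five (h0 : q ≠ 0) (h1 : ‖q‖ < 1) {z : ℂ} (hz : IsPrimitiveRoot z 5) :
    thetaR q z = (2 - z - z ^ 4) * thetaPow 5 (q ^ 5) 2 -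
      (1 + 2 * z + 2 * z ^ 4) * q * thetaPow 5 (q ^ 5) 1 := by
  have h5 := hz.pow_eq_one
  have hQ : q ^ 5 ≠ 0 := pow_ne_zero _ h0
  have e1 : z⁻¹ = z ^ 4 := inv_eq_of_mul_eq_one_right (by linear_combination h5)
  have e2 := thetaPow_sub (l := 5) hQ 2
  have e3 := thetaPow_sub (l := 5) hQ 1
  have e4 : thetaPow 5 (q ^ 5) 0 = 0 := by
    rw [thetaPow, zpow_zero, theta_one (pow_ne_zero _ hQ)]
  have h := theta_dissect_pow (h := 2) h0 h1 (hz.ne_zero (by norm_num)) h5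
  norm_num [Finset.sum_range_succ, tri] at h e2 e3
  rw [e2, e3, e4, e1] at h
  rw [thetaR, h, e1]
  have hg := geom_five hz
  generalize thetaPow 5 (q ^ 5) 1 = Y at *
  generalize thetaPow 5 (q ^ 5) 2 = X at *
  clear h e1 e2 e3 e4 hQ h5 h0 h1 hz
  grind

theorem euler_mul_five (h0 : q ≠ 0) (h1 : ‖q‖ < 1) :
    pochInf q q * pochInf (q ^ 5) (q ^ 5) = thetaPow 5 (q ^ 5) 2 ^ 2 -
      q * thetaPow 5 (q ^ 5) 2 * thetaPow 5 (q ^ 5) 1 - q ^ 2 * thetaPow 5 (q ^ 5) 1 ^ 2 := by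
  have hζ : IsPrimitiveRoot (Complex.exp (2 * Real.pi * Complex.I / (5 : ℕ))) 5 := Complex.isPrimitiveRoot_exp 5 (by norm_num)
  set ζ := Complex.exp (2 * Real.pi * Complex.I / (5 : ℕ))
  have hE := pochInf_self_ne_zero h1
  have h2 := pochInf_self_mul_prod_thetaR (h := 2) hζ h0 h1
  simp [Finset.prod_range_succ] at h2
  rw [thetaR_five h0 h1 hζ, thetaR_five h0 h1 (hζ.pow_of_coprime 2 (by norm_num))] at h2
  have h5 := hζ.pow_eq_one
  have hg := geom_five hζ
  have h6 : pochInf q q * ((2 * 2 + 1) * (pochInf q q * pochInf (q ^ 5) (q ^ 5))) = _ :=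
    (by ring : _ = (2 * 2 + 1) * pochInf q q ^ 2 * pochInf (q ^ 5) (q ^ 5)).trans h2.symm
  have h7 := mul_left_cancel₀ hE h6
  generalize thetaPow 5 (q ^ 5) 1 = Y at *
  generalize thetaPow 5 (q ^ 5) 2 = X at *
  generalize pochInf q q * pochInf (q ^ 5) (q ^ 5) = EE at *
  clear h6 h2 hE h5 hζ h0 h1
  clear_value ζ
  grind

theorem euler_fifth (h0 : q ≠ 0) (h1 : ‖q‖ < 1) :
    pochInf q q * pochInf (q ^ 5) (q ^ 5) = thetaPow 5 q 2 * thetaPow 5 q 1 := by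
  have h := pochInf_split_two_mul_add_one h0 h1 2
  norm_num [Finset.prod_range_succ] at h
  refine mul_left_cancel₀ (pochInf_self_ne_zero (norm_pow_lt_one h1 (n := 5) (by norm_num))) ?_
  linear_combination h

/-- The choice a = -1, b = 2, c = 4 makes the theta coefficients of the two Appell sums, at a + c -
b = 1 and at c = 5 - 1, equal, so only a difference of sums occurs. -/
theorem appellPow_five_first (h0 : q ≠ 0) (h1 : ‖q‖ < 1) :
    thetaPow 5 q 1 ^ 2 * (q ^ 3 * appellPow 5 q 4 2 - appellPow 5 q 1 (-1)) =
      q * thetaPow 5 q 2 * pochInf (q ^ 5) (q ^ 5) ^ 3 := by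
  have h := appellPow_transformation (l := 5) (by norm_num) h0 h1 (a := -1) (b := 2) 4
    (by norm_num) (by norm_num)
  have e1 := thetaPow_sub (l := 5) h0 1
  have e2 := thetaPow_sub (l := 5) h0 2
  have n1 : thetaPow 5 q 1 ≠ 0 := thetaPow_ne_zero (by norm_num) h0 h1 (by norm_num)
  have n2 : thetaPow 5 q 2 ≠ 0 := thetaPow_ne_zero (by norm_num) h0 h1 (by norm_num)
  norm_num [thetaPow_neg h0] at h e1 e2
  rw [e1, e2] at h
  field_simp at h
  exact h

theorem appellPow_five_second (h0 : q ≠ 0) (h1 : ‖q‖ < 1) :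
    thetaPow 5 q 2 ^ 2 * (appellPow 5 q 2 1 - q * appellPow 5 q 3 2) =
      thetaPow 5 q 1 * pochInf (q ^ 5) (q ^ 5) ^ 3 := by
  have h := appellPow_transformation (l := 5) (by norm_num) h0 h1 (a := 1) (b := 2) 3
    (by norm_num) (by norm_num)
  have e1 := thetaPow_sub (l := 5) h0 1
  have e2 := thetaPow_sub (l := 5) h0 2
  have n1 : thetaPow 5 q 1 ≠ 0 := thetaPow_ne_zero (by norm_num) h0 h1 (by norm_num)
  have n2 : thetaPow 5 q 2 ≠ 0 := thetaPow_ne_zero (by norm_num) h0 h1 (by norm_num)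
  norm_num [thetaPow_neg h0] at h e1 e2
  rw [e1, e2] at h
  field_simp at h
  linear_combination -h

theorem lser_five_first (h0 : q ≠ 0) (h1 : ‖q‖ < 1) :
    thetaPow 5 (q ^ 5) 1 ^ 2 * (lser 2 4 (-1) q + lser 2 4 2 q) =
      q * thetaPow 5 (q ^ 5) 2 * pochInf ((q ^ 5) ^ 5) ((q ^ 5) ^ 5) ^ 3 := by
  have h := appellPow_five_first (pow_ne_zero 5 h0) (norm_pow_lt_one h1 (by norm_num))
  rw [lser_eq, lser_eq]
  norm_num [tri]
  field_simp
  rw [← pow_mul, ← pow_mul] at h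
  norm_num at h
  linear_combination h

theorem lser_five_second (h0 : q ≠ 0) (h1 : ‖q‖ < 1) :
    thetaPow 5 (q ^ 5) 2 ^ 2 * (lser 2 3 1 q + lser 2 3 2 q) =
      -(q ^ 4 * thetaPow 5 (q ^ 5) 1 * pochInf ((q ^ 5) ^ 5) ((q ^ 5) ^ 5) ^ 3) := by
  have h := appellPow_five_second (pow_ne_zero 5 h0) (norm_pow_lt_one h1 (by norm_num))
  rw [lser_eq, lser_eq]
  norm_num [tri]
  linear_combination -q ^ 4 * h

/-- The product of the two `thetaR` is 5(q)_∞(q⁵;q⁵)_∞, so the left side is the square of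
(q)_∞(q⁵;q⁵)_∞, which `euler_mul_five` dissects. -/
theorem euler_five (h0 : q ≠ 0) (h1 : ‖q‖ < 1) {ζ : ℂ} (hζ : IsPrimitiveRoot ζ 5) :
    5 * pochInf (q ^ 5) (q ^ 5) ^ 3 * anPrefactor ζ (ζ ^ 2) q = (thetaPow 5 (q ^ 5) 2 ^ 2 -
      q * thetaPow 5 (q ^ 5) 2 * thetaPow 5 (q ^ 5) 1 - q ^ 2 * thetaPow 5 (q ^ 5) 1 ^ 2) ^ 2 := by
  have hn : ‖ζ‖ = 1 := hζ.norm'_eq_one (by norm_num)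
  have hE := pochInf_self_ne_zero h1
  have h2 := pochInf_self_mul_prod_thetaR (h := 2) hζ h0 h1
  have h4 := thetaR_mul_anPrefactor h0 h1 hn (w := ζ ^ 2) (by simp [hn]) (hζ.ne_one (by norm_num))
    (sq_ne_one_of_isPrimitiveRoot (by norm_num) hζ)
  norm_num [Finset.prod_range_succ] at h2
  rw [← euler_mul_five h0 h1]
  refine mul_left_cancel₀ (pow_ne_zero 2 hE) ?_
  linear_combination pochInf (q ^ 5) (q ^ 5) ^ 2 * (pochInf q q * h4 - anPrefactor ζ (ζ ^ 2) q * h2)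

theorem proj_anPrefactor_five (h0 : q ≠ 0) (h1 : ‖q‖ < 1) {ζ : ℂ} (hζ : IsPrimitiveRoot ζ 5) (a : ℤ) :
    5 * pochInf (q ^ 5) (q ^ 5) ^ 3 * proj ζ 5 a (fun q => anPrefactor ζ (ζ ^ 2) q) q =
      (if (5 : ℤ) ∣ 0 - a then 5 * thetaPow 5 (q ^ 5) 2 ^ 4 else 0) +
      (if (5 : ℤ) ∣ 1 - a then -10 * q * (thetaPow 5 (q ^ 5) 2 ^ 3 * thetaPow 5 (q ^ 5) 1) else 0) +
      (if (5 : ℤ) ∣ 2 - a then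
        -5 * q ^ 2 * (thetaPow 5 (q ^ 5) 2 ^ 2 * thetaPow 5 (q ^ 5) 1 ^ 2) else 0) +
      (if (5 : ℤ) ∣ 3 - a then 10 * q ^ 3 * (thetaPow 5 (q ^ 5) 2 * thetaPow 5 (q ^ 5) 1 ^ 3) else 0) +
      (if (5 : ℤ) ∣ 4 - a then 5 * q ^ 4 * thetaPow 5 (q ^ 5) 1 ^ 4 else 0) := by
  have hl : (5 : ℕ) ≠ 0 := by norm_num
  have h : ∀ q : ℂ, q ≠ 0 → ‖q‖ < 1 →
      5 * pochInf (q ^ 5) (q ^ 5) ^ 3 * anPrefactor ζ (ζ ^ 2) q =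
      q ^ 0 * thetaPow 5 (q ^ 5) 2 ^ 4 +
      q ^ 1 * (-2 * thetaPow 5 (q ^ 5) 2 ^ 3 * thetaPow 5 (q ^ 5) 1) +
      q ^ 2 * (-thetaPow 5 (q ^ 5) 2 ^ 2 * thetaPow 5 (q ^ 5) 1 ^ 2) +
      q ^ 3 * (2 * thetaPow 5 (q ^ 5) 2 * thetaPow 5 (q ^ 5) 1 ^ 3) +
      q ^ 4 * thetaPow 5 (q ^ 5) 1 ^ 4 := fun q h0 h1 => by
    rw [euler_five h0 h1 hζ]; ring
  have h2 := proj_congr (hζ.norm'_eq_one hl) 5 a h h0 h1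
  rw [proj_mul hl hζ a (fun x => 5 * pochInf x x ^ 3) _ h0, proj_add, proj_add, proj_add, proj_add,
    proj_pow_mul hl hζ a 0 (fun x => thetaPow 5 x 2 ^ 4) h0,
    proj_pow_mul hl hζ a 1 (fun x => -2 * thetaPow 5 x 2 ^ 3 * thetaPow 5 x 1) h0,
    proj_pow_mul hl hζ a 2 (fun x => -thetaPow 5 x 2 ^ 2 * thetaPow 5 x 1 ^ 2) h0,
    proj_pow_mul hl hζ a 3 (fun x => 2 * thetaPow 5 x 2 * thetaPow 5 x 1 ^ 3) h0,
    proj_pow_mul hl hζ a 4 (fun x => thetaPow 5 x 1 ^ 4) h0] at h2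
  rw [h2]
  push_cast
  congr 1
  · congr 1
    · congr 1
      · congr 1
        · split_ifs <;> ring
        · split_ifs <;> ring
      · split_ifs <;> ring
    · split_ifs <;> ring
  · split_ifs <;> ring

/-- Elimination of X between the equations with theta factors at ζ and ζ². The surviving factor qY
shifts classes by one. -/
theorem proj_fullSeries_one_five (h0 : q ≠ 0) (h1 : ‖q‖ < 1) {ζ : ℂ} (hζ : IsPrimitiveRoot ζ 5) (a : ℤ) :
    -5 * (1 + 2 * ζ + 2 * ζ ^ 4) * (1 + ζ) * (1 + ζ ^ 2) * q * thetaPow 5 (q ^ 5) 1 *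
      (proj ζ 5 (a - 1) (fun q => anSeries 1 ζ (ζ ^ 2) q) q +
        proj ζ 5 (a - 1) (fun q => anPrefactor ζ (ζ ^ 2) q) q) =
      (3 + ζ + ζ ^ 4) * (1 + ζ ^ 2) * proj ζ 5 a (fun q => phiF q ζ (ζ ^ 2)) q -
        (2 - ζ - ζ ^ 4) * (1 + ζ) * proj ζ 5 a (fun q => phiF q (ζ ^ 2) ζ) q := by
  have hl : (5 : ℕ) ≠ 0 := by norm_num
  have hn : ‖ζ‖ = 1 := hζ.norm'_eq_one hl
  have hn2 : ‖ζ ^ 2‖ = 1 := by simp [hn]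
  have hw : IsPrimitiveRoot (ζ ^ 2) 5 := hζ.pow_of_coprime 2 (by norm_num)
  have hg := geom_five hζ
  have h : ∀ q : ℂ, q ≠ 0 → ‖q‖ < 1 →
      q ^ 1 * (-5 * (1 + 2 * ζ + 2 * ζ ^ 4) * (1 + ζ) * (1 + ζ ^ 2) * thetaPow 5 (q ^ 5) 1) *
        (anSeries 1 ζ (ζ ^ 2) q + anPrefactor ζ (ζ ^ 2) q) =
      (3 + ζ + ζ ^ 4) * (1 + ζ ^ 2) * phiF q ζ (ζ ^ 2) -
        (2 - ζ - ζ ^ 4) * (1 + ζ) * phiF q (ζ ^ 2) ζ := fun q h0 h1 => by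
    rw [← thetaR_mul_anSeries_one h0 h1 hn hn2 (hζ.ne_one (by norm_num)) (hw.ne_one (by norm_num))
      (one_add_ne_zero_of_isPrimitiveRoot (by norm_num) hζ),
      ← thetaR_mul_anSeries_one h0 h1 hn2 hn (hw.ne_one (by norm_num)) (hζ.ne_one (by norm_num))
      (one_add_ne_zero_of_isPrimitiveRoot (by norm_num) hw), ← fullSeries, ← fullSeries,
      fullSeries_symm 1 (ζ ^ 2), thetaR_five h0 h1 hζ, thetaR_five h0 h1 hw]
    generalize thetaPow 5 (q ^ 5) 1 = Y
    generalize thetaPow 5 (q ^ 5) 2 = X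
    generalize fullSeries 1 ζ (ζ ^ 2) q = S
    clear hw hn2 hn hζ h0 h1
    grind
  have h2 := proj_congr hn 5 a h h0 h1
  rw [proj_pow_mul_mul hl hζ a 1 (fun x => -5 * (1 + 2 * ζ + 2 * ζ ^ 4) * (1 + ζ) * (1 + ζ ^ 2) *
    thetaPow 5 x 1) _ h0, proj_add, proj_sub, proj_const_mul, proj_const_mul, Nat.cast_one] at h2
  linear_combination h2

/-- Elimination of Y instead. The factor X carries no power of q, so classes are not shifted. -/
theorem proj_fullSeries_two_five (h0 : q ≠ 0) (h1 : ‖q‖ < 1) {ζ : ℂ} (hζ : IsPrimitiveRoot ζ 5) (a : ℤ) :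
    5 * (1 + ζ) * (1 + ζ ^ 2) * thetaPow 5 (q ^ 5) 2 *
      (proj ζ 5 a (fun q => anSeries 2 ζ (ζ ^ 2) q) q +
        proj ζ 5 a (fun q => anPrefactor ζ (ζ ^ 2) q) q) =
      (1 + ζ ^ 2) * proj ζ 5 a (fun q => phiG q ζ (ζ ^ 2)) q +
        (1 + ζ) * proj ζ 5 a (fun q => phiG q (ζ ^ 2) ζ) q := by
  have hl : (5 : ℕ) ≠ 0 := by norm_num
  have hn : ‖ζ‖ = 1 := hζ.norm'_eq_one hl
  have hn2 : ‖ζ ^ 2‖ = 1 := by simp [hn]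
  have hw : IsPrimitiveRoot (ζ ^ 2) 5 := hζ.pow_of_coprime 2 (by norm_num)
  have hg := geom_five hζ
  have h : ∀ q : ℂ, q ≠ 0 → ‖q‖ < 1 →
      5 * (1 + ζ) * (1 + ζ ^ 2) * thetaPow 5 (q ^ 5) 2 *
        (anSeries 2 ζ (ζ ^ 2) q + anPrefactor ζ (ζ ^ 2) q) =
      (1 + ζ ^ 2) * phiG q ζ (ζ ^ 2) + (1 + ζ) * phiG q (ζ ^ 2) ζ := fun q h0 h1 => by
    rw [← thetaR_mul_anSeries_two h0 h1 hn hn2 (hζ.ne_one (by norm_num)) (hw.ne_one (by norm_num))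
      (one_add_ne_zero_of_isPrimitiveRoot (by norm_num) hζ),
      ← thetaR_mul_anSeries_two h0 h1 hn2 hn (hw.ne_one (by norm_num)) (hζ.ne_one (by norm_num))
      (one_add_ne_zero_of_isPrimitiveRoot (by norm_num) hw), ← fullSeries, ← fullSeries,
      fullSeries_symm 2 (ζ ^ 2), thetaR_five h0 h1 hζ, thetaR_five h0 h1 hw]
    generalize thetaPow 5 (q ^ 5) 1 = Y
    generalize thetaPow 5 (q ^ 5) 2 = X
    generalize fullSeries 2 ζ (ζ ^ 2) q = S
    clear hw hn2 hn hζ h0 h1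
    grind
  have h2 := proj_congr hn 5 a h h0 h1
  rw [proj_mul hl hζ a (fun x => 5 * (1 + ζ) * (1 + ζ ^ 2) * thetaPow 5 x 2) _ h0,
    proj_add, proj_add, proj_const_mul, proj_const_mul] at h2
  linear_combination h2

/-- The nonvanishing facts shared by the four residue classes. -/
theorem nonvanishing_five (h0 : q ≠ 0) (h1 : ‖q‖ < 1) {ζ : ℂ} (hζ : IsPrimitiveRoot ζ 5) :
    1 + ζ ≠ 0 ∧ 1 + ζ ^ 2 ≠ 0 ∧ 1 + 2 * ζ + 2 * ζ ^ 4 ≠ 0 ∧ thetaPow 5 (q ^ 5) 1 ≠ 0 ∧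
      thetaPow 5 (q ^ 5) 2 ≠ 0 ∧ pochInf (q ^ 5) (q ^ 5) ≠ 0 ∧
      pochInf (q ^ 5) (q ^ 5) * pochInf ((q ^ 5) ^ 5) ((q ^ 5) ^ 5) =
        thetaPow 5 (q ^ 5) 2 * thetaPow 5 (q ^ 5) 1 := by
  have hQ : q ^ 5 ≠ 0 := pow_ne_zero _ h0
  have hQ1 : ‖q ^ 5‖ < 1 := norm_pow_lt_one h1 (by norm_num)
  refine ⟨one_add_ne_zero_of_isPrimitiveRoot (by norm_num) hζ,
    one_add_ne_zero_of_isPrimitiveRoot (by norm_num) (hζ.pow_of_coprime 2 (by norm_num)), ?_,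
    thetaPow_ne_zero (by norm_num) hQ hQ1 (by norm_num), thetaPow_ne_zero (by norm_num) hQ hQ1 (by norm_num),
    pochInf_self_ne_zero hQ1, euler_fifth hQ hQ1⟩
  intro h
  have hg := geom_five hζ
  clear hQ hQ1 hζ h0 h1
  have : (5 : ℂ) = 0 := by grind
  norm_num at this

theorem coeff_F_five_zero {ζ : ℂ} (hζ : IsPrimitiveRoot ζ 5) (n : ℕ) :
    PowerSeries.coeff (5 * n + 0) (F (ζ ^ 2) (ζ ^ 2)⁻¹ ζ) = 0 := by
  refine coeff_termSum_eq_zero le_rfl (by norm_num) hζ 0 ?_ n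
  have hz := hζ.pow_eq_one
  have hw : IsPrimitiveRoot (ζ ^ 2) 5 := hζ.pow_of_coprime 2 (by norm_num)
  filter_upwards [eventually_small_ne_zero] with q ⟨h0, h1⟩
  obtain ⟨n1, n2, n3, nY, nX, nE, hE⟩ := nonvanishing_five h0 h1 hζ
  have A1 := proj_phiF (h := 2) hζ hz hw.pow_eq_one (hw.ne_one (by norm_num)) _ (factor_five hw) 1 h0 h1
  have A2 := proj_phiF (h := 2) hζ hw.pow_eq_one hz (hζ.ne_one (by norm_num)) _ (factor_five hζ) 1 h0 h1
  have B := proj_anPrefactor_five h0 h1 hζ 0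
  have C := proj_fullSeries_one_five h0 h1 hζ 1
  have D := lser_five_first h0 h1
  have i1 : ζ⁻¹ = ζ ^ 4 := inv_eq_of_mul_eq_one_right (by linear_combination hz)
  have i2 : (ζ ^ 2)⁻¹ = ζ ^ 3 := inv_eq_of_mul_eq_one_right (by linear_combination hz)
  have hg := geom_five hζ
  norm_num [Finset.sum_range_succ, tri, numFive] at A1 A2 B C ⊢
  rw [A1, A2] at C
  simp only [i1, i2] at C
  clear A1 A2 hζ hw i1 i2
  generalize thetaPow 5 (q ^ 5) 1 = Y at *
  generalize thetaPow 5 (q ^ 5) 2 = X at *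
  generalize pochInf (q ^ 5) (q ^ 5) = E at *
  generalize pochInf ((q ^ 5) ^ 5) ((q ^ 5) ^ 5) = J at *
  generalize lser 2 4 (-1) q = L at *
  generalize lser 2 4 2 q = M at *
  generalize proj ζ 5 0 (anSeries 1 ζ (ζ ^ 2)) q = f at *
  generalize proj ζ 5 0 (fun q => anPrefactor ζ (ζ ^ 2) q) q = p at *
  -- `L` and `M` are the only Appell series in this class, and the elimination makes their
  -- coefficients equal.
  have G : q * Y * (f + p) = L + M := by
    refine mul_left_cancel₀ (mul_ne_zero (mul_ne_zero n3 n1) n2) ?_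
    clear * - hg C
    grind
  refine mul_left_cancel₀ (mul_ne_zero (mul_ne_zero h0 (pow_ne_zero 3 nY)) (pow_ne_zero 3 nE)) ?_
  -- The cofactor of `hE` is that of EJ - XY in (EJ)³ - (XY)³: it turns the E³J³ from `D` into the
  -- X³Y³ that the class of the added term provides.
  linear_combination Y ^ 2 * E ^ 3 * G + E ^ 3 * D - q * Y ^ 3 / 5 * B + q * X * (E ^ 2 * J ^ 2 + E * J * X * Y + X ^ 2 * Y ^ 2) * hE

theorem coeff_F_five_three {ζ : ℂ} (hζ : IsPrimitiveRoot ζ 5) (n : ℕ) :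
    PowerSeries.coeff (5 * n + 3) (F (ζ ^ 2) (ζ ^ 2)⁻¹ ζ) = 0 := by
  refine coeff_termSum_eq_zero le_rfl (by norm_num) hζ 3 ?_ n
  have hz := hζ.pow_eq_one
  have hw : IsPrimitiveRoot (ζ ^ 2) 5 := hζ.pow_of_coprime 2 (by norm_num)
  filter_upwards [eventually_small_ne_zero] with q ⟨h0, h1⟩
  obtain ⟨n1, n2, n3, nY, nX, nE, hE⟩ := nonvanishing_five h0 h1 hζ
  have A1 := proj_phiF (h := 2) hζ hz hw.pow_eq_one (hw.ne_one (by norm_num)) _ (factor_five hw) 4 h0 h1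
  have A2 := proj_phiF (h := 2) hζ hw.pow_eq_one hz (hζ.ne_one (by norm_num)) _ (factor_five hζ) 4 h0 h1
  have B := proj_anPrefactor_five h0 h1 hζ 3
  have C := proj_fullSeries_one_five h0 h1 hζ 4
  have D := lser_five_second h0 h1
  -- Reflection reduces the four Appell series of this class to two.
  have eN1 : lser 2 1 (-1) q = -lser 2 3 1 q := by simpa using lser_neg h0 2 1 1
  have eN2 : lser 2 1 (-2) q = -lser 2 3 2 q := by simpa using lser_neg h0 2 1 2
  have i1 : ζ⁻¹ = ζ ^ 4 := inv_eq_of_mul_eq_one_right (by linear_combination hz)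
  have i2 : (ζ ^ 2)⁻¹ = ζ ^ 3 := inv_eq_of_mul_eq_one_right (by linear_combination hz)
  have i3 : ((ζ ^ 2) ^ 2)⁻¹ = ζ := inv_eq_of_mul_eq_one_right (by linear_combination hz)
  have hg := geom_five hζ
  norm_num [Finset.sum_range_succ, tri, numFive] at A1 A2 B C ⊢
  rw [A1, A2] at C
  simp only [i1, i2, i3, eN1, eN2] at C
  clear A1 A2 hζ hw i1 i2 i3
  generalize thetaPow 5 (q ^ 5) 1 = Y at *
  generalize thetaPow 5 (q ^ 5) 2 = X at *
  generalize pochInf (q ^ 5) (q ^ 5) = E at *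
  generalize pochInf ((q ^ 5) ^ 5) ((q ^ 5) ^ 5) = J at *
  generalize lser 2 3 1 q = L at *
  generalize lser 2 3 2 q = M at *
  generalize proj ζ 5 3 (anSeries 1 ζ (ζ ^ 2)) q = f at *
  generalize proj ζ 5 3 (fun q => anPrefactor ζ (ζ ^ 2) q) q = p at *
  have G : q * Y * (f + p) = -2 * (L + M) := by
    refine mul_left_cancel₀ (mul_ne_zero (mul_ne_zero n3 n1) n2) ?_
    clear * - hg C
    grind
  refine mul_left_cancel₀ (mul_ne_zero (mul_ne_zero (mul_ne_zero h0 nY) (pow_ne_zero 2 nX)) (pow_ne_zero 3 nE)) ?_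
  linear_combination X ^ 2 * E ^ 3 * G - 2 * E ^ 3 * D - q * Y * X ^ 2 / 5 * B + 2 * q ^ 4 * Y * (E ^ 2 * J ^ 2 + E * J * X * Y + X ^ 2 * Y ^ 2) * hE

theorem coeff_G_five_one {ζ : ℂ} (hζ : IsPrimitiveRoot ζ 5) (n : ℕ) :
    PowerSeries.coeff (5 * n + 1) (G (ζ ^ 2) (ζ ^ 2)⁻¹ ζ) = 0 := by
  refine coeff_termSum_eq_zero one_le_two (by norm_num) hζ 1 ?_ n
  have hz := hζ.pow_eq_one
  have hw : IsPrimitiveRoot (ζ ^ 2) 5 := hζ.pow_of_coprime 2 (by norm_num)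
  filter_upwards [eventually_small_ne_zero] with q ⟨h0, h1⟩
  obtain ⟨n1, n2, n3, nY, nX, nE, hE⟩ := nonvanishing_five h0 h1 hζ
  have A1 := proj_phiG (h := 2) hζ hz hw.pow_eq_one (hw.ne_one (by norm_num)) _ (factor_five hw) 1 h0 h1
  have A2 := proj_phiG (h := 2) hζ hw.pow_eq_one hz (hζ.ne_one (by norm_num)) _ (factor_five hζ) 1 h0 h1
  have B := proj_anPrefactor_five h0 h1 hζ 1
  have C := proj_fullSeries_two_five h0 h1 hζ 1
  have D := lser_five_first h0 h1
  have eN1 : lser 2 0 (-2) q = -lser 2 4 2 q := by simpa using lser_neg h0 2 0 2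
  have eN2 : lser 2 0 1 q = -lser 2 4 (-1) q := by simpa using lser_neg h0 2 0 (-1)
  have i2 : (ζ ^ 2)⁻¹ = ζ ^ 3 := inv_eq_of_mul_eq_one_right (by linear_combination hz)
  have i3 : ((ζ ^ 2) ^ 2)⁻¹ = ζ := inv_eq_of_mul_eq_one_right (by linear_combination hz)
  have hg := geom_five hζ
  norm_num [Finset.sum_range_succ, tri, numFive] at A1 A2 B C ⊢
  rw [A1, A2] at C
  simp only [i2, i3, eN1, eN2] at C
  clear A1 A2 hζ hw i2 i3
  generalize thetaPow 5 (q ^ 5) 1 = Y at *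
  generalize thetaPow 5 (q ^ 5) 2 = X at *
  generalize pochInf (q ^ 5) (q ^ 5) = E at *
  generalize pochInf ((q ^ 5) ^ 5) ((q ^ 5) ^ 5) = J at *
  generalize lser 2 4 (-1) q = L at *
  generalize lser 2 4 2 q = M at *
  generalize proj ζ 5 1 (anSeries 2 ζ (ζ ^ 2)) q = f at *
  generalize proj ζ 5 1 (fun q => anPrefactor ζ (ζ ^ 2) q) q = p at *
  have G : X * (f + p) = -2 * (L + M) := by
    refine mul_left_cancel₀ (mul_ne_zero n1 n2) ?_
    clear * - hg C
    grind
  refine mul_left_cancel₀ (mul_ne_zero (mul_ne_zero nX (pow_ne_zero 2 nY)) (pow_ne_zero 3 nE)) ?_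
  linear_combination Y ^ 2 * E ^ 3 * G - 2 * E ^ 3 * D - X * Y ^ 2 / 5 * B - 2 * q * X * (E ^ 2 * J ^ 2 + E * J * X * Y + X ^ 2 * Y ^ 2) * hE

theorem coeff_G_five_four {ζ : ℂ} (hζ : IsPrimitiveRoot ζ 5) (n : ℕ) :
    PowerSeries.coeff (5 * n + 4) (G (ζ ^ 2) (ζ ^ 2)⁻¹ ζ) = 0 := by
  refine coeff_termSum_eq_zero one_le_two (by norm_num) hζ 4 ?_ n
  have hz := hζ.pow_eq_one
  have hw : IsPrimitiveRoot (ζ ^ 2) 5 := hζ.pow_of_coprime 2 (by norm_num)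
  filter_upwards [eventually_small_ne_zero] with q ⟨h0, h1⟩
  obtain ⟨n1, n2, n3, nY, nX, nE, hE⟩ := nonvanishing_five h0 h1 hζ
  have A1 := proj_phiG (h := 2) hζ hz hw.pow_eq_one (hw.ne_one (by norm_num)) _ (factor_five hw) 4 h0 h1
  have A2 := proj_phiG (h := 2) hζ hw.pow_eq_one hz (hζ.ne_one (by norm_num)) _ (factor_five hζ) 4 h0 h1
  have B := proj_anPrefactor_five h0 h1 hζ 4
  have C := proj_fullSeries_two_five h0 h1 hζ 4
  have D := lser_five_second h0 h1
  have eN1 : lser 2 1 (-1) q = -lser 2 3 1 q := by simpa using lser_neg h0 2 1 1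
  have eN2 : lser 2 1 (-2) q = -lser 2 3 2 q := by simpa using lser_neg h0 2 1 2
  have i1 : ζ⁻¹ = ζ ^ 4 := inv_eq_of_mul_eq_one_right (by linear_combination hz)
  have i2 : (ζ ^ 2)⁻¹ = ζ ^ 3 := inv_eq_of_mul_eq_one_right (by linear_combination hz)
  have i3 : ((ζ ^ 2) ^ 2)⁻¹ = ζ := inv_eq_of_mul_eq_one_right (by linear_combination hz)
  have hg := geom_five hζ
  norm_num [Finset.sum_range_succ, tri, numFive] at A1 A2 B C ⊢
  rw [A1, A2] at C
  simp only [i1, i2, i3, eN1, eN2] at C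
  clear A1 A2 hζ hw i1 i2 i3
  generalize thetaPow 5 (q ^ 5) 1 = Y at *
  generalize thetaPow 5 (q ^ 5) 2 = X at *
  generalize pochInf (q ^ 5) (q ^ 5) = E at *
  generalize pochInf ((q ^ 5) ^ 5) ((q ^ 5) ^ 5) = J at *
  generalize lser 2 3 1 q = L at *
  generalize lser 2 3 2 q = M at *
  generalize proj ζ 5 4 (anSeries 2 ζ (ζ ^ 2)) q = f at *
  generalize proj ζ 5 4 (fun q => anPrefactor ζ (ζ ^ 2) q) q = p at *
  have G : X * (f + p) = -(L + M) := by
    refine mul_left_cancel₀ (mul_ne_zero n1 n2) ?_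
    clear * - hg C
    grind
  refine mul_left_cancel₀ (mul_ne_zero (pow_ne_zero 3 nX) (pow_ne_zero 3 nE)) ?_
  linear_combination X ^ 2 * E ^ 3 * G - E ^ 3 * D - X ^ 3 / 5 * B + q ^ 4 * Y * (E ^ 2 * J ^ 2 + E * J * X * Y + X ^ 2 * Y ^ 2) * hE

end Five

end RankQuadruples

namespace RankQuadruples

open Filter Topology

/-! ### Modulus 7: theta functions and the Klein quartic -/

section Seven

variable {q : ℂ}

theorem geom_seven {ζ : ℂ} (hζ : IsPrimitiveRoot ζ 7) :
    1 + ζ + ζ ^ 2 + ζ ^ 3 + ζ ^ 4 + ζ ^ 5 + ζ ^ 6 = 0 := by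
  simpa [Finset.sum_range_succ] using hζ.geom_sum_eq_zero (by norm_num)

/-- Coefficients of `(1 - x^7) / ((1 - w x) (1 - x / w))`, where `w` is a primitive seventh root of
unity and `c = w + 1 / w`. -/
noncomputable def numSeven (c : ℂ) (m : ℕ) : ℂ := [1, c, c ^ 2 - 1, 1 - c ^ 2, -c, -1].getD m 0

theorem factor_seven {w : ℂ} (hw : IsPrimitiveRoot w 7) (x : ℂ) :
    (1 - w * x) * (1 - w⁻¹ * x) * ∑ m ∈ Finset.range (2 * 3), numSeven (w + w⁻¹) m * x ^ m =
      1 - x ^ (2 * 3 + 1) := by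
  have h7 := hw.pow_eq_one
  have e : w * w⁻¹ = 1 := mul_inv_cancel₀ (hw.ne_zero (by norm_num))
  have hc : (w + w⁻¹) ^ 3 + (w + w⁻¹) ^ 2 - 2 * (w + w⁻¹) - 1 = 0 := by
    have hg := geom_seven hw
    rw [show w⁻¹ = w ^ 6 from inv_eq_of_mul_eq_one_right (by linear_combination h7)]
    clear * - hg
    grind
  simp [Finset.sum_range_succ, numSeven]
  generalize w⁻¹ = w' at *
  have hs : (1 - w * x) * (1 - w' * x) = 1 - (w + w') * x + x ^ 2 := by linear_combination x ^ 2 * e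
  rw [hs]
  linear_combination (-x ^ 3 + x ^ 4) * hc

theorem thetaR_seven (h0 : q ≠ 0) (h1 : ‖q‖ < 1) {z : ℂ} (hz : IsPrimitiveRoot z 7) :
    thetaR q z = (2 - (z + z ^ 6)) * thetaPow 7 (q ^ 7) 3 +
      ((z ^ 2 + z ^ 5) - (z + z ^ 6)) * q * thetaPow 7 (q ^ 7) 2 +
      ((z ^ 2 + z ^ 5) - (z ^ 3 + z ^ 4)) * q ^ 3 * thetaPow 7 (q ^ 7) 1 := by
  have h7 := hz.pow_eq_one
  have hQ : q ^ 7 ≠ 0 := pow_ne_zero _ h0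
  have e1 : z⁻¹ = z ^ 6 := inv_eq_of_mul_eq_one_right (by linear_combination h7)
  have e1' : (z ^ 2)⁻¹ = z ^ 5 := inv_eq_of_mul_eq_one_right (by linear_combination h7)
  have e2 := thetaPow_sub (l := 7) hQ 1
  have e3 := thetaPow_sub (l := 7) hQ 2
  have e4 := thetaPow_sub (l := 7) hQ 3
  have e5 : thetaPow 7 (q ^ 7) 0 = 0 := by
    rw [thetaPow, zpow_zero, theta_one (pow_ne_zero _ hQ)]
  have h := theta_dissect_pow (h := 3) h0 h1 (hz.ne_zero (by norm_num)) h7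
  norm_num [Finset.sum_range_succ, tri] at h e2 e3 e4
  rw [e2, e3, e4, e5, e1, e1'] at h
  rw [thetaR, h, e1]
  have hg := geom_seven hz
  generalize thetaPow 7 (q ^ 7) 1 = Z at *
  generalize thetaPow 7 (q ^ 7) 2 = Y at *
  generalize thetaPow 7 (q ^ 7) 3 = X at *
  clear * - hg
  grind

/-- Expressions invariant under z ↦ 1/z are polynomials in c = z + z⁶, which satisfies a cubic; this
keeps the later identities small. -/
theorem root_relations_seven {z : ℂ} (hz : IsPrimitiveRoot z 7) :
    z ^ 3 + z ^ 4 = -1 - (z + z ^ 6) - (z ^ 2 + z ^ 5) ∧ z ^ 2 + z ^ 5 = (z + z ^ 6) ^ 2 - 2 ∧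
      (z + z ^ 6) ^ 3 + (z + z ^ 6) ^ 2 - 2 * (z + z ^ 6) - 1 = 0 := by
  have hg := geom_seven hz
  clear hz
  refine ⟨?_, ?_, ?_⟩ <;> grind

theorem thetaR_square_seven (h0 : q ≠ 0) (h1 : ‖q‖ < 1) {z : ℂ} (hz : IsPrimitiveRoot z 7) :
    thetaR q (z ^ 2) = (2 - (z ^ 2 + z ^ 5)) * thetaPow 7 (q ^ 7) 3 +
      ((z ^ 3 + z ^ 4) - (z ^ 2 + z ^ 5)) * q * thetaPow 7 (q ^ 7) 2 +
      ((z ^ 3 + z ^ 4) - (z + z ^ 6)) * q ^ 3 * thetaPow 7 (q ^ 7) 1 := by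
  rw [thetaR_seven h0 h1 (hz.pow_of_coprime 2 (by norm_num))]
  have h7 := hz.pow_eq_one
  have e : z ^ 12 = z ^ 5 ∧ z ^ 10 = z ^ 3 ∧ z ^ 8 = z :=
    ⟨by linear_combination z ^ 5 * h7, by linear_combination z ^ 3 * h7, by linear_combination z * h7⟩
  simp only [← pow_mul, Nat.reduceMul, e]
  ring

theorem thetaR_cube_seven (h0 : q ≠ 0) (h1 : ‖q‖ < 1) {z : ℂ} (hz : IsPrimitiveRoot z 7) :
    thetaR q (z ^ 3) = (2 - (z ^ 3 + z ^ 4)) * thetaPow 7 (q ^ 7) 3 +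
      ((z + z ^ 6) - (z ^ 3 + z ^ 4)) * q * thetaPow 7 (q ^ 7) 2 +
      ((z + z ^ 6) - (z ^ 2 + z ^ 5)) * q ^ 3 * thetaPow 7 (q ^ 7) 1 := by
  rw [thetaR_seven h0 h1 (hz.pow_of_coprime 3 (by norm_num))]
  have h7 := hz.pow_eq_one
  have e : z ^ 18 = z ^ 4 ∧ z ^ 15 = z ∧ z ^ 9 = z ^ 2 ∧ z ^ 12 = z ^ 5 :=
    ⟨by linear_combination (z ^ 4 + z ^ 11) * h7, by linear_combination (z + z ^ 8) * h7,
      by linear_combination z ^ 2 * h7, by linear_combination z ^ 5 * h7⟩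
  simp only [← pow_mul, Nat.reduceMul, e]
  ring

/-- Up to a multiple of the Klein quartic form, which `klein_quartic` shows to vanish, the product
is 7 times a square. This makes a square root, and so a dissection of (q)_∞ itself, accessible. -/
theorem thetaR_prod_seven (h0 : q ≠ 0) (h1 : ‖q‖ < 1) {z : ℂ} (hz : IsPrimitiveRoot z 7) :
    thetaR q z * thetaR q (z ^ 2) * thetaR q (z ^ 3) *
      (thetaPow 7 (q ^ 7) 3 * thetaPow 7 (q ^ 7) 2 * thetaPow 7 (q ^ 7) 1) =
      7 * (thetaPow 7 (q ^ 7) 3 * thetaPow 7 (q ^ 7) 2 ^ 2 -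
        q * thetaPow 7 (q ^ 7) 3 ^ 2 * thetaPow 7 (q ^ 7) 1 -
        q ^ 2 * thetaPow 7 (q ^ 7) 3 * thetaPow 7 (q ^ 7) 2 * thetaPow 7 (q ^ 7) 1 +
        q ^ 5 * thetaPow 7 (q ^ 7) 2 * thetaPow 7 (q ^ 7) 1 ^ 2) ^ 2 +
      7 * (thetaPow 7 (q ^ 7) 3 * thetaPow 7 (q ^ 7) 2 -
        q ^ 3 * thetaPow 7 (q ^ 7) 2 * thetaPow 7 (q ^ 7) 1 -
        q ^ 2 * thetaPow 7 (q ^ 7) 3 * thetaPow 7 (q ^ 7) 1) *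
      (thetaPow 7 (q ^ 7) 3 ^ 3 * thetaPow 7 (q ^ 7) 1 -
        thetaPow 7 (q ^ 7) 3 * thetaPow 7 (q ^ 7) 2 ^ 3 +
        q ^ 7 * thetaPow 7 (q ^ 7) 2 * thetaPow 7 (q ^ 7) 1 ^ 3) := by
  rw [thetaR_seven h0 h1 hz, thetaR_square_seven h0 h1 hz, thetaR_cube_seven h0 h1 hz]
  obtain ⟨r3, r2, r1⟩ := root_relations_seven hz
  rw [r3, r2]
  generalize z + z ^ 6 = c at *
  generalize thetaPow 7 (q ^ 7) 1 = Z at *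
  generalize thetaPow 7 (q ^ 7) 2 = Y at *
  generalize thetaPow 7 (q ^ 7) 3 = X at *
  clear * - r1
  grind

/-- Three instances of the Appell transformation involve the same three Appell sums, two in each. A
combination with theta coefficients cancels the sums and leaves this relation times (q⁷;q⁷)_∞³. -/
theorem klein_quartic (h0 : q ≠ 0) (h1 : ‖q‖ < 1) :
    thetaPow 7 q 3 ^ 3 * thetaPow 7 q 1 - thetaPow 7 q 3 * thetaPow 7 q 2 ^ 3 +
      q * thetaPow 7 q 2 * thetaPow 7 q 1 ^ 3 = 0 := by
  have e1 := thetaPow_sub (l := 7) h0 1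
  have e2 := thetaPow_sub (l := 7) h0 2
  have e3 := thetaPow_sub (l := 7) h0 3
  have A := appellPow_transformation (l := 7) (by norm_num) h0 h1 (a := -2) (b := 1) (-2)
    (by norm_num) (by norm_num)
  have B := appellPow_transformation (l := 7) (by norm_num) h0 h1 (a := -1) (b := 1) (-2)
    (by norm_num) (by norm_num)
  have C := appellPow_transformation (l := 7) (by norm_num) h0 h1 (a := -2) (b := -1) (-4)
    (by norm_num) (by norm_num)
  norm_num [thetaPow_neg h0] at A B C e1 e2 e3
  rw [e2] at A
  simp only [e1, e2, e3] at A B C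
  field_simp at A B C
  have hJ : pochInf (q ^ 7) (q ^ 7) ≠ 0 := pochInf_self_ne_zero (norm_pow_lt_one h1 (by norm_num))
  refine mul_left_cancel₀ (pow_ne_zero 3 hJ) ?_
  linear_combination -thetaPow 7 q 3 * thetaPow 7 q 1 * A + thetaPow 7 q 2 ^ 2 * B -
    thetaPow 7 q 2 * thetaPow 7 q 1 * C

/-- Evaluations of the combinations of Appell sums that occur for the modulus `7`. -/
theorem appellPow_seven (h0 : q ≠ 0) (h1 : ‖q‖ < 1) :
    thetaPow 7 q 2 ^ 2 * thetaPow 7 q 1 * (appellPow 7 q (-5) (-2) - appellPow 7 q (-2) 1) =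
      -(thetaPow 7 q 3 ^ 2 * pochInf (q ^ 7) (q ^ 7) ^ 3) ∧
    thetaPow 7 q 3 * (appellPow 7 q (-4) (-2) - appellPow 7 q (-3) (-1)) =
      q * pochInf (q ^ 7) (q ^ 7) ^ 3 ∧
    thetaPow 7 q 1 * (appellPow 7 q (-6) (-3) - appellPow 7 q (-1) 2) =
      -pochInf (q ^ 7) (q ^ 7) ^ 3 ∧
    thetaPow 7 q 1 * appellPow 7 q 0 1 = pochInf (q ^ 7) (q ^ 7) ^ 3 ∧
    thetaPow 7 q 3 * appellPow 7 q 0 3 = pochInf (q ^ 7) (q ^ 7) ^ 3 := by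
  have n1 : thetaPow 7 q 1 ≠ 0 := thetaPow_ne_zero (by norm_num) h0 h1 (by norm_num)
  have n2 : thetaPow 7 q 2 ≠ 0 := thetaPow_ne_zero (by norm_num) h0 h1 (by norm_num)
  have n3 : thetaPow 7 q 3 ≠ 0 := thetaPow_ne_zero (by norm_num) h0 h1 (by norm_num)
  have e1 := thetaPow_sub (l := 7) h0 1
  have e2 := thetaPow_sub (l := 7) h0 2
  have e3 := thetaPow_sub (l := 7) h0 3
  have A := appellPow_transformation (l := 7) (by norm_num) h0 h1 (a := -2) (b := 1) (-2)
    (by norm_num) (by norm_num)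
  have D := appellPow_transformation (l := 7) (by norm_num) h0 h1 (a := -1) (b := -2) (-4)
    (by norm_num) (by norm_num)
  have E := appellPow_transformation (l := 7) (by norm_num) h0 h1 (a := 2) (b := -3) (-6)
    (by norm_num) (by norm_num)
  norm_num [thetaPow_neg h0] at A D E e1 e2 e3
  rw [e2] at A
  simp only [e1, e2, e3] at A D E
  field_simp at A D E
  have G : ∀ s : ℤ, ¬(7 : ℤ) ∣ s → thetaPow 7 q s * appellPow 7 q 0 s = pochInf (q ^ 7) (q ^ 7) ^ 3 := by
    intro s hs
    rw [thetaPow, appellPow, zpow_zero, mul_comm]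
    refine appell_one (pow_ne_zero _ h0) (norm_pow_lt_one h1 (by norm_num)) (zpow_ne_zero s h0)
      (notPower_zpow h0 h1 hs) fun h => ?_
    rw [← zpow_natCast, ← zpow_mul] at h
    exact one_sub_zpow_ne_zero h1 (n := s * (2 : ℕ)) (by omega) (by rw [h, sub_self])
  refine ⟨by linear_combination -A, ?_, ?_, G 1 (by norm_num), G 3 (by norm_num)⟩
  · linear_combination -D
  · linear_combination -E

theorem proj_sub_natCast {ζ : ℂ} {l : ℕ} (hζ : ζ ^ l = 1) (hζ0 : ζ ≠ 0) (a : ℤ) (f : ℂ → ℂ) :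
    proj ζ l (a - l) f q = proj ζ l a f q := by
  refine Finset.sum_congr rfl fun j _ => ?_
  rw [show -((a - l) * j : ℤ) = -(a * j) + l * j by ring, zpow_add₀ hζ0, zpow_mul ζ l j, zpow_natCast ζ l, hζ,
    one_zpow, mul_one]

end Seven

end RankQuadruples

namespace RankQuadruples

open Filter Topology

/-! ### Modulus 7: behaviour near q = 0 and the dissection of (q)_∞ -/

section SevenLimits

variable {q : ℂ}

theorem norm_pochInf_sub_one_le (a : ℂ) (h1 : ‖q‖ < 1) :
    ‖pochInf a q - 1‖ ≤ Real.exp (‖a‖ / (1 - ‖q‖)) - 1 := by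
  refine le_of_tendsto ((tendsto_poch a h1).sub_const 1).norm (Eventually.of_forall fun n => ?_)
  have h2 := Finset.norm_prod_one_add_sub_one_le (Finset.range n) (fun j => -(a * q ^ j))
  simp only [← sub_eq_add_neg] at h2
  refine h2.trans (sub_le_sub_right (Real.exp_le_exp.2 ?_) 1)
  calc ∑ j ∈ Finset.range n, ‖-(a * q ^ j)‖ = ‖a‖ * ∑ j ∈ Finset.range n, ‖q‖ ^ j := by
        rw [Finset.mul_sum]
        simp
    _ ≤ ‖a‖ * (1 - ‖q‖)⁻¹ := by
        gcongr
        exact (Summable.sum_le_tsum _ (fun j _ => by positivity)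
          (summable_geometric_of_lt_one (norm_nonneg q) h1)).trans_eq
            (tsum_geometric_of_lt_one (norm_nonneg q) h1)
    _ = ‖a‖ / (1 - ‖q‖) := rfl

theorem tendsto_pochInf_pow {a b : ℕ} (ha : a ≠ 0) (hb : b ≠ 0) :
    Tendsto (fun q : ℂ => pochInf (q ^ a) (q ^ b)) (𝓝[≠] 0) (𝓝 1) := by
  rw [tendsto_iff_norm_sub_tendsto_zero]
  have h : Tendsto (fun q : ℂ => Real.exp (‖q ^ a‖ / (1 - ‖q ^ b‖)) - 1) (𝓝[≠] 0) (𝓝 0) := by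
    have : ContinuousAt (fun q : ℂ => Real.exp (‖q ^ a‖ / (1 - ‖q ^ b‖)) - 1) 0 := by
      have h2 : 1 - ‖(0 : ℂ) ^ b‖ ≠ 0 := by simp [hb]
      fun_prop (disch := exact h2)
    have h3 := this.tendsto
    simp only [zero_pow ha, norm_zero, zero_div, Real.exp_zero, sub_self] at h3
    exact h3.mono_left nhdsWithin_le_nhds
  refine squeeze_zero' (Eventually.of_forall fun _ => norm_nonneg _) ?_ h
  filter_upwards [eventually_small_ne_zero] with q ⟨_, h1⟩
  exact norm_pochInf_sub_one_le _ (norm_pow_lt_one h1 hb)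

theorem tendsto_thetaPow {l k m : ℕ} (hl : l ≠ 0) (hk : k ≠ 0) (hkl : k < l) (hm : m ≠ 0) :
    Tendsto (fun q : ℂ => thetaPow l (q ^ m) k) (𝓝[≠] 0) (𝓝 1) := by
  have h := (tendsto_pochInf_pow (mul_ne_zero hm hl) (mul_ne_zero hm hl)).mul
    ((tendsto_pochInf_pow (mul_ne_zero hm hk) (mul_ne_zero hm hl)).mul
      (tendsto_pochInf_pow (mul_ne_zero hm (Nat.sub_ne_zero_of_lt hkl)) (mul_ne_zero hm hl)))
  rw [one_mul, one_mul] at h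
  refine h.congr' ?_
  filter_upwards [eventually_small_ne_zero] with q ⟨h0, h1⟩
  have hQ : q ^ m ≠ 0 := pow_ne_zero _ h0
  rw [thetaPow, zpow_natCast, theta_eq (pow_ne_zero _ hQ)
    (norm_pow_lt_one (norm_pow_lt_one h1 hm) hl) (pow_ne_zero _ hQ), div_eq_mul_inv,
    ← pow_sub₀ _ hQ hkl.le]
  simp only [pow_mul]

/-- The numerator of the dissection of `(q; q)_∞` modulo `7`. -/
noncomputable def eulerNumSeven (q : ℂ) : ℂ := thetaPow 7 (q ^ 7) 3 * thetaPow 7 (q ^ 7) 2 ^ 2 -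
  q * thetaPow 7 (q ^ 7) 3 ^ 2 * thetaPow 7 (q ^ 7) 1 -
  q ^ 2 * thetaPow 7 (q ^ 7) 3 * thetaPow 7 (q ^ 7) 2 * thetaPow 7 (q ^ 7) 1 +
  q ^ 5 * thetaPow 7 (q ^ 7) 2 * thetaPow 7 (q ^ 7) 1 ^ 2

/-- All products and theta functions here tend to 1, so the expressions tend to 2 and to `c`. The
first fixes a sign in the dissection of (q)_∞; the second is the determinant of the final linear
system up to a power of q. -/
theorem eventually_ne_zero_seven {c d : ℂ} (hc : c ≠ 0) : ∀ᶠ q in 𝓝[≠] (0 : ℂ),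
    pochInf q q * (thetaPow 7 (q ^ 7) 3 * thetaPow 7 (q ^ 7) 2 * thetaPow 7 (q ^ 7) 1) +
      pochInf ((q ^ 7) ^ 7) ((q ^ 7) ^ 7) * eulerNumSeven q ≠ 0 ∧
    c * thetaPow 7 (q ^ 7) 3 * thetaPow 7 (q ^ 7) 2 ^ 2 + d * q ^ 7 * thetaPow 7 (q ^ 7) 1 ^ 3 ≠ 0 := by
  have hX := tendsto_thetaPow (l := 7) (k := 3) (m := 7) (by norm_num) (by norm_num) (by norm_num) (by norm_num)
  have hY := tendsto_thetaPow (l := 7) (k := 2) (m := 7) (by norm_num) (by norm_num) (by norm_num) (by norm_num)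
  have hZ := tendsto_thetaPow (l := 7) (k := 1) (m := 7) (by norm_num) (by norm_num) (by norm_num) (by norm_num)
  have hE := tendsto_pochInf_pow (a := 1) (b := 1) (by norm_num) (by norm_num)
  have hJ := tendsto_pochInf_pow (a := 49) (b := 49) (by norm_num) (by norm_num)
  have hq : Tendsto (fun q : ℂ => q) (𝓝[≠] 0) (𝓝 0) := tendsto_id.mono_left nhdsWithin_le_nhds
  simp only [pow_one, Nat.cast_ofNat, Nat.cast_one] at hX hY hZ hE
  have hN := (((hX.mul (hY.pow 2)).sub ((hq.mul (hX.pow 2)).mul hZ)).sub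
    ((((hq.pow 2).mul hX).mul hY).mul hZ)).add (((hq.pow 5).mul hY).mul (hZ.pow 2))
  have h1 := (hE.mul ((hX.mul hY).mul hZ)).add (hJ.mul hN)
  have h2 := (((hX.const_mul c).mul (hY.pow 2))).add (((hq.pow 7).const_mul d).mul (hZ.pow 3))
  norm_num at h1 h2
  filter_upwards [h1.eventually_ne (by norm_num : (2 : ℂ) ≠ 0), h2.eventually_ne hc] with q h3 h4
  simp only [← pow_mul, Nat.reduceMul, eulerNumSeven]
  exact ⟨h3, h4⟩

theorem euler_mul_thetaPow_seven (h0 : q ≠ 0) (h1 : ‖q‖ < 1)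
    (hne : pochInf q q * (thetaPow 7 (q ^ 7) 3 * thetaPow 7 (q ^ 7) 2 * thetaPow 7 (q ^ 7) 1) +
      pochInf ((q ^ 7) ^ 7) ((q ^ 7) ^ 7) * eulerNumSeven q ≠ 0) {ζ : ℂ} (hζ : IsPrimitiveRoot ζ 7) :
    7 * (thetaPow 7 (q ^ 7) 3 * thetaPow 7 (q ^ 7) 2 * thetaPow 7 (q ^ 7) 1) ^ 2 *
      anPrefactor ζ (ζ ^ 2) q =
        pochInf ((q ^ 7) ^ 7) ((q ^ 7) ^ 7) ^ 3 * eulerNumSeven q * thetaR q (ζ ^ 3) := by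
  have hn : ‖ζ‖ = 1 := hζ.norm'_eq_one (by norm_num)
  have hQ : q ^ 7 ≠ 0 := pow_ne_zero _ h0
  have hQ1 : ‖q ^ 7‖ < 1 := norm_pow_lt_one h1 (by norm_num)
  have hE := pochInf_self_ne_zero h1
  have hJ : pochInf ((q ^ 7) ^ 7) ((q ^ 7) ^ 7) ≠ 0 :=
    pochInf_self_ne_zero (norm_pow_lt_one hQ1 (by norm_num))
  have hP := pochInf_self_mul_prod_thetaR (h := 3) hζ h0 h1
  have hS := pochInf_split_two_mul_add_one hQ hQ1 3
  have hK := klein_quartic hQ hQ1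
  have hT := thetaR_prod_seven h0 h1 hζ
  have hA := thetaR_mul_anPrefactor h0 h1 hn (w := ζ ^ 2) (by simp [hn]) (hζ.ne_one (by norm_num))
    (sq_ne_one_of_isPrimitiveRoot (by norm_num) hζ)
  norm_num [Finset.prod_range_succ] at hP hS
  rw [hK, mul_zero, add_zero, ← eulerNumSeven] at hT
  generalize hEE : pochInf q q = E at *
  generalize pochInf ((q ^ 7) ^ 7) ((q ^ 7) ^ 7) = J at *
  generalize pochInf (q ^ 7) (q ^ 7) = M at *
  generalize thetaPow 7 (q ^ 7) 1 = Z at *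
  generalize thetaPow 7 (q ^ 7) 2 = Y at *
  generalize thetaPow 7 (q ^ 7) 3 = X at *
  generalize eulerNumSeven q = N at *
  generalize thetaR q ζ = A1 at *
  generalize thetaR q (ζ ^ 2) = A2 at *
  generalize thetaR q (ζ ^ 3) = A3 at *
  generalize anPrefactor ζ (ζ ^ 2) q = p at *
  have hS' : J ^ 2 * M = X * Y * Z := mul_left_cancel₀ hJ (by linear_combination hS)
  have hP' : A1 * A2 * A3 = 7 * E ^ 2 * M := mul_left_cancel₀ hE (by linear_combination hP)
  -- The equality of the squares of E·XYZ and J·N, arranged so that `hne` cancels the factor with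
  -- the wrong sign.
  have h2 : (E * (X * Y * Z) + J * N) * (E * (X * Y * Z)) = (E * (X * Y * Z) + J * N) * (J * N) := by
    linear_combination -E ^ 2 * (X * Y * Z) * hS' + J ^ 2 / 7 * hT - J ^ 2 / 7 * (X * Y * Z) * hP'
  have h3 := mul_left_cancel₀ hne h2
  refine mul_left_cancel₀ (pow_ne_zero 2 hE) ?_
  linear_combination (-7 * E ^ 2 * p * X * Y * Z) * hS' - J ^ 2 * (X * Y * Z) * p * hP' +
    J ^ 2 * (X * Y * Z) * A3 * hA + J ^ 2 * A3 * E ^ 2 * h3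

end SevenLimits

end RankQuadruples

namespace RankQuadruples

open Filter Topology

/-! ### Modulus 7: residue classes -/

section SevenClasses

variable {q : ℂ}

theorem lser_seven (h0 : q ≠ 0) :
    lser 3 6 (-1) q = q * appellPow 7 (q ^ 7) (-2) 1 ∧
    lser 3 6 2 q = -(q * appellPow 7 (q ^ 7) (-5) (-2)) ∧
    lser 3 3 (-3) q = -lser 3 3 3 q ∧
    lser 3 6 (-3) q = q ^ 6 * appellPow 7 (q ^ 7) 0 3 ∧
    lser 3 1 (-2) q = q⁻¹ * appellPow 7 (q ^ 7) (-4) (-2) ∧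
    lser 3 5 2 q = -(q⁻¹ * appellPow 7 (q ^ 7) (-4) (-2)) ∧
    lser 3 1 (-1) q = -(q⁻¹ * appellPow 7 (q ^ 7) (-3) (-1)) ∧
    lser 3 5 1 q = q⁻¹ * appellPow 7 (q ^ 7) (-3) (-1) ∧
    lser 3 6 (-2) q = -(q ^ 3 * appellPow 7 (q ^ 7) (-1) 2) ∧
    lser 3 6 3 q = q ^ 3 * appellPow 7 (q ^ 7) (-6) (-3) ∧
    lser 3 4 (-1) q = q ^ 3 * appellPow 7 (q ^ 7) 0 1 ∧
    lser 3 2 1 q = -(q ^ 3 * appellPow 7 (q ^ 7) 0 1) := by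
  have hQ : q ^ 7 ≠ 0 := pow_ne_zero _ h0
  have a1 := appellPow_neg (l := 7) hQ (-2) 1
  have a2 := appellPow_neg (l := 7) hQ (-5) (-2)
  have a3 := appellPow_neg (l := 7) hQ (-4) (-2)
  have a4 := appellPow_neg (l := 7) hQ (-3) (-1)
  have a5 := appellPow_neg (l := 7) hQ (-6) (-3)
  have b1 := lser_neg h0 3 3 3
  have b2 := lser_neg h0 3 6 3
  have b3 := lser_neg h0 3 1 2
  have b4 := lser_neg h0 3 1 1
  have b5 := lser_neg h0 3 6 2
  have b6 := lser_neg h0 3 4 1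
  norm_num at a1 a2 a3 a4 a5 b1 b2 b3 b4 b5 b6
  rw [b1, b2, b3, b4, b5, b6]
  refine ⟨?_, ?_, rfl, ?_, ?_, ?_, ?_, ?_, ?_, ?_, ?_, ?_⟩ <;>
  · simp only [lser_eq]
    norm_num [tri, a1, a2, a3, a4, a5]
    try field_simp

/-- The groups are the classes of `eulerNumSeven` times the three-term `thetaR q (ζ ^ 3)`. The sign
condition is required on a whole punctured disc because the projection samples every ζ^j q. -/
theorem proj_anPrefactor_seven (h0 : q ≠ 0) {r : ℝ} (hr1 : r ≤ 1) (h1 : ‖q‖ < r)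
    (hr : ∀ q : ℂ, q ≠ 0 → ‖q‖ < r →
      pochInf q q * (thetaPow 7 (q ^ 7) 3 * thetaPow 7 (q ^ 7) 2 * thetaPow 7 (q ^ 7) 1) +
        pochInf ((q ^ 7) ^ 7) ((q ^ 7) ^ 7) * eulerNumSeven q ≠ 0)
    {ζ α β γ : ℂ} (hζ : IsPrimitiveRoot ζ 7)
    (hα : α = 2 - (ζ ^ 3 + ζ ^ 4)) (hβ : β = (ζ + ζ ^ 6) - (ζ ^ 3 + ζ ^ 4))
    (hγ : γ = (ζ + ζ ^ 6) - (ζ ^ 2 + ζ ^ 5)) (a : ℤ) :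
    7 * (thetaPow 7 (q ^ 7) 3 * thetaPow 7 (q ^ 7) 2 * thetaPow 7 (q ^ 7) 1) ^ 2 *
      proj ζ 7 a (fun q => anPrefactor ζ (ζ ^ 2) q) q =
        pochInf ((q ^ 7) ^ 7) ((q ^ 7) ^ 7) ^ 3 * (7 *
      ((if (7 : ℤ) ∣ 0 - a then α * thetaPow 7 (q ^ 7) 3 ^ 2 * thetaPow 7 (q ^ 7) 2 ^ 2 else 0) +
      (if (7 : ℤ) ∣ 1 - a then q * (β * thetaPow 7 (q ^ 7) 3 * thetaPow 7 (q ^ 7) 2 ^ 3 -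
        α * thetaPow 7 (q ^ 7) 3 ^ 3 * thetaPow 7 (q ^ 7) 1 +
        γ * q ^ 7 * thetaPow 7 (q ^ 7) 2 * thetaPow 7 (q ^ 7) 1 ^ 3) else 0) +
      (if (7 : ℤ) ∣ 2 - a then -q ^ 2 * ((α + β) * thetaPow 7 (q ^ 7) 3 ^ 2 *
        thetaPow 7 (q ^ 7) 2 * thetaPow 7 (q ^ 7) 1) else 0) +
      (if (7 : ℤ) ∣ 3 - a then q ^ 3 * ((γ - β) * thetaPow 7 (q ^ 7) 3 *
        thetaPow 7 (q ^ 7) 2 ^ 2 * thetaPow 7 (q ^ 7) 1) else 0) +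
      (if (7 : ℤ) ∣ 4 - a then -q ^ 4 * (γ * thetaPow 7 (q ^ 7) 3 ^ 2 *
        thetaPow 7 (q ^ 7) 1 ^ 2) else 0) +
      (if (7 : ℤ) ∣ 5 - a then q ^ 5 * ((α - γ) * thetaPow 7 (q ^ 7) 3 *
        thetaPow 7 (q ^ 7) 2 * thetaPow 7 (q ^ 7) 1 ^ 2) else 0) +
      (if (7 : ℤ) ∣ 6 - a then q ^ 6 * (β * thetaPow 7 (q ^ 7) 2 ^ 2 *
        thetaPow 7 (q ^ 7) 1 ^ 2) else 0))) := by
  have hl : (7 : ℕ) ≠ 0 := by norm_num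
  have h : ∀ q : ℂ, q ≠ 0 → ‖q‖ < r →
      7 * (thetaPow 7 (q ^ 7) 3 * thetaPow 7 (q ^ 7) 2 * thetaPow 7 (q ^ 7) 1) ^ 2 *
        anPrefactor ζ (ζ ^ 2) q = pochInf ((q ^ 7) ^ 7) ((q ^ 7) ^ 7) ^ 3 * (
      q ^ 0 * (α * thetaPow 7 (q ^ 7) 3 ^ 2 * thetaPow 7 (q ^ 7) 2 ^ 2) +
      q ^ 1 * (β * thetaPow 7 (q ^ 7) 3 * thetaPow 7 (q ^ 7) 2 ^ 3 -
        α * thetaPow 7 (q ^ 7) 3 ^ 3 * thetaPow 7 (q ^ 7) 1 +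
        γ * q ^ 7 * thetaPow 7 (q ^ 7) 2 * thetaPow 7 (q ^ 7) 1 ^ 3) +
      q ^ 2 * (-((α + β) * thetaPow 7 (q ^ 7) 3 ^ 2 * thetaPow 7 (q ^ 7) 2 * thetaPow 7 (q ^ 7) 1)) +
      q ^ 3 * ((γ - β) * thetaPow 7 (q ^ 7) 3 * thetaPow 7 (q ^ 7) 2 ^ 2 * thetaPow 7 (q ^ 7) 1) +
      q ^ 4 * (-(γ * thetaPow 7 (q ^ 7) 3 ^ 2 * thetaPow 7 (q ^ 7) 1 ^ 2)) +
      q ^ 5 * ((α - γ) * thetaPow 7 (q ^ 7) 3 * thetaPow 7 (q ^ 7) 2 * thetaPow 7 (q ^ 7) 1 ^ 2) +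
      q ^ 6 * (β * thetaPow 7 (q ^ 7) 2 ^ 2 * thetaPow 7 (q ^ 7) 1 ^ 2)) := fun q h0 h1 => by
    rw [euler_mul_thetaPow_seven h0 (h1.trans_le hr1) (hr q h0 h1) hζ,
      thetaR_cube_seven h0 (h1.trans_le hr1) hζ, ← hα, ← hβ, ← hγ, eulerNumSeven]
    ring
  have h2 := proj_congr (hζ.norm'_eq_one hl) 7 a h h0 h1
  rw [proj_mul hl hζ a (fun x => 7 * (thetaPow 7 x 3 * thetaPow 7 x 2 * thetaPow 7 x 1) ^ 2) _ h0,
    proj_mul hl hζ a (fun x => pochInf (x ^ 7) (x ^ 7) ^ 3) _ h0,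
    proj_add, proj_add, proj_add, proj_add, proj_add, proj_add,
    proj_pow_mul hl hζ a 0 (fun x => α * thetaPow 7 x 3 ^ 2 * thetaPow 7 x 2 ^ 2) h0,
    proj_pow_mul hl hζ a 1 (fun x => β * thetaPow 7 x 3 * thetaPow 7 x 2 ^ 3 -
        α * thetaPow 7 x 3 ^ 3 * thetaPow 7 x 1 + γ * x * thetaPow 7 x 2 * thetaPow 7 x 1 ^ 3) h0,
    proj_pow_mul hl hζ a 2 (fun x => -((α + β) * thetaPow 7 x 3 ^ 2 * thetaPow 7 x 2 * thetaPow 7 x 1)) h0,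
    proj_pow_mul hl hζ a 3 (fun x => (γ - β) * thetaPow 7 x 3 * thetaPow 7 x 2 ^ 2 * thetaPow 7 x 1) h0,
    proj_pow_mul hl hζ a 4 (fun x => -(γ * thetaPow 7 x 3 ^ 2 * thetaPow 7 x 1 ^ 2)) h0,
    proj_pow_mul hl hζ a 5 (fun x => (α - γ) * thetaPow 7 x 3 * thetaPow 7 x 2 * thetaPow 7 x 1 ^ 2) h0,
    proj_pow_mul hl hζ a 6 (fun x => β * thetaPow 7 x 2 ^ 2 * thetaPow 7 x 1 ^ 2) h0] at h2
  rw [h2]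
  push_cast
  simp only [mul_add (7 : ℂ)]
  congr 1
  congr 1
  · congr 1
    · congr 1
      · congr 1
        · congr 1
          · congr 1
            · split_ifs <;> ring
            · split_ifs <;> ring
          · split_ifs <;> ring
        · split_ifs <;> ring
      · split_ifs <;> ring
    · split_ifs <;> ring
  · split_ifs <;> ring

/-- Two equations cannot isolate one of three theta functions; eliminating the first or the second
leaves two terms each time. -/
theorem fullSeries_seven (h0 : q ≠ 0) (h1 : ‖q‖ < 1) {ζ : ℂ} (hζ : IsPrimitiveRoot ζ 7) :
    7 * (1 + ζ) * (1 + ζ ^ 2) * (((ζ ^ 2 + ζ ^ 5) * q * thetaPow 7 (q ^ 7) 2 +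
      ((ζ + ζ ^ 6) + (ζ ^ 2 + ζ ^ 5)) * q ^ 3 * thetaPow 7 (q ^ 7) 1) * fullSeries 1 ζ (ζ ^ 2) q) =
      (2 - (ζ ^ 2 + ζ ^ 5)) * (1 + ζ ^ 2) * phiF q ζ (ζ ^ 2) -
        (2 - (ζ + ζ ^ 6)) * (1 + ζ) * phiF q (ζ ^ 2) ζ ∧
    7 * (1 + ζ) * (1 + ζ ^ 2) * (((ζ ^ 2 + ζ ^ 5) * thetaPow 7 (q ^ 7) 3 +
      q ^ 3 * thetaPow 7 (q ^ 7) 1) * fullSeries 1 ζ (ζ ^ 2) q) =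
      ((ζ ^ 2 + ζ ^ 5) - (ζ + ζ ^ 6)) * (1 + ζ) * phiF q (ζ ^ 2) ζ -
        ((ζ ^ 3 + ζ ^ 4) - (ζ ^ 2 + ζ ^ 5)) * (1 + ζ ^ 2) * phiF q ζ (ζ ^ 2) := by
  have hn : ‖ζ‖ = 1 := hζ.norm'_eq_one (by norm_num)
  have hn2 : ‖ζ ^ 2‖ = 1 := by simp [hn]
  have hw : IsPrimitiveRoot (ζ ^ 2) 7 := hζ.pow_of_coprime 2 (by norm_num)
  obtain ⟨r3, r2, r1⟩ := root_relations_seven hζ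
  rw [← thetaR_mul_anSeries_one h0 h1 hn hn2 (hζ.ne_one (by norm_num)) (hw.ne_one (by norm_num))
    (one_add_ne_zero_of_isPrimitiveRoot (by norm_num) hζ),
    ← thetaR_mul_anSeries_one h0 h1 hn2 hn (hw.ne_one (by norm_num)) (hζ.ne_one (by norm_num))
    (one_add_ne_zero_of_isPrimitiveRoot (by norm_num) hw), ← fullSeries, ← fullSeries,
    fullSeries_symm 1 (ζ ^ 2), thetaR_seven h0 h1 hζ, thetaR_square_seven h0 h1 hζ]
  generalize thetaPow 7 (q ^ 7) 1 = Z
  generalize thetaPow 7 (q ^ 7) 2 = Y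
  generalize thetaPow 7 (q ^ 7) 3 = X
  generalize fullSeries 1 ζ (ζ ^ 2) q = S
  rw [r3, r2]
  generalize (1 + ζ) = k1
  generalize (1 + ζ ^ 2) = k2
  generalize ζ + ζ ^ 6 = c at *
  clear * - r1
  constructor
  · grind
  · grind

theorem proj_fullSeries_seven (h0 : q ≠ 0) (h1 : ‖q‖ < 1) {ζ : ℂ} (hζ : IsPrimitiveRoot ζ 7) (a : ℤ) :
    7 * (1 + ζ) * (1 + ζ ^ 2) * ((ζ ^ 2 + ζ ^ 5) * q * thetaPow 7 (q ^ 7) 2 *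
      proj ζ 7 (a - 1) (fullSeries 1 ζ (ζ ^ 2)) q +
      ((ζ + ζ ^ 6) + (ζ ^ 2 + ζ ^ 5)) * q ^ 3 * thetaPow 7 (q ^ 7) 1 *
      proj ζ 7 (a - 3) (fullSeries 1 ζ (ζ ^ 2)) q) =
      (2 - (ζ ^ 2 + ζ ^ 5)) * (1 + ζ ^ 2) * proj ζ 7 a (fun q => phiF q ζ (ζ ^ 2)) q -
        (2 - (ζ + ζ ^ 6)) * (1 + ζ) * proj ζ 7 a (fun q => phiF q (ζ ^ 2) ζ) q ∧
    7 * (1 + ζ) * (1 + ζ ^ 2) * ((ζ ^ 2 + ζ ^ 5) * thetaPow 7 (q ^ 7) 3 *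
      proj ζ 7 a (fullSeries 1 ζ (ζ ^ 2)) q +
      q ^ 3 * thetaPow 7 (q ^ 7) 1 * proj ζ 7 (a - 3) (fullSeries 1 ζ (ζ ^ 2)) q) =
      ((ζ ^ 2 + ζ ^ 5) - (ζ + ζ ^ 6)) * (1 + ζ) * proj ζ 7 a (fun q => phiF q (ζ ^ 2) ζ) q -
        ((ζ ^ 3 + ζ ^ 4) - (ζ ^ 2 + ζ ^ 5)) * (1 + ζ ^ 2) * proj ζ 7 a (fun q => phiF q ζ (ζ ^ 2)) q := by
  have hl : (7 : ℕ) ≠ 0 := by norm_num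
  have hn : ‖ζ‖ = 1 := hζ.norm'_eq_one hl
  constructor
  · have h : ∀ q : ℂ, q ≠ 0 → ‖q‖ < 1 →
        q ^ 1 * (7 * (1 + ζ) * (1 + ζ ^ 2) * (ζ ^ 2 + ζ ^ 5) * thetaPow 7 (q ^ 7) 2) *
          fullSeries 1 ζ (ζ ^ 2) q +
        q ^ 3 * (7 * (1 + ζ) * (1 + ζ ^ 2) * ((ζ + ζ ^ 6) + (ζ ^ 2 + ζ ^ 5)) * thetaPow 7 (q ^ 7) 1) *
          fullSeries 1 ζ (ζ ^ 2) q =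
        (2 - (ζ ^ 2 + ζ ^ 5)) * (1 + ζ ^ 2) * phiF q ζ (ζ ^ 2) -
          (2 - (ζ + ζ ^ 6)) * (1 + ζ) * phiF q (ζ ^ 2) ζ := fun q h0 h1 => by
      rw [← (fullSeries_seven h0 h1 hζ).1]
      ring
    have h2 := proj_congr hn 7 a h h0 h1
    rw [proj_add, proj_pow_mul_mul hl hζ a 1
        (fun x => 7 * (1 + ζ) * (1 + ζ ^ 2) * (ζ ^ 2 + ζ ^ 5) * thetaPow 7 x 2) _ h0,
      proj_pow_mul_mul hl hζ a 3 (fun x => 7 * (1 + ζ) * (1 + ζ ^ 2) *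
        ((ζ + ζ ^ 6) + (ζ ^ 2 + ζ ^ 5)) * thetaPow 7 x 1) _ h0,
      proj_sub, proj_const_mul, proj_const_mul] at h2
    push_cast at h2
    linear_combination h2
  · have h : ∀ q : ℂ, q ≠ 0 → ‖q‖ < 1 →
        7 * (1 + ζ) * (1 + ζ ^ 2) * (ζ ^ 2 + ζ ^ 5) * thetaPow 7 (q ^ 7) 3 *
          fullSeries 1 ζ (ζ ^ 2) q +
        q ^ 3 * (7 * (1 + ζ) * (1 + ζ ^ 2) * thetaPow 7 (q ^ 7) 1) * fullSeries 1 ζ (ζ ^ 2) q =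
        ((ζ ^ 2 + ζ ^ 5) - (ζ + ζ ^ 6)) * (1 + ζ) * phiF q (ζ ^ 2) ζ -
          ((ζ ^ 3 + ζ ^ 4) - (ζ ^ 2 + ζ ^ 5)) * (1 + ζ ^ 2) * phiF q ζ (ζ ^ 2) := fun q h0 h1 => by
      rw [← (fullSeries_seven h0 h1 hζ).2]
      ring
    have h2 := proj_congr hn 7 a h h0 h1
    rw [proj_add, proj_mul hl hζ a
        (fun x => 7 * (1 + ζ) * (1 + ζ ^ 2) * (ζ ^ 2 + ζ ^ 5) * thetaPow 7 x 3) _ h0,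
      proj_pow_mul_mul hl hζ a 3 (fun x => 7 * (1 + ζ) * (1 + ζ ^ 2) * thetaPow 7 x 1) _ h0,
      proj_sub, proj_const_mul, proj_const_mul] at h2
    push_cast at h2
    linear_combination h2

end SevenClasses

end RankQuadruples

namespace RankQuadruples

open Filter Topology

/-! ### Modulus 7: vanishing of the classes 0 and 5 -/

section VanishingModSeven

variable {q : ℂ}

/-- The combinations of classes of `phiF` that determine the classes `0`, `3`, `5` of `fullSeries`. -/
theorem proj_phiF_seven (h0 : q ≠ 0) (h1 : ‖q‖ < 1) {ζ : ℂ} (hζ : IsPrimitiveRoot ζ 7) :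
    ((2 - (ζ ^ 2 + ζ ^ 5)) * (1 + ζ ^ 2) * proj ζ 7 1 (fun q => phiF q ζ (ζ ^ 2)) q -
      (2 - (ζ + ζ ^ 6)) * (1 + ζ) * proj ζ 7 1 (fun q => phiF q (ζ ^ 2) ζ) q =
      7 * (1 + ζ) * (1 + ζ ^ 2) * (((ζ + ζ ^ 6) - (ζ ^ 2 + ζ ^ 5)) * q *
        (appellPow 7 (q ^ 7) (-5) (-2) - appellPow 7 (q ^ 7) (-2) 1))) ∧
    ((2 - (ζ ^ 2 + ζ ^ 5)) * (1 + ζ ^ 2) * proj ζ 7 6 (fun q => phiF q ζ (ζ ^ 2)) q -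
      (2 - (ζ + ζ ^ 6)) * (1 + ζ) * proj ζ 7 6 (fun q => phiF q (ζ ^ 2) ζ) q =
      7 * (1 + ζ) * (1 + ζ ^ 2) * ((6 * (ζ + ζ ^ 6) + 8 * (ζ ^ 2 + ζ ^ 5)) * q ^ 6 *
        appellPow 7 (q ^ 7) 0 3 + (-(ζ + ζ ^ 6) + 2 * (ζ ^ 2 + ζ ^ 5) - (ζ ^ 3 + ζ ^ 4)) * q⁻¹ *
        (appellPow 7 (q ^ 7) (-4) (-2) - appellPow 7 (q ^ 7) (-3) (-1)))) ∧
    (((ζ ^ 2 + ζ ^ 5) - (ζ + ζ ^ 6)) * (1 + ζ) * proj ζ 7 3 (fun q => phiF q (ζ ^ 2) ζ) q -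
      ((ζ ^ 3 + ζ ^ 4) - (ζ ^ 2 + ζ ^ 5)) * (1 + ζ ^ 2) * proj ζ 7 3 (fun q => phiF q ζ (ζ ^ 2)) q =
      7 * (1 + ζ) * (1 + ζ ^ 2) * (((ζ + ζ ^ 6) - 2 * (ζ ^ 2 + ζ ^ 5) + (ζ ^ 3 + ζ ^ 4)) * q ^ 3 *
        (appellPow 7 (q ^ 7) (-6) (-3) - appellPow 7 (q ^ 7) (-1) 2) +
        (2 * (ζ + ζ ^ 6) + 6 * (ζ ^ 2 + ζ ^ 5) - (ζ ^ 3 + ζ ^ 4)) * q ^ 3 * appellPow 7 (q ^ 7) 0 1)) := by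
  have hz := hζ.pow_eq_one
  have hw : IsPrimitiveRoot (ζ ^ 2) 7 := hζ.pow_of_coprime 2 (by norm_num)
  have A1 := proj_phiF (h := 3) hζ hz hw.pow_eq_one (hw.ne_one (by norm_num)) _ (factor_seven hw) 1 h0 h1
  have A2 := proj_phiF (h := 3) hζ hw.pow_eq_one hz (hζ.ne_one (by norm_num)) _ (factor_seven hζ) 1 h0 h1
  have B1 := proj_phiF (h := 3) hζ hz hw.pow_eq_one (hw.ne_one (by norm_num)) _ (factor_seven hw) 6 h0 h1
  have B2 := proj_phiF (h := 3) hζ hw.pow_eq_one hz (hζ.ne_one (by norm_num)) _ (factor_seven hζ) 6 h0 h1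
  have C1 := proj_phiF (h := 3) hζ hz hw.pow_eq_one (hw.ne_one (by norm_num)) _ (factor_seven hw) 3 h0 h1
  have C2 := proj_phiF (h := 3) hζ hw.pow_eq_one hz (hζ.ne_one (by norm_num)) _ (factor_seven hζ) 3 h0 h1
  have hi : ∀ a b : ℕ, a + b = 7 → (ζ ^ a)⁻¹ = ζ ^ b := fun a b hab =>
    inv_eq_of_mul_eq_one_right (by rw [← pow_add, hab, hz])
  have i1 : ζ⁻¹ = ζ ^ 6 := by simpa using hi 1 6 rfl
  have i2 := hi 2 5 rfl
  have i3 := hi 3 4 rfl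
  have i4 := hi 4 3 rfl
  have i5 := hi 6 1 rfl
  obtain ⟨l1, l2, l3, l4, l5, l6, l7, l8, l9, l10, l11, l12⟩ := lser_seven h0
  norm_num [Finset.sum_range_succ, tri, numSeven] at A1 A2 B1 B2 C1 C2
  simp only [l1, l2, l3, l4, l5, l6, l7, l8, l9, l10, l11, l12, i1, i2, i3, i4, i5, ← pow_mul,
    Nat.reduceMul, pow_one] at A1 A2 B1 B2 C1 C2
  have hg := geom_seven hζ
  rw [A1, A2, B1, B2, C1, C2]
  generalize lser 3 3 3 q = L
  generalize appellPow 7 (q ^ 7) (-5) (-2) = P1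
  generalize appellPow 7 (q ^ 7) (-2) 1 = P2
  generalize appellPow 7 (q ^ 7) (-4) (-2) = P3
  generalize appellPow 7 (q ^ 7) (-3) (-1) = P4
  generalize appellPow 7 (q ^ 7) (-6) (-3) = P5
  generalize appellPow 7 (q ^ 7) (-1) 2 = P6
  generalize appellPow 7 (q ^ 7) 0 1 = P7
  generalize appellPow 7 (q ^ 7) 0 3 = P8
  generalize q⁻¹ = q'
  generalize q ^ 6 = q6
  generalize q ^ 3 = q3
  clear * - hg
  refine ⟨?_, ?_, ?_⟩
  · grind
  · grind
  · grind

theorem eventually_proj_seven {ζ : ℂ} (hζ : IsPrimitiveRoot ζ 7) : ∀ᶠ q in 𝓝[≠] (0 : ℂ),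
    proj ζ 7 0 (fun q => anSeries 1 ζ (ζ ^ 2) q) q = 0 ∧
      proj ζ 7 5 (fun q => anSeries 1 ζ (ζ ^ 2) q) q = 0 := by
  obtain ⟨r3, r2, r1⟩ := root_relations_seven hζ
  -- With c = ζ + ζ⁶ this number is c² - 2, and the cubic of c reads (c + 1)(c² - 2) + 1 = 0.
  have hc : (ζ ^ 2 + ζ ^ 5) ≠ 0 := by
    intro h
    rw [h] at r2
    generalize ζ + ζ ^ 6 = c at *
    exact one_ne_zero (by linear_combination r1 + (c + 1) * r2 : (1 : ℂ) = 0)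
  have hζ0 := hζ.ne_zero (by norm_num)
  have hev := eventually_ne_zero_seven (c := (ζ ^ 2 + ζ ^ 5) ^ 3)
    (d := ((ζ + ζ ^ 6) + (ζ ^ 2 + ζ ^ 5)) ^ 2) (pow_ne_zero 3 hc)
  rw [eventually_nhdsWithin_iff, Metric.eventually_nhds_iff] at hev
  obtain ⟨ε, hε, hev⟩ := hev
  have hr : ∀ q : ℂ, q ≠ 0 → ‖q‖ < min ε 1 → _ := fun q h0 h1 =>
    hev (by rw [dist_zero_right]; exact h1.trans_le (min_le_left _ _)) h0
  have hball : ∀ᶠ q in 𝓝[≠] (0 : ℂ), ‖q‖ < min ε 1 :=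
    nhdsWithin_le_nhds (by
      simpa [ball_zero_eq] using Metric.ball_mem_nhds (0 : ℂ) (lt_min hε one_pos))
  filter_upwards [hball, eventually_small_ne_zero] with q hq ⟨h0, h1⟩
  have hQ : q ^ 7 ≠ 0 := pow_ne_zero _ h0
  have hQ1 : ‖q ^ 7‖ < 1 := norm_pow_lt_one h1 (by norm_num)
  have hdet := (hr q h0 hq).2
  have P0 := proj_anPrefactor_seven h0 (min_le_right _ _) hq (fun q h0 h1 => (hr q h0 h1).1) hζ rfl rfl rfl 0
  have P5 := proj_anPrefactor_seven h0 (min_le_right _ _) hq (fun q h0 h1 => (hr q h0 h1).1) hζ rfl rfl rfl 5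
  norm_num at P0 P5
  -- Three equations for three classes: `C1` links 0 and 5, `C2` links 5 and 3, `C3` links 3 and 0.
  obtain ⟨C1, C2, C3⟩ := proj_phiF_seven h0 h1 hζ
  rw [← (proj_fullSeries_seven h0 h1 hζ 1).1] at C1
  rw [← (proj_fullSeries_seven h0 h1 hζ 6).1] at C2
  rw [← (proj_fullSeries_seven h0 h1 hζ 3).2] at C3
  have hn : 7 * (1 + ζ) * (1 + ζ ^ 2) ≠ 0 :=
    mul_ne_zero (mul_ne_zero (by norm_num) (one_add_ne_zero_of_isPrimitiveRoot (by norm_num) hζ))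
      (one_add_ne_zero_of_isPrimitiveRoot (by norm_num) (hζ.pow_of_coprime 2 (by norm_num)))
  replace C1 := mul_left_cancel₀ hn C1
  replace C2 := mul_left_cancel₀ hn C2
  replace C3 := mul_left_cancel₀ hn C3
  have hF : ∀ a, proj ζ 7 a (fullSeries 1 ζ (ζ ^ 2)) q =
      proj ζ 7 a (fun q => anSeries 1 ζ (ζ ^ 2) q) q +
        proj ζ 7 a (fun q => anPrefactor ζ (ζ ^ 2) q) q := fun a => proj_add _ _ _ _ _ _
  have hm : ∀ f : ℂ → ℂ, proj ζ 7 (-2) f q = proj ζ 7 5 f q := fun f => by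
    simpa using proj_sub_natCast hζ.pow_eq_one hζ0 5 f
  simp only [hF] at C1 C2 C3
  norm_num [hm] at C1 C2 C3
  have hK := klein_quartic hQ hQ1
  obtain ⟨H1, H2, H3, H4, H5⟩ := appellPow_seven hQ hQ1
  have nZ : thetaPow 7 (q ^ 7) 1 ≠ 0 := thetaPow_ne_zero (by norm_num) hQ hQ1 (by norm_num)
  have nY : thetaPow 7 (q ^ 7) 2 ≠ 0 := thetaPow_ne_zero (by norm_num) hQ hQ1 (by norm_num)
  have nX : thetaPow 7 (q ^ 7) 3 ≠ 0 := thetaPow_ne_zero (by norm_num) hQ hQ1 (by norm_num)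
  have hq' : q * q⁻¹ = 1 := mul_inv_cancel₀ h0
  rw [r3] at P0 P5 C2 C3
  rw [r2] at P0 P5 C1 C2 C3 hdet
  rw [r2] at hc
  generalize proj ζ 7 0 (fun q => anPrefactor ζ (ζ ^ 2) q) q = p0 at *
  generalize proj ζ 7 3 (fun q => anPrefactor ζ (ζ ^ 2) q) q = p3 at *
  generalize proj ζ 7 5 (fun q => anPrefactor ζ (ζ ^ 2) q) q = p5 at *
  generalize proj ζ 7 0 (anSeries 1 ζ (ζ ^ 2)) q = f0 at *
  generalize proj ζ 7 3 (anSeries 1 ζ (ζ ^ 2)) q = f3 at *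
  generalize proj ζ 7 5 (anSeries 1 ζ (ζ ^ 2)) q = f5 at *
  generalize pochInf ((q ^ 7) ^ 7) ((q ^ 7) ^ 7) = J at *
  rw [show -ζ ^ 6 + -ζ = -(ζ + ζ ^ 6) by ring] at C2
  generalize ζ + ζ ^ 6 = c at *
  generalize thetaPow 7 (q ^ 7) 1 = Z at *
  generalize thetaPow 7 (q ^ 7) 2 = Y at *
  generalize thetaPow 7 (q ^ 7) 3 = X at *
  generalize appellPow 7 (q ^ 7) (-5) (-2) - appellPow 7 (q ^ 7) (-2) 1 = D1 at *
  generalize appellPow 7 (q ^ 7) (-4) (-2) - appellPow 7 (q ^ 7) (-3) (-1) = D2 at *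
  generalize appellPow 7 (q ^ 7) (-6) (-3) - appellPow 7 (q ^ 7) (-1) 2 = D3 at *
  generalize appellPow 7 (q ^ 7) 0 1 = A1 at *
  generalize appellPow 7 (q ^ 7) 0 3 = A3 at *
  have hJ0 : Z ^ 2 * p0 = (1 + c + c ^ 2) * J ^ 3 := by
    refine mul_left_cancel₀ (mul_ne_zero (pow_ne_zero 2 nX) (pow_ne_zero 2 nY)) ?_
    linear_combination P0 / 7
  have hJ5 : X * Y * p5 = q ^ 5 * (2 * c ^ 2 - 1) * J ^ 3 := by
    refine mul_left_cancel₀ (mul_ne_zero (mul_ne_zero nX nY) (pow_ne_zero 2 nZ)) ?_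
    linear_combination P5 / 7
  -- The added term n = 0 accounts for all of the evaluated Appell sums, by the Klein quartic and
  -- the cubic of c, so the equation for `f0` and `f5` is homogeneous.
  have E1 : (c ^ 2 - 2) * Y * f0 + (c + (c ^ 2 - 2)) * q ^ 2 * Z * f5 = 0 := by
    refine (mul_eq_zero.1 ?_).resolve_left
      (mul_ne_zero (mul_ne_zero (mul_ne_zero h0 nX) (pow_ne_zero 2 nY)) (pow_ne_zero 2 nZ))
    linear_combination X * Y ^ 2 * Z ^ 2 * C1 - (c ^ 2 - 2) * q * X * Y ^ 3 * hJ0 -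
      (c + (c ^ 2 - 2)) * q ^ 3 * Y * Z ^ 3 * hJ5 + (c - (c ^ 2 - 2)) * q * X * Z * H1 -
      (c - (c ^ 2 - 2)) * q * J ^ 3 * hK -
      (c * q * X * Y ^ 3 * J ^ 3 + 2 * c * q ^ 8 * Y * Z ^ 3 * J ^ 3) * r1
  -- Class 3 is eliminated between `C2` and `C3`, so neither `f3` nor `p3` has to be known.
  have E2 : (c ^ 2 - 2) ^ 2 * q * X * Y * f5 - (c + (c ^ 2 - 2)) * q ^ 6 * Z ^ 2 * f0 = 0 := by
    linear_combination (c ^ 2 - 2) * X * C2 - (c + (c ^ 2 - 2)) * q ^ 3 * Z * C3 +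
      (c ^ 2 - 2) * (6 * c + 8 * (c ^ 2 - 2)) * q ^ 6 * H5 +
      (c ^ 2 - 2) * (-c + 2 * (c ^ 2 - 2) - (-1 - c - (c ^ 2 - 2))) *
        (q⁻¹ * H2 + q ^ 6 * J ^ 3 * hq') -
      (c + (c ^ 2 - 2)) * q ^ 6 * ((c - 2 * (c ^ 2 - 2) + (-1 - c - (c ^ 2 - 2))) * H3 +
        (2 * c + 6 * (c ^ 2 - 2) - (-1 - c - (c ^ 2 - 2))) * H4) -
      (c ^ 2 - 2) ^ 2 * q * hJ5 + (c + (c ^ 2 - 2)) * q ^ 6 * hJ0 +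
      q ^ 6 * J ^ 3 * (-2 * c ^ 3 + 2 * c ^ 2 + 5 * c - 8) * r1
  -- Cramer's rule: the determinant of `E1` and `E2` is q times the expression in `hdet`.
  have h5 : f5 = 0 := by
    refine (mul_eq_zero.1 ?_).resolve_left (mul_ne_zero h0 hdet)
    linear_combination (c ^ 2 - 2) * Y * E2 + (c + (c ^ 2 - 2)) * q ^ 6 * Z ^ 2 * E1
  rw [h5, mul_zero, add_zero] at E1
  exact ⟨(mul_eq_zero.1 E1).resolve_left (mul_ne_zero hc nY), h5⟩

theorem coeff_F_seven_zero {ζ : ℂ} (hζ : IsPrimitiveRoot ζ 7) (n : ℕ) :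
    PowerSeries.coeff (7 * n + 0) (F (ζ ^ 2) (ζ ^ 2)⁻¹ ζ) = 0 :=
  coeff_termSum_eq_zero le_rfl (by norm_num) hζ 0
    ((eventually_proj_seven hζ).mono fun _ h => by exact_mod_cast h.1) n

theorem coeff_F_seven_five {ζ : ℂ} (hζ : IsPrimitiveRoot ζ 7) (n : ℕ) :
    PowerSeries.coeff (7 * n + 5) (F (ζ ^ 2) (ζ ^ 2)⁻¹ ζ) = 0 :=
  coeff_termSum_eq_zero le_rfl (by norm_num) hζ 5
    ((eventually_proj_seven hζ).mono fun _ h => by exact_mod_cast h.2) n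

end VanishingModSeven

end RankQuadruples

/-! ### Rank interpretation, equal classes and congruences -/

theorem theorem1p3 :
    -- the coefficients of the two series count quadruples by rank
    (∀ (m : ℤ) (n : ℕ), ru m n = (uRankCount m n : ℚ)) ∧
    (∀ (m : ℤ) (n : ℕ), rv m n = (vRankCount m n : ℚ)) ∧
    -- the residue of the rank divides the quadruples into equal classes
    (∀ (n : ℕ) (k : ℤ), 3 * uClass k 3 (3 * n) = u (3 * n)) ∧
    (∀ (n : ℕ) (k : ℤ), 3 * vClass k 3 (3 * n + 1) = v (3 * n + 1)) ∧
    (∀ (n : ℕ) (k : ℤ), 5 * uClass k 5 (5 * n) = u (5 * n)) ∧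
    (∀ (n : ℕ) (k : ℤ), 5 * uClass k 5 (5 * n + 3) = u (5 * n + 3)) ∧
    (∀ (n : ℕ) (k : ℤ), 5 * vClass k 5 (5 * n + 1) = v (5 * n + 1)) ∧
    (∀ (n : ℕ) (k : ℤ), 5 * vClass k 5 (5 * n + 4) = v (5 * n + 4)) ∧
    (∀ (n : ℕ) (k : ℤ), 7 * uClass k 7 (7 * n) = u (7 * n)) ∧
    (∀ (n : ℕ) (k : ℤ), 7 * uClass k 7 (7 * n + 5) = u (7 * n + 5)) ∧
    -- the congruences
    (∀ n : ℕ, u (3 * n) ≡ 0 [MOD 3]) ∧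
    (∀ n : ℕ, v (3 * n + 1) ≡ 0 [MOD 3]) ∧
    (∀ n : ℕ, u (5 * n) ≡ 0 [MOD 5]) ∧
    (∀ n : ℕ, u (5 * n + 3) ≡ 0 [MOD 5]) ∧
    (∀ n : ℕ, v (5 * n + 1) ≡ 0 [MOD 5]) ∧
    (∀ n : ℕ, v (5 * n + 4) ≡ 0 [MOD 5]) ∧
    (∀ n : ℕ, u (7 * n) ≡ 0 [MOD 7]) ∧
    (∀ n : ℕ, u (7 * n + 5) ≡ 0 [MOD 7]) := by
  have h3 : IsPrimitiveRoot (Complex.exp (2 * Real.pi * Complex.I / (3 : ℕ))) 3 :=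
    Complex.isPrimitiveRoot_exp 3 (by norm_num)
  have h5 : IsPrimitiveRoot (Complex.exp (2 * Real.pi * Complex.I / (5 : ℕ))) 5 :=
    Complex.isPrimitiveRoot_exp 5 (by norm_num)
  have h7 : IsPrimitiveRoot (Complex.exp (2 * Real.pi * Complex.I / (7 : ℕ))) 7 :=
    Complex.isPrimitiveRoot_exp 7 (by norm_num)
  have e1 := fun (n : ℕ) (k : ℤ) =>
    mul_uClass (by norm_num) (by norm_num) h3 (coeff_F_three h3 n) k
  have e2 := fun (n : ℕ) (k : ℤ) =>
    mul_vClass (by norm_num) (by norm_num) h3 (coeff_G_three h3 n) k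
  have e3 := fun (n : ℕ) (k : ℤ) =>
    mul_uClass (by norm_num) (by norm_num) h5 (coeff_F_five_zero h5 n) k
  have e4 := fun (n : ℕ) (k : ℤ) =>
    mul_uClass (by norm_num) (by norm_num) h5 (coeff_F_five_three h5 n) k
  have e5 := fun (n : ℕ) (k : ℤ) =>
    mul_vClass (by norm_num) (by norm_num) h5 (coeff_G_five_one h5 n) k
  have e6 := fun (n : ℕ) (k : ℤ) =>
    mul_vClass (by norm_num) (by norm_num) h5 (coeff_G_five_four h5 n) k
  have e7 := fun (n : ℕ) (k : ℤ) =>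
    mul_uClass (by norm_num) (by norm_num) h7 (coeff_F_seven_zero h7 n) k
  have e8 := fun (n : ℕ) (k : ℤ) =>
    mul_uClass (by norm_num) (by norm_num) h7 (coeff_F_seven_five h7 n) k
  simp only [add_zero] at e1 e3 e7
  exact ⟨ru_eq, rv_eq, e1, e2, e3, e4, e5, e6, e7, e8,
    fun n => (Nat.modEq_zero_iff_dvd).2 ⟨_, (e1 n 0).symm⟩,
    fun n => (Nat.modEq_zero_iff_dvd).2 ⟨_, (e2 n 0).symm⟩,
    fun n => (Nat.modEq_zero_iff_dvd).2 ⟨_, (e3 n 0).symm⟩,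
    fun n => (Nat.modEq_zero_iff_dvd).2 ⟨_, (e4 n 0).symm⟩,
    fun n => (Nat.modEq_zero_iff_dvd).2 ⟨_, (e5 n 0).symm⟩,
    fun n => (Nat.modEq_zero_iff_dvd).2 ⟨_, (e6 n 0).symm⟩,
    fun n => (Nat.modEq_zero_iff_dvd).2 ⟨_, (e7 n 0).symm⟩,
    fun n => (Nat.modEq_zero_iff_dvd).2 ⟨_, (e8 n 0).symm⟩⟩
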